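/- **Theorem 2 (sampling task).** *Setting.* Let $\mathcal H_n=(\mathbb C^d)^{\otimes n}$ and let $G$ be a compact (e.g. finite) group with normalized Haar measure. Let $U_1,\dots,U_D$ be continuous unitary representations of $G$ on $\mathcal H_n$, let $W_1,\dots,W_D$ be unitaries, and put $C(\boldsymbol g)=U_1(g_1)W_1\cdots U_D(g_D)W_D$ for $\boldsymbol g\in\mathbb G=G^{D}$. For each layer $i$ fix a Hilbert–Schmidt orthonormal operator basis of irreducible tensor operators $T^{\lambda,\alpha}_k$, where $\lambda$ runs over the inequivalent irreps in $U_i\otimes U_i^*$, $\alpha$ over the multiplicity of $\lambda$, and $k=1,\dots,d_\lambda$; thus $U_i(g)T^{\lambda,\alpha}_kU_i(g)^\dagger=\sum_{k'}v^\lambda_{k'k}(g)T^{\lambda,\alpha}_{k'}$. A further such basis is fixed to the right of $W_D$ (for instance that of one of the layers). Write $\mathbf W_i=W_i\otimes W_i^*$, and let $\Pi_0$ be the projector onto the span of the basis operators of the layer in question that transform trivially. After each $U_i(g_i)$ a noise channel $\mathcal E_i$ acts, diagonal in the basis of the layer, $\mathcal E_i(T^{\lambda,\alpha}_k)=e_{\lambda,k}T^{\lambda,\alpha}_k$,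 with eigenvalues that do not depend on the multiplicity index $\alpha$. Let $p(\mathbf x,\boldsymbol g)$ and $\tilde p(\mathbf x,\boldsymbol g)$ be the probabilities of the outcome $\mathbf x\in\mathbb Z_d^n$ for the noiseless and the noisy circuit on input $|\mathbf 0\rangle$. For irreps $\boldsymbol\lambda=(\lambda_1,\dots,\lambda_D)$ of $\mathbb G$ let $\hat p(\mathbf x)(\boldsymbol\lambda)_{\mathbf k\mathbf k'}=\int p(\mathbf x,\boldsymbol g)\,\overline{v^{\boldsymbol\lambda}_{\mathbf k\mathbf k'}(\boldsymbol g)}\,d\boldsymbol g$ with $v^{\boldsymbol\lambda}_{\mathbf k\mathbf k'}(\boldsymbol g)=\prod_i v^{\lambda_i}_{k_ik_i'}(g_i)$ and $d_{\boldsymbol\lambda}=\prod_i d_{\lambda_i}$. For a truncation parameter $L$ put $$\tilde p^{\mathcal T}(\mathbf x,\boldsymbol g)=\sum_{\boldsymbol\lambda}d_{\boldsymbol\lambda}\sum_{\mathbf k,\mathbf k'}e_{\lambda_1,k_1}\cdots e_{\lambda_D,k_D}\,\hat p(\mathbf x)(\boldsymbol\lambda)_{\mathbf k\mathbf k'}\,v^{\boldsymbol\lambda}_{\mathbf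 k\mathbf k'}(\boldsymbol g),$$ where the outer sum is over the $\boldsymbol\lambda$ with at most $L$ non-trivial $\lambda_i$; let $p^{\mathcal T}$ be the same expression without the factors $e$. A *valid truncated path* is a choice of $(\lambda_i,\alpha_i,k_i,k_i')$ for every layer, with at most $L$ non-trivial $\lambda_i$, and of a final basis operator, such that all transfer coefficients $\langle\langle T^{\lambda_i,\alpha_i}_{k_i'}|\mathbf W_i|T^{\lambda_{i+1},\alpha_{i+1}}_{k_{i+1}}\rangle\rangle$ are non-zero. *Assumptions.* * **0.** Every irrep that occurs in a valid truncated path has dimension at most $d_{\max}=\mathrm{poly}(n)$, and the matrix coefficients $v^\lambda_{kk'}(g)$ and the noise eigenvalues of such irreps are computed in time $\mathrm{poly}(n)$. (For all irreps, the dimension and whether the irrep is trivial can be read off its label in time $\mathrm{poly}(n)$.) * **1.** Each $\mathbf W_i$ maps every basis operator either entirely into the trivial subspace or into its orthogonal complement, and so does each $\mathbf W_i^\dagger$. Moreover, for every basis operator $T$ of a layer $i$, there are in total (over all $J$) at most $s=\mathrm{poly}(n)$ basis operators $T'$ with $\langle\langle T|\mathbf W_i\Pi_0\mathbf W_{i+1}\Pi_0\cdots\Pi_0\mathbf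 W_{i+J}|T'\rangle\rangle\ne0$ at which the run of trivial layers ends, i.e. $T'$ is non-trivial or the end of the circuit is reached; the same holds for runs in the opposite direction. For given end layers these terms are computed in time $\mathrm{poly}(n)$. * **2.** For some $\gamma\in(0,1]$: $e_{\lambda,k}=1$ if $\lambda$ is trivial and $|e_{\lambda,k}|\le1-\gamma$ otherwise. * **3.** There is an $M$ such that each $\Pi_0\mathbf W_i\Pi_0\mathbf W_{i+1}\cdots\mathbf W_{i+M}\Pi_0$ whose $M+2$ projectors $\Pi_0$ belong to layers of the circuit has at most $\mathrm{cost(rank)}=\mathrm{poly}(n)$ non-zero terms $|T\rangle\rangle\langle\langle T'|$ in the basis, and they are computed in time $\mathrm{cost(contract\text{-}full)}=\mathrm{poly}(n)$. * All marginal sums $\sum\langle\mathbf x|T|\mathbf x\rangle$ of the basis operators at both ends of the circuit, over the $\mathbf x$ with prescribed values at an arbitrary set of positions, are computed in time $\mathrm{poly}(n)$, and $D=\mathrm{poly}(n)$. *Claim.* There is one classical algorithm (the same for all such circuits, using the subroutines named in the assumptions) that, for every $L$ with $(L+1)(M+2)\le D$ and every $\boldsymbol g$, outputs the value $\tilde p^{\mathcal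 T}(\mathbf x,\boldsymbol g)$ at any given $\mathbf x$, and any given marginal of $\tilde p^{\mathcal T}(\cdot,\boldsymbol g)$, in time at most $$\mathrm{cost(evaluate)}\,(s\,d_{\max})^{2L}\,D\,\mathrm{cost(rank)}\,\mathrm{cost(contract\text{-}full)}=O(D)\,\mathrm{poly}(n)\,(s\,d_{\max})^{2L},$$ where $\mathrm{cost(evaluate)}=\mathrm{poly}(n)$; the polynomials depend only on those in the assumptions, not on $L$, $\gamma$, $\boldsymbol g$ or the circuit. Moreover, whenever the residual anti-concentrates, $$\sum_{\mathbf x}\int|p-p^{\mathcal T}|^2\,d\boldsymbol g\le\frac{c}{d^n},$$ the error satisfies $$\|\tilde p-\tilde p^{\mathcal T}\|_{l_1(L^2(\mathbb G))}=\sum_{\mathbf x}\Big(\int|\tilde p(\mathbf x,\boldsymbol g)-\tilde p^{\mathcal T}(\mathbf x,\boldsymbol g)|^2\,d\boldsymbol g\Big)^{1/2}\le\sqrt c\,(1-\gamma)^L .$$ -/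

import Mathlib

open scoped BigOperators Matrix
open MeasureTheory

noncomputable section

namespace OpTrunc

/-! ## A machine model with a step count

A first-order recursive language over trees whose leaves are natural numbers and complex numbers.
Every elementary step costs one unit; calling an external subroutine costs one unit plus the
running time of the subroutine. Arithmetic on complex numbers is exact; they can be neither
compared nor converted to natural numbers, and natural numbers can only be added, subtracted and
compared. -/

/-- Machine values. The empty list is `nat 0`. -/
inductive Val where
  | nat (k : ℕ)
  | num (z : ℂ)
  | pair (a b : Val)

/-- Unary elementary operations. -/
inductive Op1 where
  | fst | snd | isPair | toNum | conj

/-- Binary elementary operations. -/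
inductive Op2 where
  | pair | add | sub | mul | lt

def Op1.apply : Op1 → Val → Option Val
  | .fst, .pair a _ => some a
  | .snd, .pair _ b => some b
  | .isPair, .pair _ _ => some (.nat 1)
  | .isPair, _ => some (.nat 0)
  | .toNum, .nat k => some (.num (k : ℂ))
  | .conj, .num z => some (.num (star z))
  | _, _ => none

def Op2.apply : Op2 → Val → Val → Option Val
  | .pair, a, b => some (.pair a b)
  | .add, .nat a, .nat b => some (.nat (a + b))
  | .add, .num a, .num b => some (.num (a + b))
  | .sub, .nat a, .nat b => some (.nat (a - b))
  | .sub, .num a, .num b => some (.num (a - b))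
  | .mul, .num a, .num b => some (.num (a * b))
  | .lt, .nat a, .nat b => some (.nat (if a < b then 1 else 0))
  | _, _, _ => none

/-- Terms of the language; variables are de Bruijn indices. -/
inductive Code where
  | var (i : ℕ)
  | const (k : ℕ)
  | op1 (o : Op1) (e : Code)
  | op2 (o : Op2) (e₁ e₂ : Code)
  | ite (c e₁ e₂ : Code)
  | letIn (e₁ e₂ : Code)
  | call (f : ℕ) (e : Code)
  | query (e : Code)

/-- A program is a finite list of mutually recursive functions of one argument. -/
abbrev Program := List Code

/-- External subroutines: the answer to a request and the time that it takes. -/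
abbrev Oracle := Val → Option (Val × ℕ)

/-- `Eval P O env e v t`: in the environment `env` the term `e` evaluates to `v` in `t` steps. -/
inductive Eval (P : Program) (O : Oracle) : List Val → Code → Val → ℕ → Prop
  | var {env i v} : env[i]? = some v → Eval P O env (.var i) v 1
  | const {env k} : Eval P O env (.const k) (.nat k) 1
  | op1 {env o e v w t} : Eval P O env e v t → o.apply v = some w →
      Eval P O env (.op1 o e) w (t + 1)
  | op2 {env o e₁ e₂ v₁ v₂ w t₁ t₂} : Eval P O env e₁ v₁ t₁ → Eval P O env e₂ v₂ t₂ →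
      o.apply v₁ v₂ = some w → Eval P O env (.op2 o e₁ e₂) w (t₁ + t₂ + 1)
  | iteTrue {env c e₁ e₂ k v t₁ t₂} : Eval P O env c (.nat (k + 1)) t₁ → Eval P O env e₁ v t₂ →
      Eval P O env (.ite c e₁ e₂) v (t₁ + t₂ + 1)
  | iteFalse {env c e₁ e₂ v t₁ t₂} : Eval P O env c (.nat 0) t₁ → Eval P O env e₂ v t₂ →
      Eval P O env (.ite c e₁ e₂) v (t₁ + t₂ + 1)
  | letIn {env e₁ e₂ v₁ v₂ t₁ t₂} : Eval P O env e₁ v₁ t₁ → Eval P O (v₁ :: env) e₂ v₂ t₂ →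
      Eval P O env (.letIn e₁ e₂) v₂ (t₁ + t₂ + 1)
  | call {env f e body v w t₁ t₂} : P[f]? = some body → Eval P O env e v t₁ →
      Eval P O [v] body w t₂ → Eval P O env (.call f e) w (t₁ + t₂ + 1)
  | query {env e v w t τ} : Eval P O env e v t → O v = some (w, τ) →
      Eval P O env (.query e) w (t + τ + 1)

/-- Running function `0` of the program on an input. -/
def Program.Outputs (P : Program) (O : Oracle) (input output : Val) (t : ℕ) : Prop :=
  Eval P O [input] (.call 0 (.var 0)) output t

def Val.ofList : List Val → Val
  | [] => .nat 0
  | a :: l => .pair a (Val.ofList l)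

def Val.ofNats (l : List ℕ) : Val := Val.ofList (l.map Val.nat)

/-- The request `q` is answered within time `c` by a value that satisfies `ok`. -/
def Oracle.Answers (O : Oracle) (q : Val) (c : ℕ) (ok : Val → Prop) : Prop :=
  ∃ v τ, O q = some (v, τ) ∧ τ ≤ c ∧ ok v

/-! ## Operators on `n` qudits -/

/-- Outcomes of the measurement in the computational basis. -/
abbrev Outcome (n d : ℕ) := Fin n → Fin d

/-- Operators on the `n`-qudit space. -/
abbrev Op (n d : ℕ) := Matrix (Outcome n d) (Outcome n d) ℂ

variable {n d : ℕ} {G : Type*}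

/-- The Hilbert–Schmidt functional `⟨⟨A| : X ↦ tr (A† X)`. -/
def hs (A : Op n d) : Op n d →ₗ[ℂ] ℂ :=
  Matrix.traceLinearMap (Outcome n d) ℂ ℂ ∘ₗ LinearMap.mulLeft ℂ Aᴴ

/-- The superoperator `V ⊗ V* : X ↦ V X V†`. -/
def conjBy (V : Op n d) : Module.End ℂ (Op n d) :=
  LinearMap.mulLeft ℂ V ∘ₗ LinearMap.mulRight ℂ Vᴴ

/-- Quantum channels (completely positive trace-preserving maps), in Kraus form. -/
def IsChannel (Φ : Module.End ℂ (Op n d)) : Prop :=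
  ∃ (m : ℕ) (K : Fin m → Op n d), ∑ i, (K i)ᴴ * K i = 1 ∧ ∀ X, Φ X = ∑ i, K i * X * (K i)ᴴ

/-- The pure input state `|0⟩⟨0|`. -/
def inputState (n d : ℕ) [NeZero d] : Op n d := Matrix.single 0 0 1

/-! ## Irreducible tensor operators -/

/-- Irreducibility of a unitary matrix representation. -/
def IsIrrep [Group G] {m : ℕ} (v : G →* Matrix.unitaryGroup (Fin m) ℂ) : Prop :=
  0 < m ∧ ∀ S : Submodule ℂ (Fin m → ℂ),
    (∀ g, ∀ x ∈ S, (v g : Matrix (Fin m) (Fin m) ℂ) *ᵥ x ∈ S) → S = ⊥ ∨ S = ⊤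

/-- Equivalence of unitary matrix representations. -/
def AreEquivalent [Group G] {m m' : ℕ} (v : G →* Matrix.unitaryGroup (Fin m) ℂ)
    (v' : G →* Matrix.unitaryGroup (Fin m') ℂ) : Prop :=
  ∃ φ : (Fin m → ℂ) ≃ₗ[ℂ] (Fin m' → ℂ), ∀ g x,
    φ ((v g : Matrix (Fin m) (Fin m) ℂ) *ᵥ x) = (v' g : Matrix (Fin m') (Fin m') ℂ) *ᵥ φ x

/-- An orthonormal operator basis `T^{l,a}_k` of irreducible tensor operators for the unitary
representation `U`: `l` runs over the inequivalent irreps in `U ⊗ U*`, `a` over the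
multiplicity of `l`, and `k` over the components of `l`. -/
structure ITOBasis (n d : ℕ) [Group G] (U : G →* Matrix.unitaryGroup (Outcome n d) ℂ) where
  nIrr : ℕ
  dim : Fin nIrr → ℕ
  mult : Fin nIrr → ℕ
  mult_pos : ∀ l, 0 < mult l
  v : (l : Fin nIrr) → G →* Matrix.unitaryGroup (Fin (dim l)) ℂ
  irreducible : ∀ l, IsIrrep (v l)
  inequivalent : ∀ l l', l ≠ l' → ¬ AreEquivalent (v l) (v l')
  T : (l : Fin nIrr) → Fin (mult l) → Fin (dim l) → Op n d
  normalized : ∀ l a k, hs (T l a k) (T l a k) = 1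
  orthogonal : ∀ l a k l' a' k',
    (⟨l, a, k⟩ : (l : Fin nIrr) × Fin (mult l) × Fin (dim l)) ≠ ⟨l', a', k'⟩ →
    hs (T l a k) (T l' a' k') = 0
  complete : Submodule.span ℂ {X | ∃ l a k, T l a k = X} = ⊤
  transform : ∀ g l a k, conjBy (U g : Op n d) (T l a k) =
    ∑ k', (v l g : Matrix (Fin (dim l)) (Fin (dim l)) ℂ) k' k • T l a k'

/-! ## Noisy group-parametrised circuits -/

/-- The noisy circuit ensemble
`C(g) = U₀(g₀) W₀ U₁(g₁) W₁ ⋯ U_{D-1}(g_{D-1}) W_{D-1}`, with a noise channel after (to the left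
of) every `Uᵢ(gᵢ)`, diagonal in the ITO basis of the layer: the eigenvalue `e` depends on the
irrep and on the component. Only the layers `i < depth` belong to the circuit; the basis with
index `depth` is the one in which the operators to the right of the last `W` are expanded, and
what is further out is not used. -/
structure NoisyCircuit (n d : ℕ) (G : Type*) [Group G] [TopologicalSpace G] where
  depth : ℕ
  U : ℕ → G →* Matrix.unitaryGroup (Outcome n d) ℂ
  continuous_U : ∀ i, Continuous (U i)
  W : ℕ → Matrix.unitaryGroup (Outcome n d) ℂ
  basis : ∀ i, ITOBasis n d (U i)
  noise : ℕ → Module.End ℂ (Op n d)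
  noise_channel : ∀ i, IsChannel (noise i)
  e : ∀ i (l : Fin (basis i).nIrr), Fin ((basis i).dim l) → ℂ
  noise_diagonal : ∀ i l a k, noise i ((basis i).T l a k) = e i l k • (basis i).T l a k

namespace NoisyCircuit

variable [Group G] [TopologicalSpace G] (C : NoisyCircuit n d G)

/-- The inequivalent irreps in `Uᵢ ⊗ Uᵢ*`. -/
abbrev Irr (i : ℕ) := Fin (C.basis i).nIrr

/-- `l` is the trivial irrep. -/
def IsTriv (i : ℕ) (l : C.Irr i) : Prop := ∀ g, (C.basis i).v l g = 1

/-- The projector `Π₀` of layer `i` on the span of the basis operators that transform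
trivially. -/
def proj (i : ℕ) : Module.End ℂ (Op n d) :=
  open Classical in
  ∑ l, if C.IsTriv i l then ∑ a, ∑ k,
    (hs ((C.basis i).T l a k)).smulRight ((C.basis i).T l a k) else 0

/-- `Wᵢ ⊗ Wᵢ*`. -/
def superW (i : ℕ) : Module.End ℂ (Op n d) := conjBy (C.W i : Op n d)

/-- The adjoint `(Wᵢ ⊗ Wᵢ*)†`. -/
def superWAdj (i : ℕ) : Module.End ℂ (Op n d) := conjBy (C.W i : Op n d)ᴴ

/-- The contraction `Wᵢ Π₀ Wᵢ₊₁ Π₀ ⋯ Π₀ Wᵢ₊ₘ` (all as superoperators). -/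
def run (i : ℕ) : ℕ → Module.End ℂ (Op n d)
  | 0 => C.superW i
  | m + 1 => run i m * C.proj (i + m + 1) * C.superW (i + m + 1)

/-- The label of a basis operator: layer, irrep, multiplicity index, component. -/
structure Node where
  pos : ℕ
  irr : C.Irr pos
  mul : Fin ((C.basis pos).mult irr)
  comp : Fin ((C.basis pos).dim irr)

variable {C}

def Node.op (x : C.Node) : Op n d := (C.basis x.pos).T x.irr x.mul x.comp

def Node.IsTriv (x : C.Node) : Prop := C.IsTriv x.pos x.irr

def Node.enc (x : C.Node) : Val := Val.ofNats [x.pos, x.irr, x.mul, x.comp]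

/-- The value `⟨⟨T_x| W_p Π₀ W_{p+1} ⋯ Π₀ W_{q-1} |T_y⟩⟩` of the contraction between the basis
operators `x` of layer `p` and `y` of layer `q > p`. -/
def coef (x y : C.Node) : ℂ :=
  if x.pos < y.pos then hs x.op (C.run x.pos (y.pos - x.pos - 1) y.op) else 0

/-- The basis operators at which runs of trivial layers that start at `x` and go to the right
end: they are non-trivial, or the end of the circuit has been reached. -/
def rightChildren (x : C.Node) : Set C.Node :=
  {y | x.pos < y.pos ∧ y.pos ≤ C.depth ∧ coef x y ≠ 0 ∧ (y.pos = C.depth ∨ ¬ y.IsTriv)}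

/-- The basis operators at which runs of trivial layers that start at `y` and go to the left
end. -/
def leftChildren (y : C.Node) : Set C.Node :=
  {x | x.pos < y.pos ∧ coef x y ≠ 0 ∧ (x.pos = 0 ∨ ¬ x.IsTriv)}

variable (C)

/-- The non-zero terms `|T_x⟩⟩⟨⟨T_y|` of `Π₀ Wᵢ Π₀ ⋯ Wᵢ₊ₘ Π₀`. -/
def fullTerms (i M : ℕ) : Set (C.Node × C.Node) :=
  {z | z.1.pos = i ∧ z.2.pos = i + M + 1 ∧ z.1.IsTriv ∧ z.2.IsTriv ∧ coef z.1 z.2 ≠ 0}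

/-- A path of basis operators: `T^l_k → T^l_{k'}` at layer `i` (through `Uᵢ`), then
`T^l_{k'} → T^{l₁}_{k₁}` to layer `i + 1` (through `Wᵢ`), and so on. -/
structure Path where
  irr : ∀ i, C.Irr i
  mul : ∀ i, Fin ((C.basis i).mult (irr i))
  k : ∀ i, Fin ((C.basis i).dim (irr i))
  k' : ∀ i, Fin ((C.basis i).dim (irr i))

variable {C}

/-- The path is valid: all its transfer coefficients are non-zero. -/
def Path.IsValid (q : C.Path) : Prop :=
  ∀ i < C.depth, hs ((C.basis i).T (q.irr i) (q.mul i) (q.k' i))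
    (C.superW i ((C.basis (i + 1)).T (q.irr (i + 1)) (q.mul (i + 1)) (q.k (i + 1)))) ≠ 0

/-- At most `L` of the irreps along the path are non-trivial. -/
def Path.IsTruncated (q : C.Path) (L : ℕ) : Prop :=
  {i | i < C.depth ∧ ¬ C.IsTriv i (q.irr i)}.encard ≤ L

variable (C)

/-- The irrep `l` of layer `i` occurs within a valid truncated path. -/
def Allowed (L i : ℕ) (l : C.Irr i) : Prop :=
  ∃ q : C.Path, q.IsValid ∧ q.IsTruncated L ∧ q.irr i = l

/-! ### The assumptions -/

/-- The dimension of the irreps within truncated paths is at most `dmax`. -/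
def Assumption0 (L dmax : ℕ) : Prop :=
  ∀ i < C.depth, ∀ l, C.Allowed L i l → (C.basis i).dim l ≤ dmax

/-- Controlled tree growth, for the `W`'s and for their adjoints, and bounded branching of the
contractions, in both directions. -/
structure Assumption1 (s : ℕ) : Prop where
  growth : ∀ i < C.depth, ∀ y : C.Node, y.pos = i + 1 →
    C.proj i (C.superW i y.op) = 0 ∨ C.proj i (C.superW i y.op) = C.superW i y.op
  growth_adj : ∀ i, i + 1 < C.depth → ∀ x : C.Node, x.pos = i →
    C.proj (i + 1) (C.superWAdj i x.op) = 0 ∨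
      C.proj (i + 1) (C.superWAdj i x.op) = C.superWAdj i x.op
  right : ∀ x : C.Node, x.pos < C.depth → (rightChildren x).encard ≤ s
  left : ∀ y : C.Node, y.pos < C.depth → (leftChildren y).encard ≤ s

/-- Noise penalisation, with spectral gap `γ`. -/
structure Assumption2 (γ : ℝ) : Prop where
  gap_pos : 0 < γ
  gap_le_one : γ ≤ 1
  fixed : ∀ i < C.depth, ∀ l, C.IsTriv i l → ∀ k, C.e i l k = 1
  penalised : ∀ i < C.depth, ∀ l, ¬ C.IsTriv i l → ∀ k, ‖C.e i l k‖ ≤ 1 - γ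

/-- Contractions of `M + 1` consecutive `W`'s restricted to the trivial subspaces have at most
`r` terms. -/
def Assumption3 (M r : ℕ) : Prop :=
  ∀ i, i + M + 1 < C.depth → (C.fullTerms i M).encard ≤ r

/-- `z` agrees with the partial outcome `y`. -/
def Agrees (y : Fin n → Option (Fin d)) (z : Outcome n d) : Prop :=
  ∀ i a, y i = some a → z i = a

/-- The subroutines `O` compute, for the circuit with parameters `g`, the data of the
assumptions within the stated times: the labels and matrix coefficients of irreps and the noise
eigenvalues (`cMat`), the contractions (`cCon`), the full contractions (`cFull`), and the diagonal
sums of the basis operators over the outcomes that agree with `y` (all marginals, `cEval`) and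
their overlap with the input state. Lists may come in any order. -/
structure Subroutines [NeZero d] (L M : ℕ) (g : Fin C.depth → G)
    (y : Fin n → Option (Fin d)) (cMat cCon cFull cEval : ℕ) (O : Oracle) : Prop where
  label : open Classical in ∀ i < C.depth, ∀ l : C.Irr i,
    O.Answers (Val.ofNats [0, i, l]) cMat
      (· = Val.ofNats [(C.basis i).dim l, if C.IsTriv i l then 1 else 0])
  matrixCoeff : ∀ (i : Fin C.depth) (l : C.Irr i), C.Allowed L i l →
    ∀ k k' : Fin ((C.basis i).dim l), O.Answers (Val.ofNats [1, i, l, k, k']) cMat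
      (· = .num (((C.basis i).v l (g i) :
        Matrix (Fin ((C.basis i).dim l)) (Fin ((C.basis i).dim l)) ℂ) k k'))
  noiseCoeff : ∀ i < C.depth, ∀ l : C.Irr i, C.Allowed L i l →
    ∀ k : Fin ((C.basis i).dim l), O.Answers (Val.ofNats [2, i, l, k]) cMat (· = .num (C.e i l k))
  contractRight : ∀ x : C.Node, ∀ j, x.pos < j → j ≤ C.depth →
    O.Answers (.pair (.nat 3) (.pair (.nat j) x.enc)) cCon fun w => ∃ l : List C.Node,
      l.Nodup ∧ (∀ z, z ∈ l ↔ z ∈ rightChildren x ∧ z.pos = j) ∧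
      w = Val.ofList (l.map fun z => .pair z.enc (.num (coef x z)))
  contractLeft : ∀ x : C.Node, x.pos < C.depth → ∀ j < x.pos,
    O.Answers (.pair (.nat 4) (.pair (.nat j) x.enc)) cCon fun w => ∃ l : List C.Node,
      l.Nodup ∧ (∀ z, z ∈ l ↔ z ∈ leftChildren x ∧ z.pos = j) ∧
      w = Val.ofList (l.map fun z => .pair z.enc (.num (coef z x)))
  contractFull : ∀ i, i + M + 1 < C.depth →
    O.Answers (Val.ofNats [5, i]) cFull fun w => ∃ l : List (C.Node × C.Node),
      l.Nodup ∧ (∀ z, z ∈ l ↔ z ∈ C.fullTerms i M) ∧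
      w = Val.ofList
        (l.map fun z => .pair z.1.enc (.pair z.2.enc (.num (coef z.1 z.2))))
  marginal : open Classical in ∀ x : C.Node, x.pos = 0 →
    O.Answers (.pair (.nat 6) x.enc) cEval
      (· = .num (∑ z : Outcome n d with Agrees y z, x.op z z))
  overlap : ∀ x : C.Node, x.pos = C.depth →
    O.Answers (.pair (.nat 7) x.enc) cEval (· = .num (x.op 0 0))

/-! ### Output distributions and their truncations -/

variable [NeZero d]

/-- The unitary `C(g)`. -/
def unitary (g : Fin C.depth → G) : Op n d :=
  (List.ofFn fun i : Fin C.depth => (C.U i (g i) : Op n d) * (C.W i : Op n d)).prod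

/-- The noiseless output distribution. -/
def p (x : Outcome n d) (g : Fin C.depth → G) : ℂ :=
  conjBy (C.unitary g) (inputState n d) x x

/-- The noisy output distribution. -/
def pNoisy (x : Outcome n d) (g : Fin C.depth → G) : ℂ :=
  (List.ofFn fun i : Fin C.depth =>
    C.noise i * conjBy (C.U i (g i) : Op n d) * C.superW i).prod (inputState n d) x x

/-- Irreps of `G^D`, given by an irrep for every layer. -/
abbrev Irreps := (i : Fin C.depth) → C.Irr i

/-- Components of an irrep of `G^D`. -/
abbrev Comps (l : C.Irreps) := (i : Fin C.depth) → Fin ((C.basis i).dim (l i))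

/-- Matrix coefficients of an irrep of `G^D`. -/
def matCoeff (l : C.Irreps) (k k' : C.Comps l) (g : Fin C.depth → G) : ℂ :=
  ∏ i : Fin C.depth, ((C.basis i).v (l i) (g i) :
    Matrix (Fin ((C.basis i).dim (l i))) (Fin ((C.basis i).dim (l i))) ℂ) (k i) (k' i)

/-- The Fourier coefficient of a function on `G^D`, for the Haar measure `μ` of `G`. -/
def fourier [MeasurableSpace G] (μ : Measure G) (f : (Fin C.depth → G) → ℂ) (l : C.Irreps)
    (k k' : C.Comps l) : ℂ :=
  ∫ g, f g * star (C.matCoeff l k k' g) ∂(Measure.pi fun _ => μ)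

/-- The Fourier series of `f`, truncated to the irreps of `G^D` with at most `L` non-trivial
factors; the Fourier coefficients are multiplied by the weights `wt`. -/
def truncSeries [MeasurableSpace G] (μ : Measure G) (L : ℕ) (wt : (l : C.Irreps) → C.Comps l → ℂ)
    (f : (Fin C.depth → G) → ℂ) (g : Fin C.depth → G) : ℂ :=
  open Classical in
  ∑ l : C.Irreps with (Finset.univ.filter fun i : Fin C.depth => ¬ C.IsTriv i (l i)).card ≤ L,
    ((∏ i : Fin C.depth, (C.basis i).dim (l i) : ℕ) : ℂ) *
      ∑ k, ∑ k', wt l k * C.fourier μ f l k k' * C.matCoeff l k k' g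

/-- The truncated noiseless quasi-distribution. -/
def pTrunc [MeasurableSpace G] (μ : Measure G) (L : ℕ) (x : Outcome n d)
    (g : Fin C.depth → G) : ℂ :=
  C.truncSeries μ L (fun _ _ => 1) (C.p x) g

/-- The truncated noisy quasi-distribution. -/
def pNoisyTrunc [MeasurableSpace G] (μ : Measure G) (L : ℕ) (x : Outcome n d)
    (g : Fin C.depth → G) : ℂ :=
  C.truncSeries μ L (fun l k => ∏ i : Fin C.depth, C.e i (l i) (k i)) (C.p x) g

/-- The sum of the truncated noisy quasi-distribution over the outcomes that agree with `y`:
its value at a point if `y` is a full outcome, a marginal otherwise. -/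
def pNoisyTruncMarginal [MeasurableSpace G] (μ : Measure G) (L : ℕ)
    (y : Fin n → Option (Fin d)) (g : Fin C.depth → G) : ℂ :=
  open Classical in
  ∑ x : Outcome n d with Agrees y x, C.pNoisyTrunc μ L x g

/-- The residual `p - p^T` anti-concentrates, with the constant `c`. -/
def ResidualAnticoncentrates [MeasurableSpace G] (μ : Measure G) (L : ℕ) (c : ℝ) : Prop :=
  ∑ x, ∫ g, ‖C.p x g - C.pTrunc μ L x g‖ ^ 2 ∂(Measure.pi fun _ => μ) ≤ c / (d : ℝ) ^ n

/-- The norm of the noisy truncation error in `ℓ¹(L²(G^D))`. -/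
def truncError [MeasurableSpace G] (μ : Measure G) (L : ℕ) : ℝ :=
  ∑ x, √(∫ g, ‖C.pNoisy x g - C.pNoisyTrunc μ L x g‖ ^ 2 ∂(Measure.pi fun _ => μ))

end NoisyCircuit

end OpTrunc

end

/-! The error bound and the algorithm rest on one expansion. A noisy layer is a sum over irreps of
`e * v` times the matrix units `unit l k k'`. Multiplying out, the ideal and the noisy probabilities
become finite sums of matrix coefficients of `G ^ D`, with the same path amplitudes `pathCoeff`
(`p_eq_sum`, `pNoisy_eq_sum`). Schur orthogonality identifies these amplitudes with Fourier
coefficients up to the dimension (`fourier_p`), so truncation deletes exactly the terms with more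
than `L` non-trivial irreps.

Error. Every deleted term carries a noise weight of modulus at most `(1 - γ) ^ L`. Parseval compares
the noisy with the ideal residual for each outcome (`integral_error_le`), and Cauchy–Schwarz over
the `d ^ n` outcomes gives the bound (`truncError_le`).

Algorithm. Since `e = 1` on trivial irreps, a trivial layer is the projector `Π₀`, independent of
the group element. The truncated series is the sum over paths with at most `L` non-trivial layers
(`pNoisyTrunc_eq`); this budget is the index of the families `ℕ → Op n d`. As `(L + 1) * (M + 2) ≤
D`, every such path has `M + 2` consecutive trivial layers, and sorting by the last such window
counts each path once (`prefixFam_const_eq`, `windowFree_eq_zero`). A window has at most `r` terms.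
From its ends the search goes left, over trivial runs of any length, and then right, over runs of
fewer than `M + 2` layers. Each non-trivial layer costs a branching factor `s * dmax`; the search to
the right is the leaf of the search to the left, whence `(s * dmax) ^ (2 * L)` (`eval_right`,
`eval_left`).

The subroutines answer for matrix coefficients only if the irrep lies on a valid truncated path, so
these queries wait until a path is complete. Irreps of dimension above `dmax` are pruned; nothing is
lost, because a non-zero contribution would exhibit a valid truncated path (`Joined`). Additive
costs are absorbed into the product bound because `s`, `dmax` and `r` are at least one, as the
identity operator travels along trivial nodes. -/

noncomputable section

namespace OpTrunc

/-! ## Evaluation within a time bound -/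

/-- The term `e` evaluates to `v` within `B` steps. -/
def EvalWithin (P : Program) (O : Oracle) (env : List Val) (e : Code) (v : Val) (B : ℕ) : Prop :=
  ∃ t ≤ B, Eval P O env e v t

namespace EvalWithin

variable {P : Program} {O : Oracle} {env : List Val}

theorem mono {e v B B'} (h : EvalWithin P O env e v B) (hB : B ≤ B') :
    EvalWithin P O env e v B' := by
  obtain ⟨t, ht, h⟩ := h
  exact ⟨t, ht.trans hB, h⟩

theorem op1 {o e v w B} (h : EvalWithin P O env e v B) (ho : o.apply v = some w) :
    EvalWithin P O env (.op1 o e) w (B + 1) := by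
  obtain ⟨t, ht, h⟩ := h
  exact ⟨t + 1, by omega, .op1 h ho⟩

theorem op2 {o e₁ e₂ v₁ v₂ w B₁ B₂} (h₁ : EvalWithin P O env e₁ v₁ B₁)
    (h₂ : EvalWithin P O env e₂ v₂ B₂) (ho : o.apply v₁ v₂ = some w) :
    EvalWithin P O env (.op2 o e₁ e₂) w (B₁ + B₂ + 1) := by
  obtain ⟨t₁, ht₁, h₁⟩ := h₁
  obtain ⟨t₂, ht₂, h₂⟩ := h₂
  exact ⟨t₁ + t₂ + 1, by omega, .op2 h₁ h₂ ho⟩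

theorem iteTrue {c e₁ e₂ k v B₁ B₂} (h₁ : EvalWithin P O env c (.nat k) B₁) (hk : k ≠ 0)
    (h₂ : EvalWithin P O env e₁ v B₂) : EvalWithin P O env (.ite c e₁ e₂) v (B₁ + B₂ + 1) := by
  obtain ⟨t₁, ht₁, h₁⟩ := h₁
  obtain ⟨t₂, ht₂, h₂⟩ := h₂
  obtain ⟨k, rfl⟩ := Nat.exists_eq_succ_of_ne_zero hk
  exact ⟨t₁ + t₂ + 1, by omega, .iteTrue h₁ h₂⟩

theorem iteFalse {c e₁ e₂ k v B₁ B₂} (h₁ : EvalWithin P O env c (.nat k) B₁) (hk : k = 0)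
    (h₂ : EvalWithin P O env e₂ v B₂) : EvalWithin P O env (.ite c e₁ e₂) v (B₁ + B₂ + 1) := by
  obtain ⟨t₁, ht₁, h₁⟩ := h₁
  obtain ⟨t₂, ht₂, h₂⟩ := h₂
  subst hk
  exact ⟨t₁ + t₂ + 1, by omega, .iteFalse h₁ h₂⟩

theorem letIn {e₁ e₂ v₁ v₂ B₁ B₂} (h₁ : EvalWithin P O env e₁ v₁ B₁)
    (h₂ : EvalWithin P O (v₁ :: env) e₂ v₂ B₂) :
    EvalWithin P O env (.letIn e₁ e₂) v₂ (B₁ + B₂ + 1) := by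
  obtain ⟨t₁, ht₁, h₁⟩ := h₁
  obtain ⟨t₂, ht₂, h₂⟩ := h₂
  exact ⟨t₁ + t₂ + 1, by omega, .letIn h₁ h₂⟩

theorem call {f e body v w B₁ B₂} (hf : P[f]? = some body) (h₁ : EvalWithin P O env e v B₁)
    (h₂ : EvalWithin P O [v] body w B₂) : EvalWithin P O env (.call f e) w (B₁ + B₂ + 1) := by
  obtain ⟨t₁, ht₁, h₁⟩ := h₁
  obtain ⟨t₂, ht₂, h₂⟩ := h₂
  exact ⟨t₁ + t₂ + 1, by omega, .call hf h₁ h₂⟩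

theorem query {e v w B τ} (h : EvalWithin P O env e v B) {c : ℕ} (hO : O v = some (w, τ))
    (hτ : τ ≤ c) : EvalWithin P O env (.query e) w (B + c + 1) := by
  obtain ⟨t, ht, h⟩ := h
  exact ⟨t + τ + 1, by omega, .query h hO⟩

theorem query_eq {e q w B} (h : EvalWithin P O env e q B) {c : ℕ}
    (hO : O.Answers q c (· = w)) : EvalWithin P O env (.query e) w (B + c + 1) := by
  obtain ⟨v, τ, h₁, h₂, rfl⟩ := hO
  exact h.query h₁ h₂

end EvalWithin

/-- The value of a term that consists of elementary operations only. -/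
def Code.denote (env : List Val) : Code → Option Val
  | .var i => env[i]?
  | .const k => some (.nat k)
  | .op1 o e => (e.denote env).bind o.apply
  | .op2 o e₁ e₂ => (e₁.denote env).bind fun v => (e₂.denote env).bind fun w => o.apply v w
  | _ => none

/-- The number of steps of a term that consists of elementary operations only. -/
def Code.size : Code → ℕ
  | .op1 _ e => e.size + 1
  | .op2 _ e₁ e₂ => e₁.size + e₂.size + 1
  | _ => 1

theorem Code.eval_denote (P : Program) (O : Oracle) (env : List Val) (e : Code) :
    ∀ v, e.denote env = some v → Eval P O env e v e.size := by
  induction e with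
  | var i => intro v h; exact .var h
  | const k => intro v h; obtain rfl := Option.some.inj h; exact .const
  | op1 o e ih =>
    intro v h
    simp only [Code.denote, Option.bind_eq_some_iff] at h
    obtain ⟨w, hw, h⟩ := h
    exact .op1 (ih _ hw) h
  | op2 o e₁ e₂ ih₁ ih₂ =>
    intro v h
    simp only [Code.denote, Option.bind_eq_some_iff] at h
    obtain ⟨w₁, hw₁, w₂, hw₂, h⟩ := h
    exact .op2 (ih₁ _ hw₁) (ih₂ _ hw₂) h
  | ite | letIn | call | query => intro v h; simp [Code.denote] at h

/-- Straight-line fragments of the program are settled by computation: the value by reducing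
`denote`, usually with `rfl`, and the step count with `decide`. Only branches, bindings, calls and
queries need rules of their own. -/
theorem EvalWithin.elementary {P : Program} {O : Oracle} {env : List Val} {e : Code} {v : Val}
    {B : ℕ} (h : e.denote env = some v) (hB : e.size ≤ B) : EvalWithin P O env e v B :=
  ⟨_, hB, e.eval_denote P O env v h⟩

/-! ## The program -/

namespace Code

/-- The remainder of a list after `k` entries. -/
def drop : ℕ → Code → Code
  | 0, e => e
  | k + 1, e => drop k (.op1 .snd e)

/-- The entry with index `k` of a list. -/
def entry (k : ℕ) (e : Code) : Code := .op1 .fst (drop k e)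

/-- A tuple. -/
def tuple : List Code → Code → Code
  | [], e => e
  | a :: l, e => .op2 .pair a (tuple l e)

/-- The complex number zero. -/
def zero : Code := .op1 .toNum (.const 0)

end Code

/-- The parameters `depth, L, M, dmax`. -/
def paramsVal (D L M dmax : ℕ) : Val := Val.ofNats [D, L, M, dmax]

/-- The state of the search: direction, admissible step, number of non-trivial layers left,
accumulated factor, pending matrix coefficients, the end point at which the search goes on to the
right, and the parameters. -/
def stateVal (dir gap b : ℕ) (acc : ℂ) (pend y params : Val) : Val :=
  .pair (.nat dir) (.pair (.nat gap) (.pair (.nat b) (.pair (.num acc) (.pair pend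
    (.pair y params)))))

section Bodies

open Code

/-- Start of the loop over windows. -/
def mainBody : Code := .call 1 (tuple [.const 0] (.var 0))

/-- Loop over windows; the argument is the position and the parameters. -/
def windowBody : Code :=
  .ite (.op2 .lt (.op2 .add (.op2 .add (entry 0 (.var 0)) (entry 3 (.var 0))) (.const 1))
      (entry 1 (.var 0)))
    (.op2 .add
      (.call 2 (.op2 .pair (.query (tuple [.const 5, entry 0 (.var 0)] (.const 0)))
        (drop 1 (.var 0))))
      (.call 1 (tuple [.op2 .add (entry 0 (.var 0)) (.const 1)] (drop 1 (.var 0)))))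
    zero

/-- Loop over the terms of a window; the argument is the list of terms and the parameters. -/
def termBody : Code :=
  .ite (.op1 .isPair (entry 0 (.var 0)))
    (.op2 .add
      (.call 3 (tuple [entry 0 (entry 0 (entry 0 (.var 0))), .const 4, .const 0,
        entry 2 (.var 0), drop 2 (entry 0 (entry 0 (.var 0))), .const 0,
        entry 1 (entry 0 (entry 0 (.var 0)))] (drop 1 (.var 0))))
      (.call 2 (tuple [drop 1 (entry 0 (.var 0))] (drop 1 (.var 0)))))
    zero

/-- Search from a node; the argument is the node and the state. -/
def nodeBody : Code :=
  .ite (.op2 .lt (.const 3) (entry 1 (.var 0)))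
    (.ite (entry 0 (entry 0 (.var 0)))
      (.call 4 (tuple [.const 0, entry 0 (entry 0 (.var 0))] (.var 0)))
      (.call 3 (tuple [entry 6 (.var 0), .const 3, .const 1, entry 3 (.var 0),
        .op2 .mul (entry 4 (.var 0)) (.query (tuple [.const 6] (entry 0 (.var 0)))),
        entry 5 (.var 0), entry 6 (.var 0)] (drop 7 (.var 0)))))
    (.ite (.op2 .lt (entry 0 (entry 0 (.var 0))) (entry 7 (.var 0)))
      (.call 4 (tuple [.op2 .add (entry 0 (entry 0 (.var 0))) (.const 1), entry 2 (.var 0)]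
        (.var 0)))
      (.op2 .mul (.op2 .mul (entry 4 (.var 0))
          (.op1 .conj (.query (tuple [.const 7] (entry 0 (.var 0))))))
        (.call 8 (entry 5 (.var 0)))))

/-- Loop over positions; the argument is the position, the number of positions left, the node and
the state. -/
def positionBody : Code :=
  .ite (entry 1 (.var 0))
    (.ite (.op2 .lt (entry 9 (.var 0)) (entry 0 (.var 0))) zero
      (.op2 .add
        (.call 5 (.op2 .pair
          (.query (tuple [entry 3 (.var 0), entry 0 (.var 0)] (entry 2 (.var 0))))
          (drop 3 (.var 0))))
        (.call 4 (tuple [.op2 .add (entry 0 (.var 0)) (.const 1),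
          .op2 .sub (entry 1 (.var 0)) (.const 1)] (drop 2 (.var 0))))))
    zero

/-- Loop over a list of nodes with weights; the argument is the list and the state. -/
def listBody : Code :=
  .ite (.op1 .isPair (entry 0 (.var 0)))
    (.op2 .add
      (.call 6 (tuple [entry 0 (entry 0 (entry 0 (.var 0))), entry 1 (.var 0), entry 2 (.var 0),
        entry 3 (.var 0),
        .op2 .mul (entry 4 (.var 0)) (drop 1 (entry 0 (entry 0 (.var 0))))] (drop 5 (.var 0))))
      (.call 5 (tuple [drop 1 (entry 0 (.var 0))] (drop 1 (.var 0)))))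
    zero

/-- A node at which a run of trivial layers ends; the argument is the node and the state. -/
def childBody : Code :=
  .ite (.op2 .lt (entry 0 (entry 0 (.var 0))) (entry 7 (.var 0)))
    (.letIn (.query (tuple [.const 0, entry 0 (entry 0 (.var 0)), entry 1 (entry 0 (.var 0))]
        (.const 0)))
      (.ite (entry 1 (.var 0)) (.call 3 (.var 1))
        (.ite (entry 3 (.var 1))
          (.ite (.op2 .lt (entry 10 (.var 1)) (entry 0 (.var 0))) zero
            (.call 7 (tuple [entry 0 (.var 0)] (.var 1))))
          zero)))
    (.call 3 (.var 0))

/-- Loop over the components of a non-trivial irrep; the argument is the number of components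
left, the node and the state. -/
def componentBody : Code :=
  .ite (entry 0 (.var 0))
    (.op2 .add
      (.letIn (.op2 .sub (entry 0 (.var 0)) (.const 1))
        (.call 3 (tuple [
          tuple [entry 0 (entry 1 (.var 1)), entry 1 (entry 1 (.var 1)),
            entry 2 (entry 1 (.var 1)), .var 0] (.const 0),
          entry 2 (.var 1), .op2 .add (entry 10 (.var 1)) (.const 2),
          .op2 .sub (entry 4 (.var 1)) (.const 1), entry 5 (.var 1),
          .op2 .pair (.ite (.op2 .lt (.const 3) (entry 2 (.var 1)))
            (tuple [entry 0 (entry 1 (.var 1)), entry 1 (entry 1 (.var 1)), .var 0,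
              entry 3 (entry 1 (.var 1))] (.const 0))
            (tuple [entry 0 (entry 1 (.var 1)), entry 1 (entry 1 (.var 1)),
              entry 3 (entry 1 (.var 1)), .var 0] (.const 0)))
          (entry 6 (.var 1))] (drop 7 (.var 1)))))
      (.call 7 (tuple [.op2 .sub (entry 0 (.var 0)) (.const 1)] (drop 1 (.var 0)))))
    zero

/-- Product of the pending matrix coefficients and noise eigenvalues. -/
def pendingBody : Code :=
  .ite (.op1 .isPair (.var 0))
    (.op2 .mul
      (.op2 .mul (.query (tuple [.const 1] (entry 0 (.var 0))))
        (.query (tuple [.const 2, entry 0 (entry 0 (.var 0)), entry 1 (entry 0 (.var 0)),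
          entry 2 (entry 0 (.var 0))] (.const 0))))
      (.call 8 (drop 1 (.var 0))))
    (.op1 .toNum (.const 1))

end Bodies

/-- Depth-first enumeration of the truncated paths, from their last long run of trivial layers
first to the left and then to the right. -/
def searchProgram : Program :=
  [mainBody, windowBody, termBody, nodeBody, positionBody, listBody, childBody, componentBody,
    pendingBody]

/-! ### Effect and cost of one call of each function of the program -/

section Steps

variable {O : Oracle}

theorem EvalWithin.zero {env : List Val} :
    EvalWithin searchProgram O env Code.zero (.num 0) 2 := by
  -- `toNum` yields the cast of a natural number, which still has to be simplified to the complex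
  -- number zero.
  refine .elementary ?_ le_rfl
  simp [Code.zero, Code.denote, Op1.apply]

theorem eval_main {D L M dmax : ℕ} {v : Val} {B : ℕ}
    (h : EvalWithin searchProgram O [.pair (.nat 0) (paramsVal D L M dmax)] windowBody v B) :
    EvalWithin searchProgram O [paramsVal D L M dmax] mainBody v (B + 10) :=
  (EvalWithin.call rfl (.elementary rfl le_rfl) h).mono
    (by change 3 + B + 1 ≤ _; omega)

theorem eval_window_stop {D L M dmax i : ℕ} (h : ¬ i + M + 1 < D) :
    EvalWithin searchProgram O [.pair (.nat i) (paramsVal D L M dmax)] windowBody (.num 0) 100 := by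
  -- The guard compares variables. With its value left as an `if` the evaluation is `rfl`, and the
  -- comparison is decided separately.
  refine (EvalWithin.iteFalse (k := if i + M + 1 < D then 1 else 0)
    (.elementary rfl le_rfl) (if_neg h) .zero).mono ?_
  decide

theorem eval_window_step {D L M dmax i c B₁ B₂ : ℕ} {w : Val} {z₁ z₂ : ℂ}
    (h : i + M + 1 < D) (hO : O.Answers (Val.ofNats [5, i]) c (· = w))
    (h₁ : EvalWithin searchProgram O [.pair w (paramsVal D L M dmax)] termBody (.num z₁) B₁)
    (h₂ : EvalWithin searchProgram O [.pair (.nat (i + 1)) (paramsVal D L M dmax)] windowBody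
      (.num z₂) B₂) :
    EvalWithin searchProgram O [.pair (.nat i) (paramsVal D L M dmax)] windowBody
      (.num (z₁ + z₂)) (B₁ + B₂ + c + 100) := by
  refine (EvalWithin.iteTrue (k := if i + M + 1 < D then 1 else 0) (B₁ := 20)
    (.elementary rfl (by decide)) (by simp [h])
    (.op2 (.call rfl (.op2 (.query_eq (.elementary rfl (B := 10) (by decide)) hO)
      (.elementary rfl (B := 10) (by decide)) rfl) h₁)
      (.call rfl (.elementary rfl (B := 10) (by decide)) h₂) rfl)).mono ?_
  omega

theorem eval_term_nil {D L M dmax : ℕ} :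
    EvalWithin searchProgram O [.pair (Val.ofList []) (paramsVal D L M dmax)] termBody
      (.num 0) 100 := by
  refine (EvalWithin.iteFalse (k := 0) (B₁ := 20)
    (.elementary rfl (by decide)) rfl .zero).mono (by decide)

theorem eval_term_cons {D L M dmax B₁ B₂ : ℕ} {x y : Val} {l : List Val} {w z₁ z₂ : ℂ}
    (h₁ : EvalWithin searchProgram O
      [.pair x (stateVal 4 0 L w (.nat 0) y (paramsVal D L M dmax))] nodeBody (.num z₁) B₁)
    (h₂ : EvalWithin searchProgram O [.pair (Val.ofList l) (paramsVal D L M dmax)] termBody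
      (.num z₂) B₂) :
    EvalWithin searchProgram O
      [.pair (Val.ofList (.pair x (.pair y (.num w)) :: l)) (paramsVal D L M dmax)] termBody
      (.num (z₁ + z₂)) (B₁ + B₂ + 100) := by
  refine (EvalWithin.iteTrue (k := 1) (B₁ := 20)
    (.elementary rfl (by decide)) one_ne_zero
    (.op2 (.call rfl (.elementary rfl (B := 50) (by decide)) h₁)
      (.call rfl (.elementary rfl (B := 10) (by decide)) h₂) rfl)).mono ?_
  omega

section Node

variable {D L M dmax gap b : ℕ} {acc : ℂ} {pend y : Val} {pos irr mul comp : ℕ}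

/-- The turning point of the search. At layer `0` the left half is closed by the marginal sum, and
the search restarts at the right end of the window with `gap = 1`: the layer behind the window must
be non-trivial or the end of the circuit, otherwise the window would not be the last one. -/
theorem eval_node_left_end {c B : ℕ} {u z : ℂ}
    (hO : O.Answers (.pair (.nat 6) (Val.ofNats [0, irr, mul, comp])) c (· = .num u))
    (h : EvalWithin searchProgram O
      [.pair y (stateVal 3 1 b (acc * u) pend y (paramsVal D L M dmax))] nodeBody (.num z) B) :
    EvalWithin searchProgram O [.pair (Val.ofNats [0, irr, mul, comp])
      (stateVal 4 gap b acc pend y (paramsVal D L M dmax))] nodeBody (.num z) (B + c + 200) := by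
  refine (EvalWithin.iteTrue (k := 1) (B₁ := 20)
    (.elementary rfl (by decide)) one_ne_zero
    (.iteFalse (k := 0) (B₁ := 20) (.elementary rfl (by decide)) rfl
    (.call rfl
      (.op2 (.elementary rfl (B := 15) (by decide))
        (.op2 (.elementary rfl (B := 15) (by decide))
        (.op2 (.elementary rfl (B := 15) (by decide))
        (.op2 (.elementary rfl (B := 15) (by decide))
        (.op2 (.op2 (.elementary rfl (B := 15) (by decide))
          (.query_eq (.elementary rfl (B := 15) (by decide)) hO) rfl)
        (.elementary rfl (B := 50) (by decide)) rfl) rfl) rfl) rfl) rfl) h))).mono ?_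
  omega

theorem eval_node_left {B : ℕ} {v : Val} (hpos : pos ≠ 0)
    (h : EvalWithin searchProgram O [.pair (.nat 0) (.pair (.nat pos)
      (.pair (Val.ofNats [pos, irr, mul, comp])
        (stateVal 4 gap b acc pend y (paramsVal D L M dmax))))] positionBody v B) :
    EvalWithin searchProgram O [.pair (Val.ofNats [pos, irr, mul, comp])
      (stateVal 4 gap b acc pend y (paramsVal D L M dmax))] nodeBody v (B + 200) := by
  refine (EvalWithin.iteTrue (k := 1) (B₁ := 20)
    (.elementary rfl (by decide)) one_ne_zero
    (.iteTrue (k := pos) (B₁ := 20) (.elementary rfl (by decide)) hpos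
    (.call rfl (.elementary rfl (B := 50) (by decide)) h))).mono ?_
  omega

theorem eval_node_right {B : ℕ} {v : Val} (hpos : pos < D)
    (h : EvalWithin searchProgram O [.pair (.nat (pos + 1)) (.pair (.nat gap)
      (.pair (Val.ofNats [pos, irr, mul, comp])
        (stateVal 3 gap b acc pend y (paramsVal D L M dmax))))] positionBody v B) :
    EvalWithin searchProgram O [.pair (Val.ofNats [pos, irr, mul, comp])
      (stateVal 3 gap b acc pend y (paramsVal D L M dmax))] nodeBody v (B + 200) := by
  refine (EvalWithin.iteFalse (k := 0) (B₁ := 20)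
    (.elementary rfl (by decide)) rfl
    (.iteTrue (k := if pos < D then 1 else 0) (B₁ := 20) (.elementary rfl (by decide))
      (by simp [hpos])
    (.call rfl (.elementary rfl (B := 50) (by decide)) h))).mono ?_
  omega

/-- The path is complete, and only now are the pending coefficients queried. The overlap is
conjugated because `hs` is conjugate linear in the basis operator. -/
theorem eval_node_right_end {c B : ℕ} {u z : ℂ}
    (hO : O.Answers (.pair (.nat 7) (Val.ofNats [D, irr, mul, comp])) c (· = .num u))
    (h : EvalWithin searchProgram O [pend] pendingBody (.num z) B) :
    EvalWithin searchProgram O [.pair (Val.ofNats [D, irr, mul, comp])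
      (stateVal 3 gap b acc pend y (paramsVal D L M dmax))] nodeBody
      (.num (acc * star u * z)) (B + c + 200) := by
  refine (EvalWithin.iteFalse (k := 0) (B₁ := 20)
    (.elementary rfl (by decide)) rfl
    (.iteFalse (k := if D < D then 1 else 0) (B₁ := 20) (.elementary rfl (by decide))
      (by simp)
    (.op2 (.op2 (.elementary rfl (B := 15) (by decide))
      (.op1 (.query_eq (.elementary rfl (B := 15) (by decide)) hO) rfl) rfl)
      (.call rfl (.elementary rfl (B := 15) (by decide)) h) rfl))).mono ?_
  omega

end Node

section Position

variable {D L M dmax dir gap b : ℕ} {acc : ℂ} {pend y x : Val} {j cnt : ℕ}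

theorem eval_position_stop (h : cnt = 0 ∨ D < j) :
    EvalWithin searchProgram O [.pair (.nat j) (.pair (.nat cnt) (.pair x
      (stateVal dir gap b acc pend y (paramsVal D L M dmax))))] positionBody (.num 0) 100 := by
  by_cases h0 : cnt = 0
  · refine (EvalWithin.iteFalse (k := cnt) (B₁ := 20)
      (.elementary rfl (by decide)) h0 .zero).mono (by decide)
  · refine (EvalWithin.iteTrue (k := cnt) (B₁ := 20)
      (.elementary rfl (by decide)) h0
      (.iteTrue (k := if D < j then 1 else 0) (B₁ := 20)
      (.elementary rfl (by decide)) ?_ .zero)).mono (by decide)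
    simp [h.resolve_left h0]

theorem eval_position_step {c B₁ B₂ : ℕ} {w : Val} {z₁ z₂ : ℂ} (hj : j ≤ D)
    (hO : O.Answers (.pair (.nat dir) (.pair (.nat j) x)) c (· = w))
    (h₁ : EvalWithin searchProgram O
      [.pair w (stateVal dir gap b acc pend y (paramsVal D L M dmax))] listBody (.num z₁) B₁)
    (h₂ : EvalWithin searchProgram O [.pair (.nat (j + 1)) (.pair (.nat cnt) (.pair x
      (stateVal dir gap b acc pend y (paramsVal D L M dmax))))] positionBody (.num z₂) B₂) :
    EvalWithin searchProgram O [.pair (.nat j) (.pair (.nat (cnt + 1)) (.pair x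
      (stateVal dir gap b acc pend y (paramsVal D L M dmax))))] positionBody
      (.num (z₁ + z₂)) (B₁ + B₂ + c + 200) := by
  refine (EvalWithin.iteTrue (k := cnt + 1) (B₁ := 20)
      (.elementary rfl (by decide)) (Nat.succ_ne_zero _)
      (.iteFalse (k := if D < j then 1 else 0) (B₁ := 20)
      (.elementary rfl (by decide)) (by simp [hj])
      (.op2 (.call rfl (.op2 (.query_eq (.elementary rfl (B := 20) (by decide)) hO)
        (.elementary rfl (B := 20) (by decide)) rfl) h₁)
        (.call rfl (.elementary (v := .pair (.nat (j + 1)) (.pair (.nat cnt) (.pair x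
          (stateVal dir gap b acc pend y (paramsVal D L M dmax))))) rfl
          (B := 30) (by decide)) h₂) rfl))).mono ?_
  omega

theorem eval_list_nil :
    EvalWithin searchProgram O [.pair (Val.ofList [])
      (stateVal dir gap b acc pend y (paramsVal D L M dmax))] listBody (.num 0) 100 := by
  refine (EvalWithin.iteFalse (k := 0) (B₁ := 20)
    (.elementary rfl (by decide)) rfl .zero).mono (by decide)

theorem eval_list_cons {B₁ B₂ : ℕ} {l : List Val} {w z₁ z₂ : ℂ}
    (h₁ : EvalWithin searchProgram O
      [.pair x (stateVal dir gap b (acc * w) pend y (paramsVal D L M dmax))] childBody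
      (.num z₁) B₁)
    (h₂ : EvalWithin searchProgram O [.pair (Val.ofList l)
      (stateVal dir gap b acc pend y (paramsVal D L M dmax))] listBody (.num z₂) B₂) :
    EvalWithin searchProgram O [.pair (Val.ofList (.pair x (.num w) :: l))
      (stateVal dir gap b acc pend y (paramsVal D L M dmax))] listBody
      (.num (z₁ + z₂)) (B₁ + B₂ + 200) := by
  refine (EvalWithin.iteTrue (k := 1) (B₁ := 20)
    (.elementary rfl (by decide)) one_ne_zero
    (.op2 (.call rfl (.elementary rfl (B := 60) (by decide)) h₁)
      (.call rfl (.elementary rfl (B := 20) (by decide)) h₂) rfl)).mono ?_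
  omega

end Position

section Child

variable {D L M dmax dir gap b : ℕ} {acc : ℂ} {pend y : Val} {pos irr mul comp : ℕ}

theorem eval_child_end {B : ℕ} {v : Val} (hpos : ¬ pos < D)
    (h : EvalWithin searchProgram O [.pair (Val.ofNats [pos, irr, mul, comp])
      (stateVal dir gap b acc pend y (paramsVal D L M dmax))] nodeBody v B) :
    EvalWithin searchProgram O [.pair (Val.ofNats [pos, irr, mul, comp])
      (stateVal dir gap b acc pend y (paramsVal D L M dmax))] childBody v (B + 100) := by
  refine (EvalWithin.iteFalse (k := if pos < D then 1 else 0) (B₁ := 20)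
    (.elementary rfl (by decide)) (by simp [hpos])
    (.call rfl (.elementary rfl (B := 20) (by decide)) h)).mono ?_
  omega

theorem eval_child_trivial {B c dim : ℕ} {v : Val} (hpos : pos < D)
    (hO : O.Answers (Val.ofNats [0, pos, irr]) c (· = Val.ofNats [dim, 1]))
    (h : EvalWithin searchProgram O [.pair (Val.ofNats [pos, irr, mul, comp])
      (stateVal dir gap b acc pend y (paramsVal D L M dmax))] nodeBody v B) :
    EvalWithin searchProgram O [.pair (Val.ofNats [pos, irr, mul, comp])
      (stateVal dir gap b acc pend y (paramsVal D L M dmax))] childBody v (B + c + 200) := by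
  refine (EvalWithin.iteTrue (k := if pos < D then 1 else 0) (B₁ := 20)
    (.elementary rfl (by decide)) (by simp [hpos])
    (.letIn (.query_eq (.elementary rfl (B := 30) (by decide)) hO)
    (.iteTrue (k := 1) (B₁ := 20) (.elementary rfl (by decide)) one_ne_zero
    (.call rfl (.elementary rfl (B := 20) (by decide)) h)))).mono ?_
  omega

/-- A branch is pruned when the budget is exhausted or the dimension is above `dmax`. That the
second case loses nothing is the content of `Joined.allowed_of_rightValue_ne_zero` and its
counterpart on the left. -/
theorem eval_child_skip {c dim : ℕ} (hpos : pos < D)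
    (hO : O.Answers (Val.ofNats [0, pos, irr]) c (· = Val.ofNats [dim, 0]))
    (h : b = 0 ∨ dmax < dim) :
    EvalWithin searchProgram O [.pair (Val.ofNats [pos, irr, mul, comp])
      (stateVal dir gap b acc pend y (paramsVal D L M dmax))] childBody (.num 0) (c + 200) := by
  have key : EvalWithin searchProgram O [Val.ofNats [dim, 0],
      .pair (Val.ofNats [pos, irr, mul, comp])
      (stateVal dir gap b acc pend y (paramsVal D L M dmax))]
      (.ite (Code.entry 3 (.var 1))
          (.ite (.op2 .lt (Code.entry 10 (.var 1)) (Code.entry 0 (.var 0))) Code.zero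
            (.call 7 (Code.tuple [Code.entry 0 (.var 0)] (.var 1))))
          Code.zero) (.num 0) 70 := by
    by_cases hb : b = 0
    · exact (EvalWithin.iteFalse (k := b) (B₁ := 20)
        (.elementary rfl (by decide)) hb .zero).mono (by decide)
    · refine (EvalWithin.iteTrue (k := b) (B₁ := 20)
        (.elementary rfl (by decide)) hb
        (.iteTrue (k := if dmax < dim then 1 else 0) (B₁ := 20)
        (.elementary rfl (by decide)) ?_ .zero)).mono (by decide)
      simp [h.resolve_left hb]
  refine (EvalWithin.iteTrue (k := if pos < D then 1 else 0) (B₁ := 20)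
    (.elementary rfl (by decide)) (by simp [hpos])
    (.letIn (.query_eq (.elementary rfl (B := 30) (by decide)) hO)
    (.iteFalse (k := 0) (B₁ := 20) (.elementary rfl (by decide)) rfl key))).mono ?_
  omega

theorem eval_child_step {B c dim : ℕ} {v : Val} (hpos : pos < D)
    (hO : O.Answers (Val.ofNats [0, pos, irr]) c (· = Val.ofNats [dim, 0]))
    (hdim : dim ≤ dmax) (hb : b ≠ 0)
    (h : EvalWithin searchProgram O [.pair (.nat dim) (.pair (Val.ofNats [pos, irr, mul, comp])
      (stateVal dir gap b acc pend y (paramsVal D L M dmax)))] componentBody v B) :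
    EvalWithin searchProgram O [.pair (Val.ofNats [pos, irr, mul, comp])
      (stateVal dir gap b acc pend y (paramsVal D L M dmax))] childBody v (B + c + 200) := by
  refine (EvalWithin.iteTrue (k := if pos < D then 1 else 0) (B₁ := 20)
    (.elementary rfl (by decide)) (by simp [hpos])
    (.letIn (.query_eq (.elementary rfl (B := 30) (by decide)) hO)
    (.iteFalse (k := 0) (B₁ := 20) (.elementary rfl (by decide)) rfl
    (.iteTrue (k := b) (B₁ := 20) (.elementary rfl (by decide)) hb
    (.iteFalse (k := if dmax < dim then 1 else 0) (B₁ := 20) (.elementary rfl (by decide))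
      (by simp [hdim])
    (.call rfl (.elementary rfl (B := 20) (by decide)) h)))))).mono ?_
  omega

theorem eval_component_zero {x : Val} :
    EvalWithin searchProgram O [.pair (.nat 0) (.pair x
      (stateVal dir gap b acc pend y (paramsVal D L M dmax)))] componentBody (.num 0) 100 := by
  refine (EvalWithin.iteFalse (k := 0) (B₁ := 20)
    (.elementary rfl (by decide)) rfl .zero).mono (by decide)

/-- The layer is non-trivial, so the budget drops by one, and `gap` restarts at `M + 2`, which
admits at most `M + 1` trivial layers before the next stop to the right. The new component is the
row index when moving left and the column index when moving right; hence the two forms of the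
pending entry. -/
theorem eval_component_succ {k B₁ B₂ : ℕ} {z₁ z₂ : ℂ}
    (h₁ : EvalWithin searchProgram O [.pair (Val.ofNats [pos, irr, mul, k])
      (stateVal dir (M + 2) b acc
        (.pair (if 3 < dir then Val.ofNats [pos, irr, k, comp]
          else Val.ofNats [pos, irr, comp, k]) pend) y (paramsVal D L M dmax))]
      nodeBody (.num z₁) B₁)
    (h₂ : EvalWithin searchProgram O [.pair (.nat k) (.pair (Val.ofNats [pos, irr, mul, comp])
      (stateVal dir gap (b + 1) acc pend y (paramsVal D L M dmax)))] componentBody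
      (.num z₂) B₂) :
    EvalWithin searchProgram O [.pair (.nat (k + 1)) (.pair (Val.ofNats [pos, irr, mul, comp])
      (stateVal dir gap (b + 1) acc pend y (paramsVal D L M dmax)))] componentBody
      (.num (z₁ + z₂)) (B₁ + B₂ + 400) := by
  refine (EvalWithin.iteTrue (k := k + 1) (B₁ := 20)
    (.elementary rfl (by decide)) (Nat.succ_ne_zero _)
    (.op2 (.letIn (v₁ := .nat k) (.elementary rfl (B := 20) (by decide))
      (.call rfl (.op2 (.elementary rfl (B := 50) (by decide))
        (.op2 (.elementary rfl (B := 15) (by decide))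
        (.op2 (.elementary rfl (B := 15) (by decide))
        (.op2 (.elementary rfl (B := 15) (by decide))
        (.op2 (.elementary rfl (B := 15) (by decide))
        (.op2 (.op2 (v₁ := if 3 < dir then Val.ofNats [pos, irr, k, comp]
          else Val.ofNats [pos, irr, comp, k]) (B₁ := 80) ?_
          (.elementary rfl (B := 15) (by decide)) rfl)
        (.elementary rfl (B := 30) (by decide)) rfl) rfl) rfl) rfl) rfl) rfl) h₁))
      (.call rfl (.elementary (v := .pair (.nat k) (.pair (Val.ofNats [pos, irr, mul, comp])
        (stateVal dir gap (b + 1) acc pend y (paramsVal D L M dmax)))) rfl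
        (B := 30) (by decide)) h₂) rfl)).mono ?_
  · by_cases h : 3 < dir
    · rw [if_pos h]
      exact (EvalWithin.iteTrue (k := if 3 < dir then 1 else 0) (B₁ := 20)
        (.elementary rfl (by decide)) (by simp [h])
        (.elementary rfl (B := 50) (by decide))).mono (by decide)
    · rw [if_neg h]
      exact (EvalWithin.iteFalse (k := if 3 < dir then 1 else 0) (B₁ := 20)
        (.elementary rfl (by decide)) (by simp [h])
        (.elementary rfl (B := 50) (by decide))).mono (by decide)
  · omega

theorem eval_pending_nil :
    EvalWithin searchProgram O [Val.ofList []] pendingBody (.num 1) 100 := by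
  refine (EvalWithin.iteFalse (k := 0) (B₁ := 20)
    (.elementary rfl (by decide)) rfl (.elementary (B := 20) ?_ (by decide))).mono (by decide)
  simp [Code.denote, Op1.apply]

theorem eval_pending_cons {c i l k k' B : ℕ} {u v z : ℂ} {rest : List Val}
    (h₁ : O.Answers (Val.ofNats [1, i, l, k, k']) c (· = .num u))
    (h₂ : O.Answers (Val.ofNats [2, i, l, k]) c (· = .num v))
    (h : EvalWithin searchProgram O [Val.ofList rest] pendingBody (.num z) B) :
    EvalWithin searchProgram O [Val.ofList (Val.ofNats [i, l, k, k'] :: rest)] pendingBody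
      (.num (u * v * z)) (B + 2 * c + 200) := by
  refine (EvalWithin.iteTrue (k := 1) (B₁ := 20)
    (.elementary rfl (by decide)) one_ne_zero
    (.op2 (.op2 (.query_eq (.elementary rfl (B := 20) (by decide)) h₁)
      (.query_eq (.elementary rfl (B := 50) (by decide)) h₂) rfl)
      (.call rfl (.elementary rfl (B := 20) (by decide)) h) rfl)).mono ?_
  omega

end Child

end Steps

/-! ## Expansions in the operator bases -/

theorem hs_apply {n d : ℕ} (A X : Op n d) : hs A X = (Aᴴ * X).trace := rfl

theorem conjBy_apply {n d : ℕ} (V X : Op n d) : conjBy V X = V * (X * Vᴴ) := rfl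

namespace ITOBasis

variable {n d : ℕ} {G : Type*} [Group G] {U : G →* Matrix.unitaryGroup (Outcome n d) ℂ}
  (B : ITOBasis n d U)

/-- The map that sends the component `k'` of every copy of the irrep `l` to the component `k`. -/
def unit (l : Fin B.nIrr) (k k' : Fin (B.dim l)) : Module.End ℂ (Op n d) :=
  ∑ a, (hs (B.T l a k')).smulRight (B.T l a k)

/-- Matrix coefficients of the irrep `l`. -/
def coeff (l : Fin B.nIrr) (u : G) (k k' : Fin (B.dim l)) : ℂ :=
  (B.v l u : Matrix (Fin (B.dim l)) (Fin (B.dim l)) ℂ) k k'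

theorem hs_same (l : Fin B.nIrr) (a a' : Fin (B.mult l)) (k k' : Fin (B.dim l)) :
    hs (B.T l a k) (B.T l a' k') = if a = a' ∧ k = k' then 1 else 0 := by
  split_ifs with h
  · obtain ⟨rfl, rfl⟩ := h
    exact B.normalized l a k
  · apply B.orthogonal
    simpa using h

theorem hs_of_ne {l l' : Fin B.nIrr} (h : l ≠ l') (a : Fin (B.mult l)) (a' : Fin (B.mult l'))
    (k : Fin (B.dim l)) (k' : Fin (B.dim l')) : hs (B.T l a k) (B.T l' a' k') = 0 := by
  apply B.orthogonal
  intro h'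
  exact h (congrArg Sigma.fst h')

theorem ext_basis {N : Type*} [AddCommMonoid N] [Module ℂ N] {φ ψ : Op n d →ₗ[ℂ] N}
    (h : ∀ l a k, φ (B.T l a k) = ψ (B.T l a k)) : φ = ψ := by
  refine LinearMap.ext_on B.complete ?_
  rintro _ ⟨l, a, k, rfl⟩
  exact h l a k

theorem unit_T_same (l : Fin B.nIrr) (k k' : Fin (B.dim l)) (a : Fin (B.mult l))
    (j : Fin (B.dim l)) : B.unit l k k' (B.T l a j) = if k' = j then B.T l a k else 0 := by
  simp only [unit, LinearMap.sum_apply, LinearMap.smulRight_apply, hs_same, ite_and, ite_smul,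
    one_smul, zero_smul, Finset.sum_ite_eq', Finset.mem_univ, if_true]

theorem unit_T_of_ne {l l' : Fin B.nIrr} (h : l ≠ l') (k k' : Fin (B.dim l))
    (a : Fin (B.mult l')) (j : Fin (B.dim l')) : B.unit l k k' (B.T l' a j) = 0 := by
  simp [unit, LinearMap.sum_apply, LinearMap.smulRight_apply, B.hs_of_ne h]

theorem hs_unit_same (l : Fin B.nIrr) (a : Fin (B.mult l)) (j k k' : Fin (B.dim l))
    (X : Op n d) : hs (B.T l a j) (B.unit l k k' X) = if j = k then hs (B.T l a k') X else 0 := by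
  simp only [unit, LinearMap.sum_apply, LinearMap.smulRight_apply, map_sum, map_smul, hs_same,
    ite_and, smul_eq_mul, mul_ite, mul_one, mul_zero, Finset.sum_ite_eq, Finset.mem_univ, if_true]

theorem hs_unit_of_ne {l l' : Fin B.nIrr} (h : l ≠ l') (a : Fin (B.mult l))
    (j : Fin (B.dim l)) (k k' : Fin (B.dim l')) (X : Op n d) :
    hs (B.T l a j) (B.unit l' k k' X) = 0 := by
  simp [unit, LinearMap.sum_apply, LinearMap.smulRight_apply, map_sum, B.hs_of_ne h]

theorem sum_unit_diag : ∑ l, ∑ k, B.unit l k k = 1 := by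
  refine B.ext_basis fun l a j => ?_
  rw [LinearMap.sum_apply, Finset.sum_eq_single l]
  · simp [LinearMap.sum_apply, unit_T_same]
  · intro l' _ h
    simp [LinearMap.sum_apply, B.unit_T_of_ne h]
  · simp

/-- Every operator is the sum of its components. -/
theorem expand (X : Op n d) : X = ∑ l, ∑ a, ∑ k, hs (B.T l a k) X • B.T l a k := by
  have h := congrArg (fun φ : Module.End ℂ (Op n d) => φ X) B.sum_unit_diag
  simp only [LinearMap.sum_apply, unit, LinearMap.smulRight_apply, Module.End.one_apply] at h
  conv_lhs => rw [← h]
  exact Finset.sum_congr rfl fun l _ => Finset.sum_comm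

theorem apply_eq_sum {N : Type*} [AddCommMonoid N] [Module ℂ N] (φ : Op n d →ₗ[ℂ] N)
    (X : Op n d) : φ X = ∑ l, ∑ a, ∑ k, hs (B.T l a k) X • φ (B.T l a k) := by
  conv_lhs => rw [B.expand X]
  simp only [map_sum, map_smul]

/-- A non-zero contraction passes through some basis operator with both factors non-zero. This is
how paths are extracted from non-vanishing sums. -/
theorem exists_hs_ne_zero {N : Type*} [AddCommMonoid N] [Module ℂ N] (φ : Op n d →ₗ[ℂ] N)
    {X : Op n d} (h : φ X ≠ 0) : ∃ l a k, hs (B.T l a k) X ≠ 0 ∧ φ (B.T l a k) ≠ 0 := by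
  by_contra! hc
  apply h
  rw [B.apply_eq_sum φ X]
  refine Finset.sum_eq_zero fun l _ => Finset.sum_eq_zero fun a _ => Finset.sum_eq_zero
    fun k _ => ?_
  by_cases h0 : hs (B.T l a k) X = 0
  · rw [h0, zero_smul]
  · rw [hc l a k h0, smul_zero]

/-- The representation acts on the component space of every copy of an irrep. -/
theorem conjBy_eq (u : G) :
    conjBy (U u : Op n d) = ∑ l, ∑ k, ∑ k', B.coeff l u k k' • B.unit l k k' := by
  refine B.ext_basis fun l a j => ?_
  rw [B.transform, LinearMap.sum_apply, Finset.sum_eq_single l]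
  · simp [LinearMap.sum_apply, unit_T_same, coeff]
  · intro l' _ h
    simp [LinearMap.sum_apply, B.unit_T_of_ne h]
  · simp

/-- An operator that commutes with the representation has components in trivial irreps only. -/
theorem eq_one_of_invariant {X : Op n d} (hX : ∀ u, conjBy (U u : Op n d) X = X)
    {l : Fin B.nIrr} {a : Fin (B.mult l)} {k : Fin (B.dim l)} (h : hs (B.T l a k) X ≠ 0)
    (u : G) : B.v l u = 1 := by
  -- The components of `X` in one copy of `l` form a vector fixed by the representation. If it is
  -- non-zero, its span is an invariant line, which by irreducibility is the whole space.
  set c : Fin (B.dim l) → ℂ := fun k => hs (B.T l a k) X with hc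
  have hfix : ∀ u, (B.v l u : Matrix (Fin (B.dim l)) (Fin (B.dim l)) ℂ) *ᵥ c = c := by
    intro u
    ext j
    have h1 := congrArg (hs (B.T l a j)) (hX u)
    rw [B.conjBy_eq, LinearMap.sum_apply, map_sum, Finset.sum_eq_single l] at h1
    · simp only [LinearMap.sum_apply, LinearMap.smul_apply, map_sum, map_smul, hs_unit_same,
        smul_eq_mul, mul_ite, mul_zero] at h1
      rw [Finset.sum_eq_single j] at h1
      · simpa [Matrix.mulVec, dotProduct, coeff, hc] using h1
      · intro b _ hb
        simp [hb.symm]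
      · simp
    · intro l' _ hl
      simp only [LinearMap.sum_apply, LinearMap.smul_apply, map_sum, map_smul,
        B.hs_unit_of_ne hl.symm, smul_zero, Finset.sum_const_zero]
    · simp
  have hc0 : c ≠ 0 := fun h0 => h (congrFun h0 k)
  have htop : Submodule.span ℂ {c} = ⊤ := by
    refine ((B.irreducible l).2 _ fun u x hx => ?_).resolve_left ?_
    · obtain ⟨z, rfl⟩ := Submodule.mem_span_singleton.1 hx
      rw [Matrix.mulVec_smul, hfix]
      exact Submodule.smul_mem _ _ (Submodule.mem_span_singleton_self c)
    · simpa using hc0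
  apply Subtype.ext
  apply Matrix.ext_of_mulVec_single
  intro j
  obtain ⟨z, hz⟩ := Submodule.mem_span_singleton.1
    (htop ▸ Submodule.mem_top : (Pi.single j 1 : Fin (B.dim l) → ℂ) ∈ Submodule.span ℂ {c})
  rw [← hz, Matrix.mulVec_smul, hfix]
  simp

end ITOBasis

/-! ### Trivial and non-trivial parts of a noisy layer -/

namespace NoisyCircuit

variable {n d : ℕ} {G : Type*} [Group G] [TopologicalSpace G] (C : NoisyCircuit n d G)

/-- The action of a noisy layer on the irrep `l`. -/
def irrepLayer (i : ℕ) (u : G) (l : C.Irr i) : Module.End ℂ (Op n d) :=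
  ∑ k, ∑ k', (C.e i l k * (C.basis i).coeff l u k k') • (C.basis i).unit l k k'

/-- The action of a noisy layer on the non-trivial irreps. -/
def nontrivLayer (i : ℕ) (u : G) : Module.End ℂ (Op n d) :=
  open Classical in ∑ l, if C.IsTriv i l then 0 else C.irrepLayer i u l

theorem noise_mul_unit (i : ℕ) (l : C.Irr i) (k k' : Fin ((C.basis i).dim l)) :
    C.noise i * (C.basis i).unit l k k' = C.e i l k • (C.basis i).unit l k k' := by
  ext1 X
  simp only [ITOBasis.unit, Module.End.mul_apply, LinearMap.sum_apply, LinearMap.smulRight_apply,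
    map_sum, map_smul, C.noise_diagonal, LinearMap.smul_apply, Finset.smul_sum]
  exact Finset.sum_congr rfl fun a _ => smul_comm _ _ _

theorem noise_mul_conjBy (i : ℕ) (u : G) :
    C.noise i * conjBy (C.U i u : Op n d) = ∑ l, C.irrepLayer i u l := by
  rw [(C.basis i).conjBy_eq]
  simp only [Finset.mul_sum, mul_smul_comm, noise_mul_unit, irrepLayer, smul_smul]
  refine Finset.sum_congr rfl fun l _ => Finset.sum_congr rfl fun k _ =>
    Finset.sum_congr rfl fun k' _ => ?_
  rw [mul_comm]

open Classical in
theorem proj_eq (i : ℕ) :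
    C.proj i = ∑ l, if C.IsTriv i l then ∑ k, (C.basis i).unit l k k else 0 := by
  refine Finset.sum_congr rfl fun l _ => ?_
  split_ifs
  · exact Finset.sum_comm
  · rfl

/-- Here `v = 1` and `e = 1`, so the layer no longer depends on the group element; this is what
allows runs of trivial layers to be contracted independently of `g`. -/
theorem irrepLayer_of_isTriv {i : ℕ} (he : ∀ l, C.IsTriv i l → ∀ k, C.e i l k = 1) (u : G)
    {l : C.Irr i} (hl : C.IsTriv i l) :
    C.irrepLayer i u l = ∑ k, (C.basis i).unit l k k := by
  refine Finset.sum_congr rfl fun k _ => ?_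
  rw [Finset.sum_eq_single k]
  · simp [he l hl, ITOBasis.coeff, hl u]
  · intro k' _ hk
    simp [ITOBasis.coeff, hl u, Matrix.one_apply_ne hk.symm]
  · simp

variable {C}

theorem hs_proj (x : C.Node) (X : Op n d) :
    open Classical in hs x.op (C.proj x.pos X) = if x.IsTriv then hs x.op X else 0 := by
  classical
  obtain ⟨i, l, a, k⟩ := x
  simp only [Node.op, proj_eq, LinearMap.sum_apply, map_sum]
  rw [Finset.sum_eq_single l]
  · by_cases h : C.IsTriv i l
    · rw [if_pos h, if_pos (show Node.IsTriv ⟨i, l, a, k⟩ from h)]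
      simp only [LinearMap.sum_apply, map_sum, ITOBasis.hs_unit_same]
      simp
    · rw [if_neg h, if_neg (show ¬ Node.IsTriv ⟨i, l, a, k⟩ from h)]
      simp
  · intro l' _ h
    split_ifs
    · simp only [LinearMap.sum_apply, map_sum, ITOBasis.hs_unit_of_ne _ h.symm]
      simp
    · simp
  · simp

theorem proj_op (x : C.Node) :
    open Classical in C.proj x.pos x.op = if x.IsTriv then x.op else 0 := by
  classical
  obtain ⟨i, l, a, k⟩ := x
  simp only [Node.op, proj_eq, LinearMap.sum_apply]
  rw [Finset.sum_eq_single l]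
  · by_cases h : C.IsTriv i l
    · rw [if_pos h, if_pos (show Node.IsTriv ⟨i, l, a, k⟩ from h)]
      simp only [LinearMap.sum_apply, ITOBasis.unit_T_same]
      simp
    · rw [if_neg h, if_neg (show ¬ Node.IsTriv ⟨i, l, a, k⟩ from h)]
      simp
  · intro l' _ h
    split_ifs
    · simp only [LinearMap.sum_apply, ITOBasis.unit_T_of_ne _ h]
      simp
    · simp
  · simp

theorem hs_nontrivLayer_of_isTriv (x : C.Node) (u : G) (hx : x.IsTriv) (X : Op n d) :
    hs x.op (C.nontrivLayer x.pos u X) = 0 := by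
  classical
  obtain ⟨i, l, a, k⟩ := x
  simp only [Node.op, Node.IsTriv, nontrivLayer, LinearMap.sum_apply, map_sum] at hx ⊢
  refine Finset.sum_eq_zero fun l' _ => ?_
  split_ifs with h
  · simp
  · have hne : l ≠ l' := by rintro rfl; exact h hx
    simp only [irrepLayer, LinearMap.sum_apply, map_sum, LinearMap.smul_apply, map_smul,
      ITOBasis.hs_unit_of_ne _ hne, smul_zero, Finset.sum_const_zero]

/-- The row is fixed and the column summed: the form for the search to the right, which meets a
layer at its left component. `nontrivLayer_op` is the mirror image for the search to the left. -/
theorem hs_nontrivLayer (x : C.Node) (u : G) (hx : ¬ x.IsTriv) (X : Op n d) :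
    hs x.op (C.nontrivLayer x.pos u X) =
      ∑ k', C.e x.pos x.irr x.comp * (C.basis x.pos).coeff x.irr u x.comp k' *
        hs (Node.op ⟨x.pos, x.irr, x.mul, k'⟩ : Op n d) X := by
  classical
  obtain ⟨i, l, a, k⟩ := x
  simp only [Node.op, Node.IsTriv, nontrivLayer, LinearMap.sum_apply, map_sum] at hx ⊢
  rw [Finset.sum_eq_single l, if_neg hx]
  · simp only [irrepLayer, LinearMap.sum_apply, map_sum, LinearMap.smul_apply, map_smul,
      ITOBasis.hs_unit_same, smul_eq_mul, mul_ite, mul_zero]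
    rw [Finset.sum_eq_single k]
    · simp
    · intro b _ hb
      simp [hb.symm]
    · simp
  · intro l' _ h
    split_ifs
    · simp
    · simp only [irrepLayer, LinearMap.sum_apply, map_sum, LinearMap.smul_apply, map_smul,
        ITOBasis.hs_unit_of_ne _ h.symm, smul_zero, Finset.sum_const_zero]
  · simp

theorem nontrivLayer_op_of_isTriv (x : C.Node) (u : G) (hx : x.IsTriv) :
    C.nontrivLayer x.pos u x.op = 0 := by
  classical
  obtain ⟨i, l, a, k⟩ := x
  simp only [Node.op, Node.IsTriv, nontrivLayer, LinearMap.sum_apply] at hx ⊢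
  refine Finset.sum_eq_zero fun l' _ => ?_
  split_ifs with h
  · simp
  · have hne : l' ≠ l := by rintro rfl; exact h hx
    simp only [irrepLayer, LinearMap.sum_apply, LinearMap.smul_apply,
      ITOBasis.unit_T_of_ne _ hne, smul_zero, Finset.sum_const_zero]

theorem nontrivLayer_op (x : C.Node) (u : G) (hx : ¬ x.IsTriv) :
    C.nontrivLayer x.pos u x.op =
      ∑ k, (C.e x.pos x.irr k * (C.basis x.pos).coeff x.irr u k x.comp) •
        (Node.op ⟨x.pos, x.irr, x.mul, k⟩ : Op n d) := by
  classical
  obtain ⟨i, l, a, k⟩ := x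
  simp only [Node.op, Node.IsTriv, nontrivLayer, LinearMap.sum_apply] at hx ⊢
  rw [Finset.sum_eq_single l, if_neg hx]
  · simp only [irrepLayer, LinearMap.sum_apply, LinearMap.smul_apply, ITOBasis.unit_T_same,
      smul_ite, smul_zero]
    simp
  · intro l' _ h
    split_ifs
    · simp
    · simp only [irrepLayer, LinearMap.sum_apply, LinearMap.smul_apply,
        ITOBasis.unit_T_of_ne _ h, smul_zero, Finset.sum_const_zero]
  · simp

/-! ## The nodes of a layer -/

variable (C)

/-- The basis operators of layer `i`. -/
def nodesAt (i : ℕ) : Finset C.Node :=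
  (Finset.univ : Finset ((l : C.Irr i) × Fin ((C.basis i).mult l) × Fin ((C.basis i).dim l))).map
    ⟨fun t => ⟨i, t.1, t.2.1, t.2.2⟩, by
      rintro ⟨l, a, k⟩ ⟨l', a', k'⟩ h
      simp only [Node.mk.injEq, heq_eq_eq, true_and] at h
      obtain ⟨rfl, h⟩ := h
      simp only [heq_eq_eq] at h
      obtain ⟨rfl, rfl⟩ := h
      rfl⟩

variable {C}

theorem mem_nodesAt {i : ℕ} {x : C.Node} : x ∈ C.nodesAt i ↔ x.pos = i := by
  simp only [nodesAt, Finset.mem_map, Finset.mem_univ, true_and]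
  constructor
  · rintro ⟨t, rfl⟩
    rfl
  · rintro rfl
    exact ⟨⟨x.irr, x.mul, x.comp⟩, rfl⟩

theorem sum_nodesAt {N : Type*} [AddCommMonoid N] (i : ℕ) (F : C.Node → N) :
    ∑ x ∈ C.nodesAt i, F x = ∑ l, ∑ a, ∑ k, F ⟨i, l, a, k⟩ := by
  simp only [nodesAt, Finset.sum_map, Fintype.sum_sigma, Fintype.sum_prod_type]
  rfl

theorem apply_eq_sum_nodesAt {N : Type*} [AddCommMonoid N] [Module ℂ N] (i : ℕ)
    (φ : Op n d →ₗ[ℂ] N) (X : Op n d) : φ X = ∑ x ∈ C.nodesAt i, hs x.op X • φ x.op := by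
  rw [sum_nodesAt]
  exact (C.basis i).apply_eq_sum φ X

theorem exists_node_hs_ne_zero {N : Type*} [AddCommMonoid N] [Module ℂ N] (i : ℕ)
    (φ : Op n d →ₗ[ℂ] N) {X : Op n d} (h : φ X ≠ 0) :
    ∃ x : C.Node, x.pos = i ∧ hs x.op X ≠ 0 ∧ φ x.op ≠ 0 := by
  obtain ⟨l, a, k, h⟩ := (C.basis i).exists_hs_ne_zero φ h
  exact ⟨⟨i, l, a, k⟩, rfl, h⟩

/-! ## Runs of trivial layers -/

/-- `run` grows at its right end by definition; recursions that start at the left end need the same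
product opened there. -/
theorem run_succ' (i m : ℕ) : C.run i (m + 1) = C.superW i * C.proj (i + 1) * C.run (i + 1) m := by
  induction m with
  | zero => rfl
  | succ m ih =>
    rw [run, ih, run, show i + 1 + m + 1 = i + (m + 1) + 1 by ring]
    simp only [mul_assoc]

theorem coef_eq {x y : C.Node} (h : x.pos < y.pos) :
    coef x y = hs x.op (C.run x.pos (y.pos - x.pos - 1) y.op) := if_pos h

theorem coef_eq_run {x y : C.Node} {m : ℕ} (h : y.pos = x.pos + m + 1) :
    coef x y = hs x.op (C.run x.pos m y.op) := by
  rw [coef_eq (by omega), show y.pos - x.pos - 1 = m by omega]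

theorem lt_of_coef_ne_zero {x y : C.Node} (h : coef x y ≠ 0) : x.pos < y.pos := by
  by_contra hlt
  exact h (if_neg hlt)

/-- The last step of a run that ends to the right. -/
theorem exists_last_of_coef_ne_zero {x y : C.Node} {m : ℕ} (hxy : y.pos = x.pos + (m + 1) + 1)
    (h : coef x y ≠ 0) : ∃ z : C.Node, z.IsTriv ∧ z.pos = x.pos + m + 1 ∧ coef x z ≠ 0 ∧
      hs z.op (C.superW z.pos y.op) ≠ 0 := by
  rw [coef_eq_run hxy, run] at h
  obtain ⟨z, hz, h1, h2⟩ := exists_node_hs_ne_zero (C := C) (x.pos + m + 1)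
    (hs x.op ∘ₗ C.run x.pos m) (X := C.proj (x.pos + m + 1) (C.superW (x.pos + m + 1) y.op)) h
  rw [← hz, hs_proj] at h1
  split_ifs at h1 with ht
  · exact ⟨z, ht, hz, by rw [coef_eq_run hz]; exact h2, h1⟩
  · exact absurd rfl h1

/-- The first step of a run that ends to the left. -/
theorem exists_first_of_coef_ne_zero {x y : C.Node} {m : ℕ} (hxy : y.pos = x.pos + (m + 1) + 1)
    (h : coef x y ≠ 0) : ∃ z : C.Node, z.IsTriv ∧ z.pos = x.pos + 1 ∧ coef z y ≠ 0 ∧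
      hs x.op (C.superW x.pos z.op) ≠ 0 := by
  rw [coef_eq_run hxy, run_succ'] at h
  obtain ⟨z, hz, h1, h2⟩ := exists_node_hs_ne_zero (C := C) (x.pos + 1)
    (hs x.op ∘ₗ C.superW x.pos) (X := C.proj (x.pos + 1) (C.run (x.pos + 1) m y.op)) h
  rw [← hz, hs_proj] at h1
  split_ifs at h1 with ht
  · exact ⟨z, ht, hz, by rw [coef_eq_run (m := m) (by omega)]; exact h1, h2⟩
  · exact absurd rfl h1

/-! ## The identity operator -/

theorem conjBy_one_of_unitary (V : Matrix.unitaryGroup (Outcome n d) ℂ) :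
    conjBy (V : Op n d) 1 = 1 := by
  rw [conjBy_apply, one_mul]
  exact Matrix.mem_unitaryGroup_iff.1 V.2

/-- The identity is fixed by all unitary conjugations, so it has components in trivial irreps only
and survives every `Π₀` and every `W`. It thus provides a non-zero contraction between trivial nodes
over any distance, the source of the bounds `1 ≤ s`, `1 ≤ dmax` and `1 ≤ r`. -/
theorem isTriv_of_hs_one_ne_zero {x : C.Node} (h : hs x.op (1 : Op n d) ≠ 0) : x.IsTriv :=
  fun u => (C.basis x.pos).eq_one_of_invariant (fun _ => conjBy_one_of_unitary _) h u

theorem proj_one (i : ℕ) : C.proj i 1 = 1 := by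
  classical
  have h := apply_eq_sum_nodesAt (C := C) i (C.proj i) 1
  have h' := apply_eq_sum_nodesAt (C := C) i (LinearMap.id) 1
  rw [h]
  refine Eq.trans ?_ h'.symm
  refine Finset.sum_congr rfl fun x hx => ?_
  by_cases h0 : hs x.op (1 : Op n d) = 0
  · rw [h0, zero_smul, zero_smul]
  · rw [← mem_nodesAt.1 hx, proj_op, if_pos (isTriv_of_hs_one_ne_zero h0), LinearMap.id_apply]

theorem run_one (i m : ℕ) : C.run i m 1 = 1 := by
  induction m with
  | zero => exact conjBy_one_of_unitary _
  | succ m ih =>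
    rw [run, Module.End.mul_apply, Module.End.mul_apply, superW, conjBy_one_of_unitary, proj_one,
      ih]

theorem exists_node_hs_one_ne_zero [NeZero d] (C : NoisyCircuit n d G) (i : ℕ) :
    ∃ x : C.Node, x.pos = i ∧ hs x.op (1 : Op n d) ≠ 0 := by
  obtain ⟨x, hx, h, -⟩ := exists_node_hs_ne_zero (C := C) i (LinearMap.id) (X := (1 : Op n d))
    one_ne_zero
  exact ⟨x, hx, h⟩

/-- The identity operator propagates along trivial nodes. -/
theorem exists_coef_ne_zero {x : C.Node} (hx : hs x.op (1 : Op n d) ≠ 0) (m : ℕ) :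
    ∃ y : C.Node, y.pos = x.pos + m + 1 ∧ hs y.op (1 : Op n d) ≠ 0 ∧ coef x y ≠ 0 := by
  have h : (hs x.op ∘ₗ C.run x.pos m) 1 ≠ 0 := by
    rwa [LinearMap.comp_apply, run_one]
  obtain ⟨y, hy, h1, h2⟩ := exists_node_hs_ne_zero (C := C) (x.pos + m + 1) _ h
  exact ⟨y, hy, h1, by rw [coef_eq_run hy]; exact h2⟩

end NoisyCircuit

namespace NoisyCircuit

variable {n d : ℕ} {G : Type*} [Group G] [TopologicalSpace G] (C : NoisyCircuit n d G)

/-! ## Operator families indexed by the number of admissible non-trivial layers -/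

/-- One admissible non-trivial layer is used up. -/
def shift : (ℕ → Op n d) →ₗ[ℂ] (ℕ → Op n d) where
  toFun F b := Nat.casesOn b 0 F
  map_add' F F' := by ext1 b; cases b <;> simp
  map_smul' c F := by ext1 b; cases b <;> simp

@[simp] theorem shift_zero (F : ℕ → Op n d) : shift F 0 = 0 := rfl

@[simp] theorem shift_succ (F : ℕ → Op n d) (b : ℕ) : shift F (b + 1) = F b := rfl

/-- Pointwise application of an operator to a family. -/
def lift (φ : Module.End ℂ (Op n d)) : (ℕ → Op n d) →ₗ[ℂ] (ℕ → Op n d) :=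
  φ.compLeft ℕ

@[simp] theorem lift_apply (φ : Module.End ℂ (Op n d)) (F : ℕ → Op n d) (b : ℕ) :
    lift φ F b = φ (F b) := rfl

theorem lift_shift (φ : Module.End ℂ (Op n d)) (F : ℕ → Op n d) :
    lift φ (shift F) = shift (lift φ F) := by
  ext1 b; cases b <;> simp

variable (u : ℕ → G) (M : ℕ) (ρ : Op n d)

/-- A layer `i` with the following `Wᵢ`. -/
def stepFam (i : ℕ) : (ℕ → Op n d) →ₗ[ℂ] (ℕ → Op n d) :=
  lift (C.proj i * C.superW i) + lift (C.nontrivLayer i (u i) * C.superW i) ∘ₗ shift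

/-- The layers before layer `t`. -/
def prefixFam : ℕ → (ℕ → Op n d) →ₗ[ℂ] (ℕ → Op n d)
  | 0 => LinearMap.id
  | t + 1 => prefixFam t ∘ₗ C.stepFam u t

theorem stepFam_apply (i : ℕ) (F : ℕ → Op n d) (b : ℕ) :
    C.stepFam u i F b =
      C.proj i (C.superW i (F b)) + C.nontrivLayer i (u i) (C.superW i (shift F b)) := rfl

theorem stepFam_shift (i : ℕ) (F : ℕ → Op n d) :
    C.stepFam u i (shift F) = shift (C.stepFam u i F) := by
  ext1 b
  cases b <;> simp [stepFam_apply]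

/-- The layers treat all budgets alike, so a unit spent at layer `t` can be charged before or after
the layers to its left. -/
theorem prefixFam_shift (t : ℕ) (F : ℕ → Op n d) :
    C.prefixFam u t (shift F) = shift (C.prefixFam u t F) := by
  induction t generalizing F with
  | zero => rfl
  | succ t ih => simp only [prefixFam, LinearMap.comp_apply, stepFam_shift, ih]

/-- The sum over runs of trivial layers that start at layer `p` and reach over at most `gap`
steps, each followed by the operator given for the layer that is reached. -/
def reach (p gap : ℕ) (F : ℕ → Op n d) : Op n d :=
  ∑ t ∈ Finset.range gap, if p + 1 + t ≤ C.depth then C.run p t (F (p + 1 + t)) else 0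

/-- The sum over the paths with at most `b` non-trivial layers from layer `j` to the end, where
layer `j` is non-trivial and no `M + 2` consecutive layers are trivial. -/
def suffix : ℕ → ℕ → Op n d
  | 0, j => if j = C.depth then ρ else 0
  | b + 1, j => if j = C.depth then ρ else
      C.nontrivLayer j (u j) (C.reach j (M + 2) (suffix b))

theorem suffix_depth (b : ℕ) : C.suffix u M ρ b C.depth = ρ := by
  cases b <;> simp [suffix]

theorem suffix_zero {j : ℕ} (h : j ≠ C.depth) : C.suffix u M ρ 0 j = 0 := by
  simp [suffix, h]

theorem suffix_succ {j : ℕ} (b : ℕ) (h : j ≠ C.depth) :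
    C.suffix u M ρ (b + 1) j =
      C.nontrivLayer j (u j) (C.reach j (M + 2) (C.suffix u M ρ b)) := by
  simp [suffix, h]

theorem reach_succ (p gap : ℕ) (F : ℕ → Op n d) :
    C.reach p (gap + 1) F = C.reach p gap F +
      if p + 1 + gap ≤ C.depth then C.run p gap (F (p + 1 + gap)) else 0 := by
  rw [reach, Finset.sum_range_succ, reach]

theorem reach_succ' (p gap : ℕ) (F : ℕ → Op n d) (hp : p + 1 ≤ C.depth) :
    C.reach p (gap + 1) F =
      C.superW p (F (p + 1) + C.proj (p + 1) (C.reach (p + 1) gap F)) := by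
  rw [reach, Finset.sum_range_succ', add_comm, map_add, reach, map_sum, map_sum]
  congr 1
  · simp [hp, run]
  · refine Finset.sum_congr rfl fun t _ => ?_
    rw [show p + 1 + (t + 1) = p + 1 + 1 + t by ring]
    split_ifs
    · rw [run_succ']
      rfl
    · simp

theorem reach_eq_zero {p gap : ℕ} {F : ℕ → Op n d}
    (h : ∀ j, p < j → j ≤ p + gap → j ≤ C.depth → F j = 0) : C.reach p gap F = 0 := by
  refine Finset.sum_eq_zero fun t ht => ?_
  rw [Finset.mem_range] at ht
  split_ifs with hD
  · rw [h _ (by omega) (by omega) hD, map_zero]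
  · rfl

/-- The sum over the paths from layer `i` to the end without `M + 2` consecutive trivial
layers. -/
def windowFree (i b : ℕ) : Op n d :=
  C.suffix u M ρ b i + C.proj i (C.reach i (M + 1) (C.suffix u M ρ b))

/-- The sum over the paths from layer `i` to the end that start with exactly `M + 2` trivial
layers. -/
def windowFirst (i b : ℕ) : Op n d :=
  if i + M + 2 ≤ C.depth then C.proj i (C.run i (M + 1) (C.suffix u M ρ b (i + M + 2))) else 0

/-- A layer is prepended to the paths without a window. If it is non-trivial, a `suffix` results. If
it is trivial, the initial run grows by one; only a run of `M + 1` layers becomes a window, and this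
case is split off as `windowFirst`. -/
theorem stepFam_windowFree {i : ℕ} (hi : i < C.depth) :
    C.stepFam u i (C.windowFree u M ρ (i + 1)) =
      C.windowFree u M ρ i + C.windowFirst u M ρ i := by
  have hW : ∀ b, C.superW i (C.windowFree u M ρ (i + 1) b) =
      C.reach i (M + 2) (C.suffix u M ρ b) := fun b =>
    (C.reach_succ' i (M + 1) _ hi).symm
  ext1 b
  rw [stepFam_apply, hW, reach_succ, map_add, Pi.add_apply, windowFree, windowFirst,
    show i + 1 + (M + 1) = i + M + 2 by ring]
  have hA : C.nontrivLayer i (u i) (C.superW i (shift (C.windowFree u M ρ (i + 1)) b)) =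
      C.suffix u M ρ b i := by
    cases b with
    | zero => simp [C.suffix_zero u M ρ hi.ne]
    | succ b => rw [shift_succ, hW, C.suffix_succ u M ρ b hi.ne]
  rw [hA, apply_ite (C.proj i), map_zero]
  abel

/-- Decomposition of the sum over all paths according to the position of their last `M + 2`
consecutive trivial layers. -/
theorem prefixFam_const_eq :
    C.prefixFam u C.depth (fun _ => ρ) = C.windowFree u M ρ 0 +
      ∑ i ∈ Finset.range C.depth, C.prefixFam u i (C.windowFirst u M ρ i) := by
  -- Telescoping along `stepFam_windowFree`. At `t = C.depth` only the input operator is left of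
  -- `windowFree`.
  have h : ∀ t ≤ C.depth, C.prefixFam u t (C.windowFree u M ρ t) = C.windowFree u M ρ 0 +
      ∑ i ∈ Finset.range t, C.prefixFam u i (C.windowFirst u M ρ i) := by
    intro t
    induction t with
    | zero => intro _; simp [prefixFam]
    | succ t ih =>
      intro ht
      rw [prefixFam, LinearMap.comp_apply, C.stepFam_windowFree u M ρ ht, map_add, ih (by omega),
        Finset.sum_range_succ, add_assoc]
  rw [← h _ le_rfl]
  congr 1
  ext1 b
  rw [windowFree, suffix_depth, C.reach_eq_zero (fun j h1 _ h2 => absurd h2 (by omega)), map_zero,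
    add_zero]

/-- A non-trivial layer together with the at most `M + 1` trivial ones behind it advances by at most
`M + 2`, so `b` of them cannot bridge more than `b * (M + 2)` layers. -/
theorem suffix_eq_zero (b : ℕ) {j : ℕ} (hj : j + b * (M + 2) < C.depth) :
    C.suffix u M ρ b j = 0 := by
  induction b generalizing j with
  | zero => exact C.suffix_zero u M ρ (by omega)
  | succ b ih =>
    rw [add_mul, one_mul] at hj
    rw [C.suffix_succ u M ρ b (by omega), C.reach_eq_zero, map_zero]
    intro j' _ h2 _
    exact ih (by omega)

/-- With at most `L` non-trivial layers there are `M + 2` consecutive trivial ones. -/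
theorem windowFree_eq_zero {L : ℕ} (h : (L + 1) * (M + 2) ≤ C.depth) :
    C.windowFree u M ρ 0 L = 0 := by
  rw [add_mul, one_mul] at h
  -- The initial run ends at layer `M + 1` at the latest, and `L * (M + 2)` further steps reach at
  -- most layer `(L + 1) * (M + 2) - 1`, which is before the end.
  rw [windowFree, suffix_eq_zero _ _ _ _ _ (by omega), C.reach_eq_zero, map_zero, add_zero]
  intro j _ h2 _
  exact C.suffix_eq_zero u M ρ L (by omega)

/-! ## Decomposition according to the last non-trivial layer -/

/-- The contribution of runs of trivial layers that start at the left end. -/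
def trivialPrefix (p : ℕ) : Module.End ℂ (Op n d) :=
  Nat.casesOn p 1 fun p => C.proj 0 * C.run 0 p

/-- The paths are sorted by their last non-trivial layer `j` before `p`, behind which there is a run
of trivial layers; `trivialPrefix` is the case without such a layer. The unit of budget spent at `j`
is the `shift`. -/
theorem prefixFam_eq_sum (p : ℕ) (F : ℕ → Op n d) :
    C.prefixFam u p F = lift (C.trivialPrefix p) F +
      ∑ j ∈ Finset.range p, C.prefixFam u j
        (lift (C.nontrivLayer j (u j) * C.run j (p - j - 1)) (shift F)) := by
  induction p generalizing F with
  | zero => rw [Finset.range_zero, Finset.sum_empty, add_zero]; rfl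
  | succ p ih =>
    rw [prefixFam, LinearMap.comp_apply, stepFam, LinearMap.add_apply, map_add, ih,
      Finset.sum_range_succ, add_assoc, LinearMap.comp_apply]
    congr 1
    · cases p with
      | zero => rfl
      | succ p => ext1 b; simp [trivialPrefix, run]
    · congr 1
      · refine Finset.sum_congr rfl fun j hj => ?_
        rw [Finset.mem_range] at hj
        rw [← lift_shift]
        have h1 : p - j - 1 + 1 = p + 1 - j - 1 := by omega
        have h2 : j + (p - j - 1) + 1 = p := by omega
        rw [← h1, run, h2]
        rfl
      · simp [run]

end NoisyCircuit

/-! ### Branching of the search: node values as sums over children -/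

namespace NoisyCircuit

variable {n d : ℕ} {G : Type*} [Group G] [TopologicalSpace G] {C : NoisyCircuit n d G}

/-- The basis operator with another component of the same copy of the irrep. -/
def Node.withComp (x : C.Node) (k : Fin ((C.basis x.pos).dim x.irr)) : C.Node :=
  ⟨x.pos, x.irr, x.mul, k⟩

/-- Converts the lists returned by subroutines, which come in any order, into sums over whole
layers; the nodes that are missing contribute zero. -/
theorem sum_map_eq_sum_nodesAt {ls : List C.Node} (hnd : ls.Nodup) (J : Finset ℕ)
    (F : C.Node → ℂ) (h : ∀ z ∈ ls, z.pos ∈ J) (h' : ∀ z : C.Node, z.pos ∈ J → z ∉ ls → F z = 0) :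
    (ls.map F).sum = ∑ j ∈ J, ∑ z ∈ C.nodesAt j, F z := by
  classical
  rw [← List.sum_toFinset F hnd,
    ← Finset.sum_fiberwise_of_maps_to (s := ls.toFinset) (t := J) (g := Node.pos)
      (fun z hz => h z (List.mem_toFinset.1 hz))]
  refine Finset.sum_congr rfl fun j hj => Finset.sum_subset ?_ ?_
  · intro z hz
    exact mem_nodesAt.2 (Finset.mem_filter.1 hz).2
  · intro z hz hz'
    obtain rfl := mem_nodesAt.1 hz
    refine h' z hj fun hzl => hz' ?_
    simpa using hzl

section Right

variable (C) (u : ℕ → G) (M : ℕ) (ρ : Op n d)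

/-- The sum over the paths to the right of `y` whose first run of trivial layers has less than
`gap` layers. -/
def rightValue (y : C.Node) (gap b : ℕ) : ℂ :=
  hs y.op (C.reach y.pos gap (C.suffix u M ρ b))

variable {C}

/-- Within reach, a node that is not a child has a vanishing coefficient or is trivial before the
end, and `suffix` has no component along the latter. -/
theorem rightValue_eq_sum (y : C.Node) (gap b : ℕ) {ls : List C.Node} (hnd : ls.Nodup)
    (hls : ∀ z, z ∈ ls ↔ z ∈ rightChildren y ∧ y.pos + 1 ≤ z.pos ∧ z.pos < y.pos + 1 + gap) :
    C.rightValue u M ρ y gap b =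
      (ls.map fun z => coef y z * hs z.op (C.suffix u M ρ b z.pos)).sum := by
  rw [sum_map_eq_sum_nodesAt hnd (((Finset.range gap).image fun t => y.pos + 1 + t).filter
    fun j => j ≤ C.depth), Finset.sum_filter, Finset.sum_image (by intro a _ b _ h; simpa using h),
    rightValue, reach, map_sum]
  · refine Finset.sum_congr rfl fun t _ => ?_
    split_ifs
    · refine (apply_eq_sum_nodesAt (C := C) (y.pos + 1 + t) (hs y.op ∘ₗ C.run y.pos t) _).trans ?_
      refine Finset.sum_congr rfl fun z hz => ?_
      rw [mem_nodesAt] at hz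
      rw [coef_eq_run (m := t) (by omega), hz, smul_eq_mul, mul_comm]
      rfl
    · simp
  · intro z hz
    obtain ⟨h1, h2, h3⟩ := (hls z).1 hz
    simp only [Finset.mem_filter, Finset.mem_image, Finset.mem_range]
    exact ⟨⟨z.pos - (y.pos + 1), by omega, by omega⟩, h1.2.1⟩
  · intro z hz hz'
    simp only [Finset.mem_filter, Finset.mem_image, Finset.mem_range] at hz
    obtain ⟨⟨t, ht, hzt⟩, hD⟩ := hz
    by_contra h0
    rw [mul_eq_zero, not_or] at h0
    refine hz' ((hls z).2 ⟨⟨by omega, hD, h0.1, ?_⟩, by omega, by omega⟩)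
    by_contra hc
    rw [not_or, not_not] at hc
    apply h0.2
    cases b with
    | zero => rw [C.suffix_zero u M ρ hc.1, map_zero]
    | succ b => rw [C.suffix_succ u M ρ b hc.1, hs_nontrivLayer_of_isTriv z _ hc.2]

theorem hs_suffix_succ {z : C.Node} (hz : ¬ z.IsTriv) (hD : z.pos ≠ C.depth) (b : ℕ) :
    hs z.op (C.suffix u M ρ (b + 1) z.pos) =
      ∑ k, C.e z.pos z.irr z.comp * (C.basis z.pos).coeff z.irr (u z.pos) z.comp k *
        C.rightValue u M ρ (z.withComp k) (M + 2) b := by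
  rw [C.suffix_succ u M ρ b hD, hs_nontrivLayer z _ hz]
  rfl

end Right

section Left

variable (C) (u : ℕ → G) (mu : Op n d →ₗ[ℂ] ℂ) (f : ℕ → ℂ)

/-- The sum over the paths to the left of `x`, weighted with a function of the number of
non-trivial layers that are left over. -/
def leftValue (x : C.Node) (b : ℕ) : ℂ :=
  mu (C.prefixFam u x.pos (fun b => f b • x.op) b)

/-- The contribution to `leftValue` of a node at which a run of trivial layers ends. -/
def leftChildValue (z : C.Node) (b : ℕ) : ℂ :=
  open Classical in
  if z.IsTriv then C.leftValue u mu f z b else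
    Nat.casesOn b 0 fun b => ∑ k, C.e z.pos z.irr k * (C.basis z.pos).coeff z.irr (u z.pos) k z.comp *
      C.leftValue u mu f (z.withComp k) b

variable {C}

theorem leftValue_of_pos_eq_zero {x : C.Node} (hx : x.pos = 0) (b : ℕ) :
    C.leftValue u mu f x b = f b * mu x.op := by
  rw [leftValue, hx, prefixFam, LinearMap.id_apply, map_smul, smul_eq_mul]

theorem leftValue_trivial_part {x : C.Node} (hx : 0 < x.pos) (b : ℕ) :
    open Classical in
    mu (C.trivialPrefix x.pos (f b • x.op)) = ∑ z ∈ C.nodesAt 0,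
      if z.IsTriv then coef z x * (f b * mu z.op) else 0 := by
  classical
  obtain ⟨p, hp⟩ := Nat.exists_eq_succ_of_ne_zero hx.ne'
  rw [hp, map_smul, map_smul]
  refine (congrArg (f b • ·) (apply_eq_sum_nodesAt (C := C) 0 (mu ∘ₗ C.proj 0)
    (C.run 0 p x.op))).trans ?_
  rw [Finset.smul_sum]
  refine Finset.sum_congr rfl fun z hz => ?_
  rw [mem_nodesAt] at hz
  rw [coef_eq_run (m := p) (by omega), LinearMap.comp_apply, ← hz, proj_op]
  split_ifs
  · simp only [smul_eq_mul]; ring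
  · simp

theorem leftValue_nontrivial_part (x : C.Node) {j : ℕ} (hj : j < x.pos) (b : ℕ) :
    open Classical in
    mu (C.prefixFam u j (lift (C.nontrivLayer j (u j) * C.run j (x.pos - j - 1))
      (shift fun b => f b • x.op)) b) = ∑ z ∈ C.nodesAt j,
      if z.IsTriv then 0 else coef z x * C.leftChildValue u mu f z b := by
  classical
  rw [lift_shift, prefixFam_shift]
  cases b with
  | zero =>
    rw [shift_zero, map_zero]
    refine (Finset.sum_eq_zero fun z _ => ?_).symm
    split_ifs with h
    · rfl
    · simp [leftChildValue, h]
  | succ b =>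
    have hF : lift (C.nontrivLayer j (u j) * C.run j (x.pos - j - 1)) (fun b => f b • x.op) =
        ∑ z ∈ C.nodesAt j, coef z x • fun b => f b • C.nontrivLayer j (u j) z.op := by
      ext1 b
      rw [Finset.sum_apply, lift_apply, Module.End.mul_apply, map_smul, map_smul,
        apply_eq_sum_nodesAt (C := C) j (C.nontrivLayer j (u j)) (C.run j _ x.op), Finset.smul_sum]
      refine Finset.sum_congr rfl fun z hz => ?_
      rw [mem_nodesAt] at hz
      rw [coef_eq_run (m := x.pos - j - 1) (by omega), Pi.smul_apply, smul_comm, hz]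
    rw [shift_succ, hF, map_sum, Finset.sum_apply, map_sum]
    refine Finset.sum_congr rfl fun z hz => ?_
    rw [mem_nodesAt] at hz
    subst hz
    rw [map_smul, Pi.smul_apply, map_smul, smul_eq_mul]
    split_ifs with h
    · simp only [nontrivLayer_op_of_isTriv z _ h, smul_zero]
      rw [show (fun _ : ℕ => (0 : Op n d)) = 0 from rfl, map_zero, Pi.zero_apply, map_zero,
        mul_zero]
    · have hA : (fun b => f b • C.nontrivLayer z.pos (u z.pos) z.op) =
          ∑ k, (C.e z.pos z.irr k * (C.basis z.pos).coeff z.irr (u z.pos) k z.comp) •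
            fun b => f b • (z.withComp k).op := by
        ext1 b
        rw [nontrivLayer_op z _ h, Finset.sum_apply, Finset.smul_sum]
        exact Finset.sum_congr rfl fun k _ => smul_comm _ _ _
      rw [hA, map_sum, Finset.sum_apply, map_sum]
      simp only [leftChildValue, if_neg h, map_smul, Pi.smul_apply, smul_eq_mul]
      rfl

/-- By `prefixFam_eq_sum` a run to the left ends at a non-trivial node of any layer or at a trivial
node of layer `0`. With a non-zero coefficient these are exactly the children, and `key` checks this
node by node. -/
theorem leftValue_eq_sum {x : C.Node} (hx : 0 < x.pos) (b : ℕ) {ls : List C.Node}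
    (hnd : ls.Nodup) (hls : ∀ z, z ∈ ls ↔ z ∈ leftChildren x) :
    C.leftValue u mu f x b = (ls.map fun z => coef z x * C.leftChildValue u mu f z b).sum := by
  classical
  have key : ∀ z : C.Node, (if z.pos = 0 then (if z.IsTriv then coef z x * (f b * mu z.op) else 0)
      else 0) + (if z.IsTriv then 0 else coef z x * C.leftChildValue u mu f z b) =
      if z ∈ ls then coef z x * C.leftChildValue u mu f z b else 0 := by
    intro z
    by_cases ht : z.IsTriv
    · by_cases h0 : z.pos = 0
      · by_cases hc : coef z x = 0
        · simp [ht, hc]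
        · have : z ∈ ls := (hls z).2 ⟨lt_of_coef_ne_zero hc, hc, Or.inl h0⟩
          simp [ht, h0, this, leftChildValue, leftValue_of_pos_eq_zero u mu f h0]
      · have : z ∉ ls := fun h => ((hls z).1 h).2.2.elim h0 (fun h => h ht)
        simp [ht, h0, this]
    · by_cases hc : coef z x = 0
      · simp [ht, hc]
      · have : z ∈ ls := (hls z).2 ⟨lt_of_coef_ne_zero hc, hc, Or.inr ht⟩
        simp [ht, this]
  have hsum : (ls.map fun z => coef z x * C.leftChildValue u mu f z b).sum =
      ∑ j ∈ Finset.range x.pos, ∑ z ∈ C.nodesAt j,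
        if z ∈ ls then coef z x * C.leftChildValue u mu f z b else 0 := by
    rw [← sum_map_eq_sum_nodesAt hnd]
    · congr 1
      exact List.map_congr_left fun z hz => (if_pos hz).symm
    · intro z hz
      exact Finset.mem_range.2 ((hls z).1 hz).1
    · intro z _ hz
      exact if_neg hz
  rw [hsum, leftValue, prefixFam_eq_sum, Pi.add_apply, map_add, lift_apply,
    leftValue_trivial_part mu f hx, Finset.sum_apply, map_sum]
  simp only [← key, Finset.sum_add_distrib]
  congr 1
  · refine Eq.trans ?_ (Finset.sum_eq_single 0 ?_ ?_).symm
    · refine Finset.sum_congr rfl fun z hz => ?_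
      rw [if_pos (mem_nodesAt.1 hz)]
    · intro j _ hj
      refine Finset.sum_eq_zero fun z hz => ?_
      rw [if_neg (by rw [mem_nodesAt.1 hz]; exact hj)]
    · intro h
      exact absurd (Finset.mem_range.2 hx) h
  · exact Finset.sum_congr rfl fun j hj =>
      leftValue_nontrivial_part u mu f x (Finset.mem_range.1 hj) b

/-- The contribution of the window at layer `i`. -/
theorem windowFirst_eq_sum (M : ℕ) (ρ : Op n d) {i L : ℕ} (hi : i + M + 1 < C.depth)
    {ls : List (C.Node × C.Node)} (hnd : ls.Nodup) (hls : ∀ z, z ∈ ls ↔ z ∈ C.fullTerms i M) :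
    mu (C.prefixFam u i (C.windowFirst u M ρ i) L) =
      (ls.map fun z => coef z.1 z.2 *
        C.leftValue u mu (fun b => C.rightValue u M ρ z.2 1 b) z.1 L).sum := by
  classical
  -- The outer projectors of the full contraction force both ends to be trivial. The last `W` of the
  -- window, from layer `i + M + 1` to `i + M + 2`, is left to `rightValue` with gap `1`.
  have hw : C.windowFirst u M ρ i = (ls.map fun z => coef z.1 z.2 •
      fun b => C.rightValue u M ρ z.2 1 b • z.1.op).sum := by
    ext1 b
    have h1 : ∀ X : Op n d, C.proj i X = ∑ x ∈ C.nodesAt i,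
        hs x.op X • (if x.IsTriv then x.op else 0) := by
      intro X
      rw [apply_eq_sum_nodesAt (C := C) i (C.proj i) X]
      refine Finset.sum_congr rfl fun x hx => ?_
      rw [mem_nodesAt] at hx
      rw [← hx, proj_op]
    have h2 : ∀ x ∈ C.nodesAt i, ∀ X : Op n d, hs x.op (C.run i M (C.proj (i + M + 1) X)) =
        ∑ y ∈ C.nodesAt (i + M + 1), if y.IsTriv then coef x y * hs y.op X else 0 := by
      intro x hx X
      rw [mem_nodesAt] at hx
      refine (apply_eq_sum_nodesAt (C := C) (i + M + 1) (hs x.op ∘ₗ C.run i M)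
        (C.proj (i + M + 1) X)).trans ?_
      refine Finset.sum_congr rfl fun y hy => ?_
      rw [mem_nodesAt] at hy
      rw [coef_eq_run (m := M) (by omega), ← hy, hs_proj, hx]
      split_ifs
      · rw [smul_eq_mul, mul_comm]; rfl
      · simp
    have h3 : ∀ y ∈ C.nodesAt (i + M + 1), hs y.op (C.superW (i + M + 1)
        (C.suffix u M ρ b (i + M + 2))) = C.rightValue u M ρ y 1 b := by
      intro y hy
      rw [mem_nodesAt] at hy
      rw [rightValue, reach, Finset.sum_range_one, hy, if_pos (by omega)]
      rfl
    rw [windowFirst, if_pos (by omega), h1, run]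
    have hr : ((ls.map fun z => coef z.1 z.2 •
        fun b => C.rightValue u M ρ z.2 1 b • z.1.op).sum : ℕ → Op n d) b =
        ∑ z ∈ C.nodesAt i ×ˢ C.nodesAt (i + M + 1), if z ∈ ls then
          coef z.1 z.2 • C.rightValue u M ρ z.2 1 b • z.1.op else 0 := by
      rw [← List.sum_toFinset _ hnd, Finset.sum_apply, ← Finset.sum_filter]
      refine Finset.sum_congr ?_ fun z _ => rfl
      ext z
      simp only [List.mem_toFinset, Finset.mem_filter, Finset.mem_product, mem_nodesAt]
      constructor
      · intro hz
        have := (hls z).1 hz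
        exact ⟨⟨this.1, this.2.1⟩, hz⟩
      · exact fun h => h.2
    rw [hr, Finset.sum_product]
    refine Finset.sum_congr rfl fun x hx => ?_
    rw [Module.End.mul_apply, Module.End.mul_apply, h2 x hx, Finset.sum_smul]
    refine Finset.sum_congr rfl fun y hy => ?_
    rw [h3 y hy]
    by_cases hz : (x, y) ∈ ls
    · have := (hls _).1 hz
      rw [if_pos hz, if_pos this.2.2.1, if_pos this.2.2.2.1, mul_smul]
    · rw [if_neg hz]
      by_cases hxt : x.IsTriv
      · by_cases hyt : y.IsTriv
        · have hc : coef x y = 0 := by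
            by_contra hc
            exact hz ((hls _).2 ⟨mem_nodesAt.1 hx, mem_nodesAt.1 hy, hxt, hyt, hc⟩)
          simp [hc]
        · simp [hyt]
      · simp [hxt]
  rw [hw, ← List.sum_toFinset _ hnd, ← List.sum_toFinset _ hnd, map_sum, Finset.sum_apply, map_sum]
  refine Finset.sum_congr rfl fun z hz => ?_
  have hz := ((hls z).1 (List.mem_toFinset.1 hz)).1
  rw [map_smul, Pi.smul_apply, map_smul, smul_eq_mul, leftValue, hz]

end Left

end NoisyCircuit

namespace NoisyCircuit

variable {n d : ℕ} {G : Type*} [Group G] [TopologicalSpace G] (C : NoisyCircuit n d G)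

/-! ## Segments of truncated paths -/

/-- An irrep of layer `i`, a multiplicity index, and the components to the left and to the right
of `Uᵢ`. -/
abbrev Transition (i : ℕ) :=
  (l : C.Irr i) × Fin ((C.basis i).mult l) × Fin ((C.basis i).dim l) × Fin ((C.basis i).dim l)

variable {C}

/-- The basis operator to the left of `Uᵢ`. -/
def leftNode {i : ℕ} (q : C.Transition i) : C.Node := ⟨i, q.1, q.2.1, q.2.2.1⟩

/-- The basis operator to the right of `Uᵢ`. -/
def rightNode {i : ℕ} (q : C.Transition i) : C.Node := ⟨i, q.1, q.2.1, q.2.2.2⟩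

/-- A path leads from `x` to `y` through the irreps in `A` and leaves `b` of the `L` non-trivial
layers. -/
def Joined (L : ℕ) (x y : C.Node) (b : ℕ) (A : Set (Sigma C.Irr)) : Prop :=
  open Classical in
  x.pos ≤ y.pos ∧ ∃ q : ∀ i, C.Transition i, leftNode (q x.pos) = x ∧ rightNode (q y.pos) = y ∧
    (∀ i, x.pos ≤ i → i < y.pos →
      hs (rightNode (q i)).op (C.superW i (leftNode (q (i + 1))).op) ≠ 0) ∧
    ((Finset.Icc x.pos y.pos).filter
      fun i => i < C.depth ∧ ¬ C.IsTriv i (q i).1).card + b ≤ L ∧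
    ∀ a ∈ A, x.pos ≤ a.1 ∧ a.1 ≤ y.pos ∧ (q a.1).1 = a.2

theorem Joined.mono {L : ℕ} {x y : C.Node} {b b' : ℕ} {A A' : Set (Sigma C.Irr)}
    (h : Joined L x y b A) (hb : b' ≤ b) (hA : A' ⊆ A) : Joined L x y b' A' := by
  obtain ⟨h0, q, h1, h2, h3, h4, h5⟩ := h
  exact ⟨h0, q, h1, h2, h3, by omega, fun a ha => h5 a (hA ha)⟩

theorem Joined.refl [NeZero d] (L : ℕ) {x : C.Node} (hx : x.IsTriv) :
    Joined L x x L {⟨x.pos, x.irr⟩} := by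
  classical
  -- Layers off the segment need some transition; the components of the identity show that every
  -- layer has one.
  have : ∀ i, Nonempty (C.Transition i) := fun i => by
    obtain ⟨z, rfl, -⟩ := exists_node_hs_one_ne_zero C i
    exact ⟨⟨z.irr, z.mul, z.comp, z.comp⟩⟩
  let q : ∀ i, C.Transition i := Function.update (fun i => (this i).some) x.pos
    ⟨x.irr, x.mul, x.comp, x.comp⟩
  have hq : q x.pos = ⟨x.irr, x.mul, x.comp, x.comp⟩ := Function.update_self ..
  refine ⟨le_rfl, q, by rw [hq]; rfl, by rw [hq]; rfl, fun i h1 h2 => absurd h2 (by omega), ?_,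
    by rintro a rfl; exact ⟨le_rfl, le_rfl, by rw [hq]⟩⟩
  rw [Finset.Icc_self, Finset.filter_singleton, if_neg, Finset.card_empty, zero_add]
  rintro ⟨-, h⟩
  rw [hq] at h
  exact h hx

/-- The layer of `c` is entered from the right at `c.comp`; the component `k` on its other side is
free, since a transition may change the component within a copy of the irrep. Only a non-trivial `c`
uses up budget. -/
theorem Joined.extendLeft {L : ℕ} {x y c : C.Node} {b b' : ℕ} {A : Set (Sigma C.Irr)}
    (h : Joined L x y b A) (hc : c.pos + 1 = x.pos) (hW : hs c.op (C.superW c.pos x.op) ≠ 0)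
    (k : Fin ((C.basis c.pos).dim c.irr)) (hb : b' ≤ b) (hb' : ¬ c.IsTriv → b' + 1 ≤ b) :
    Joined L (c.withComp k) y b' (insert ⟨c.pos, c.irr⟩ A) := by
  classical
  obtain ⟨h0, q, h1, h2, h3, h4, h5⟩ := h
  let q' : ∀ i, C.Transition i := Function.update q c.pos ⟨c.irr, c.mul, k, c.comp⟩
  have hq : q' c.pos = ⟨c.irr, c.mul, k, c.comp⟩ := Function.update_self ..
  have hq' : ∀ i, i ≠ c.pos → q' i = q i := fun i hi => Function.update_of_ne hi ..
  refine ⟨by change c.pos ≤ _; omega, q', ?_, ?_, ?_, ?_, ?_⟩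
  · change leftNode (q' c.pos) = _
    rw [hq]; rfl
  · rw [hq' _ (by omega), h2]
  · intro i hi1 hi2
    change c.pos ≤ i at hi1
    rw [hq' (i + 1) (by omega)]
    rcases hi1.eq_or_lt with rfl | hi
    · rw [hq, hc, h1]
      exact hW
    · rw [hq' i (by omega)]
      exact h3 i (by omega) hi2
  · change ((Finset.Icc c.pos y.pos).filter _).card + b' ≤ L
    -- The path changes at `c.pos` alone, so at most this layer joins the non-trivial ones.
    have hsub : (Finset.Icc c.pos y.pos).filter (fun i => i < C.depth ∧ ¬ C.IsTriv i (q' i).1) ⊆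
        insert c.pos ((Finset.Icc x.pos y.pos).filter
          fun i => i < C.depth ∧ ¬ C.IsTriv i (q i).1) := by
      intro i hi
      rw [Finset.mem_filter, Finset.mem_Icc] at hi
      rw [Finset.mem_insert, Finset.mem_filter, Finset.mem_Icc]
      by_cases hic : i = c.pos
      · exact Or.inl hic
      · rw [hq' i hic] at hi
        exact Or.inr ⟨by omega, hi.2⟩
    by_cases ht : c.IsTriv
    · have := Finset.card_le_card ((Finset.subset_insert_iff_of_notMem (by
        rw [Finset.mem_filter, hq]
        exact fun h => h.2.2 ht)).1 hsub)
      omega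
    · have := (Finset.card_le_card hsub).trans (Finset.card_insert_le _ _)
      have := hb' ht
      omega
  · intro a ha
    change c.pos ≤ _ ∧ _
    rcases ha with rfl | ha
    · exact ⟨le_rfl, by change c.pos ≤ _; omega, by change (q' c.pos).1 = _; rw [hq]⟩
    · obtain ⟨ha1, ha2, ha3⟩ := h5 a ha
      exact ⟨by omega, ha2, by rw [hq' _ (by omega), ha3]⟩

theorem Joined.extendRight {L : ℕ} {x y c : C.Node} {b b' : ℕ} {A : Set (Sigma C.Irr)}
    (h : Joined L x y b A) (hc : c.pos = y.pos + 1) (hW : hs y.op (C.superW y.pos c.op) ≠ 0)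
    (k : Fin ((C.basis c.pos).dim c.irr)) (hb : b' ≤ b)
    (hb' : c.pos < C.depth → ¬ c.IsTriv → b' + 1 ≤ b) :
    Joined L x (c.withComp k) b' (insert ⟨c.pos, c.irr⟩ A) := by
  classical
  obtain ⟨h0, q, h1, h2, h3, h4, h5⟩ := h
  let q' : ∀ i, C.Transition i := Function.update q c.pos ⟨c.irr, c.mul, c.comp, k⟩
  have hq : q' c.pos = ⟨c.irr, c.mul, c.comp, k⟩ := Function.update_self ..
  have hq' : ∀ i, i ≠ c.pos → q' i = q i := fun i hi => Function.update_of_ne hi ..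
  refine ⟨by change _ ≤ c.pos; omega, q', ?_, ?_, ?_, ?_, ?_⟩
  · rw [hq' _ (by omega), h1]
  · change rightNode (q' c.pos) = _
    rw [hq]; rfl
  · intro i hi1 hi2
    change i < c.pos at hi2
    rw [hq' i (by omega)]
    rcases (Nat.le_of_lt_succ (hc ▸ hi2)).eq_or_lt with rfl | hi
    · rw [← hc, hq, h2]
      exact hW
    · rw [hq' (i + 1) (by omega)]
      exact h3 i hi1 hi
  · change ((Finset.Icc x.pos c.pos).filter _).card + b' ≤ L
    have hsub : (Finset.Icc x.pos c.pos).filter (fun i => i < C.depth ∧ ¬ C.IsTriv i (q' i).1) ⊆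
        insert c.pos ((Finset.Icc x.pos y.pos).filter
          fun i => i < C.depth ∧ ¬ C.IsTriv i (q i).1) := by
      intro i hi
      rw [Finset.mem_filter, Finset.mem_Icc] at hi
      rw [Finset.mem_insert, Finset.mem_filter, Finset.mem_Icc]
      by_cases hic : i = c.pos
      · exact Or.inl hic
      · rw [hq' i hic] at hi
        exact Or.inr ⟨by omega, hi.2⟩
    by_cases ht : c.pos < C.depth ∧ ¬ c.IsTriv
    · have := (Finset.card_le_card hsub).trans (Finset.card_insert_le _ _)
      have := hb' ht.1 ht.2
      omega
    · have := Finset.card_le_card ((Finset.subset_insert_iff_of_notMem (by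
        rw [Finset.mem_filter, hq]
        exact fun h => ht h.2)).1 hsub)
      omega
  · intro a ha
    change _ ∧ _ ≤ c.pos ∧ _
    rcases ha with rfl | ha
    · exact ⟨by change _ ≤ c.pos; omega, le_rfl, by change (q' c.pos).1 = _; rw [hq]⟩
    · obtain ⟨ha1, ha2, ha3⟩ := h5 a ha
      exact ⟨ha1, by omega, by rw [hq' _ (by omega), ha3]⟩

/-- A non-zero contraction conceals a chain of trivial nodes with non-zero transfer coefficients.
They are recovered one at a time, starting next to the segment, and cost no budget. -/
theorem Joined.runLeft {L : ℕ} {x y c : C.Node} {b b' : ℕ} {A : Set (Sigma C.Irr)}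
    (h : Joined L x y b A) (hc : coef c x ≠ 0)
    (k : Fin ((C.basis c.pos).dim c.irr)) (hb : b' ≤ b) (hb' : ¬ c.IsTriv → b' + 1 ≤ b) :
    Joined L (c.withComp k) y b' (insert ⟨c.pos, c.irr⟩ A) := by
  obtain ⟨m, hm⟩ := Nat.exists_eq_add_of_lt (lt_of_coef_ne_zero hc)
  induction m generalizing x with
  | zero =>
    rw [coef_eq_run (m := 0) hm] at hc
    exact h.extendLeft (by omega) hc k hb hb'
  | succ m ih =>
    obtain ⟨z, hz, hzp, h1, h2⟩ := exists_last_of_coef_ne_zero hm hc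
    exact ih ((h.extendLeft (b' := b) (by omega) h2 z.comp le_rfl
      (fun h => absurd hz h)).mono le_rfl (Set.subset_insert _ _)) h1 hzp

theorem Joined.runRight {L : ℕ} {x y c : C.Node} {b b' : ℕ} {A : Set (Sigma C.Irr)}
    (h : Joined L x y b A) (hc : coef y c ≠ 0)
    (k : Fin ((C.basis c.pos).dim c.irr)) (hb : b' ≤ b)
    (hb' : c.pos < C.depth → ¬ c.IsTriv → b' + 1 ≤ b) :
    Joined L x (c.withComp k) b' (insert ⟨c.pos, c.irr⟩ A) := by
  obtain ⟨m, hm⟩ := Nat.exists_eq_add_of_lt (lt_of_coef_ne_zero hc)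
  induction m generalizing y with
  | zero =>
    rw [coef_eq_run (m := 0) hm] at hc
    exact h.extendRight (by omega) hc k hb hb'
  | succ m ih =>
    obtain ⟨z, hz, hzp, h1, h2⟩ := exists_first_of_coef_ne_zero hm hc
    exact ih ((h.extendRight (b' := b) hzp h2 z.comp le_rfl
      (fun _ h => absurd hz h)).mono le_rfl (Set.subset_insert _ _)) h1
      (show c.pos = z.pos + m + 1 by omega)

/-- A segment from end to end is a valid truncated path. -/
theorem Joined.allowed {L : ℕ} {x y : C.Node} {b : ℕ} {A : Set (Sigma C.Irr)}
    (h : Joined L x y b A) (hx : x.pos = 0) (hy : y.pos = C.depth) {i : ℕ} {l : C.Irr i}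
    (ha : ⟨i, l⟩ ∈ A) : C.Allowed L i l := by
  classical
  obtain ⟨h0, q, h1, h2, h3, h4, h5⟩ := h
  refine ⟨⟨fun i => (q i).1, fun i => (q i).2.1, fun i => (q i).2.2.1, fun i => (q i).2.2.2⟩,
    fun i hi => h3 i (by omega) (by omega), ?_, (h5 _ ha).2.2⟩
  refine le_trans (b := (((Finset.Icc x.pos y.pos).filter
      fun i => i < C.depth ∧ ¬ C.IsTriv i (q i).1).card : ℕ∞)) ?_ (by exact_mod_cast by omega)
  rw [← Set.encard_coe_eq_coe_finsetCard]
  refine Set.encard_le_encard fun i hi => ?_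
  rw [Finset.mem_coe, Finset.mem_filter, Finset.mem_Icc]
  exact ⟨⟨by omega, by rw [hy]; exact hi.1.le⟩, hi⟩

/-! ## Vanishing of contributions without a valid truncated path -/

theorem finite_rightChildren (x : C.Node) : (rightChildren x).Finite := by
  classical
  refine ((Finset.range (C.depth + 1)).biUnion C.nodesAt).finite_toSet.subset fun z hz => ?_
  rw [Finset.mem_coe, Finset.mem_biUnion]
  exact ⟨z.pos, Finset.mem_range.2 (Nat.lt_succ_of_le hz.2.1), mem_nodesAt.2 rfl⟩

theorem finite_leftChildren (x : C.Node) : (leftChildren x).Finite := by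
  classical
  refine ((Finset.range x.pos).biUnion C.nodesAt).finite_toSet.subset fun z hz => ?_
  rw [Finset.mem_coe, Finset.mem_biUnion]
  exact ⟨z.pos, Finset.mem_range.2 hz.1, mem_nodesAt.2 rfl⟩

section Vanishing

variable (u : ℕ → G) (M : ℕ) (ρ : Op n d)

/-- A non-zero sum has a non-zero summand. Following it from child to child, by induction on the
budget, completes the segment to the end of the circuit without losing the irreps recorded in `A`.
-/
theorem Joined.exists_of_rightValue_ne_zero {L : ℕ} {x y : C.Node} {b gap : ℕ}
    {A : Set (Sigma C.Irr)} (h : Joined L x y b A) (h0 : C.rightValue u M ρ y gap b ≠ 0) :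
    ∃ (y' : C.Node) (b' : ℕ), y'.pos = C.depth ∧ Joined L x y' b' A := by
  classical
  induction b generalizing y gap A with
  | zero =>
    rw [rightValue_eq_sum u M ρ y gap 0 (ls := ((finite_rightChildren y).toFinset.filter
      fun z => y.pos + 1 ≤ z.pos ∧ z.pos < y.pos + 1 + gap).toList) (Finset.nodup_toList _)
      (by simp)] at h0
    obtain ⟨_, hzm, hz0⟩ := List.exists_mem_ne_zero_of_sum_ne_zero h0
    obtain ⟨z, hz, rfl⟩ := List.mem_map.1 hzm
    have hzD : z.pos = C.depth := by
      by_contra hD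
      exact hz0 (by rw [C.suffix_zero u M ρ hD, map_zero, mul_zero])
    exact ⟨_, 0, hzD, (h.runRight (left_ne_zero_of_mul hz0) z.comp le_rfl
      (fun h => absurd h (by omega))).mono le_rfl (Set.subset_insert _ _)⟩
  | succ b ih =>
    rw [rightValue_eq_sum u M ρ y gap _ (ls := ((finite_rightChildren y).toFinset.filter
      fun z => y.pos + 1 ≤ z.pos ∧ z.pos < y.pos + 1 + gap).toList) (Finset.nodup_toList _)
      (by simp)] at h0
    obtain ⟨_, hzm, hz0⟩ := List.exists_mem_ne_zero_of_sum_ne_zero h0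
    obtain ⟨z, hz, rfl⟩ := List.mem_map.1 hzm
    by_cases hzD : z.pos = C.depth
    · exact ⟨_, 0, hzD, (h.runRight (b' := 0) (left_ne_zero_of_mul hz0) z.comp (Nat.zero_le _)
        (fun h => absurd h (by omega))).mono le_rfl (Set.subset_insert _ _)⟩
    · have hz1 := right_ne_zero_of_mul hz0
      have hzt : ¬ z.IsTriv := fun ht => hz1 (by
        rw [C.suffix_succ u M ρ b hzD, hs_nontrivLayer_of_isTriv z _ ht])
      rw [hs_suffix_succ u M ρ hzt hzD] at hz1
      obtain ⟨k, -, hk⟩ := Finset.exists_ne_zero_of_sum_ne_zero hz1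
      exact ih ((h.runRight (b' := b) (left_ne_zero_of_mul hz0) k (by omega)
        (fun _ _ => le_rfl)).mono le_rfl (Set.subset_insert _ _)) (right_ne_zero_of_mul hk)

theorem Joined.exists_of_leftValue_ne_zero (mu : Op n d →ₗ[ℂ] ℂ) (f : ℕ → ℂ) {L : ℕ}
    {x y : C.Node} {b : ℕ} {A : Set (Sigma C.Irr)} (h : Joined L x y b A)
    (h0 : C.leftValue u mu f x b ≠ 0) :
    ∃ (x' : C.Node) (b' : ℕ), x'.pos = 0 ∧ f b' ≠ 0 ∧ Joined L x' y b' A := by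
  classical
  induction b generalizing x A with
  | zero =>
    rcases Nat.eq_zero_or_pos x.pos with hx | hx
    · rw [leftValue_of_pos_eq_zero u mu f hx] at h0
      exact ⟨x, 0, hx, left_ne_zero_of_mul h0, h⟩
    · rw [leftValue_eq_sum u mu f hx _ (ls := (finite_leftChildren x).toFinset.toList)
        (Finset.nodup_toList _) (by simp)] at h0
      obtain ⟨_, hzm, hz0⟩ := List.exists_mem_ne_zero_of_sum_ne_zero h0
      obtain ⟨z, hz, rfl⟩ := List.mem_map.1 hzm
      have hzc : z ∈ leftChildren x := by simpa using hz
      have hz1 := right_ne_zero_of_mul hz0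
      by_cases ht : z.IsTriv
      · have hzp : z.pos = 0 := hzc.2.2.resolve_right (fun h => h ht)
        rw [leftChildValue, if_pos ht, leftValue_of_pos_eq_zero u mu f hzp] at hz1
        exact ⟨_, 0, hzp, left_ne_zero_of_mul hz1, (h.runLeft hzc.2.1 z.comp le_rfl
          (fun h => absurd ht h)).mono le_rfl (Set.subset_insert _ _)⟩
      · rw [leftChildValue, if_neg ht] at hz1
        exact absurd rfl hz1
  | succ b ih =>
    rcases Nat.eq_zero_or_pos x.pos with hx | hx
    · rw [leftValue_of_pos_eq_zero u mu f hx] at h0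
      exact ⟨x, _, hx, left_ne_zero_of_mul h0, h⟩
    · rw [leftValue_eq_sum u mu f hx _ (ls := (finite_leftChildren x).toFinset.toList)
        (Finset.nodup_toList _) (by simp)] at h0
      obtain ⟨_, hzm, hz0⟩ := List.exists_mem_ne_zero_of_sum_ne_zero h0
      obtain ⟨z, hz, rfl⟩ := List.mem_map.1 hzm
      have hzc : z ∈ leftChildren x := by simpa using hz
      have hz1 := right_ne_zero_of_mul hz0
      by_cases ht : z.IsTriv
      · have hzp : z.pos = 0 := hzc.2.2.resolve_right (fun h => h ht)
        rw [leftChildValue, if_pos ht, leftValue_of_pos_eq_zero u mu f hzp] at hz1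
        exact ⟨_, _, hzp, left_ne_zero_of_mul hz1, (h.runLeft hzc.2.1 z.comp le_rfl
          (fun h => absurd ht h)).mono le_rfl (Set.subset_insert _ _)⟩
      · rw [leftChildValue, if_neg ht] at hz1
        obtain ⟨k, -, hk⟩ := Finset.exists_ne_zero_of_sum_ne_zero hz1
        exact ih ((h.runLeft (b' := b) hzc.2.1 k (by omega)
          (fun _ => le_rfl)).mono le_rfl (Set.subset_insert _ _)) (right_ne_zero_of_mul hk)

theorem Joined.allowed_of_rightValue_ne_zero {L : ℕ} {x y : C.Node} {b gap : ℕ}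
    {A : Set (Sigma C.Irr)} (h : Joined L x y b A) (hx : x.pos = 0)
    (h0 : C.rightValue u M ρ y gap b ≠ 0) {i : ℕ} {l : C.Irr i} (ha : ⟨i, l⟩ ∈ A) :
    C.Allowed L i l := by
  obtain ⟨y', b', hy', h'⟩ := h.exists_of_rightValue_ne_zero u M ρ h0
  exact h'.allowed hx hy' ha

/-- The weight at the left end is the value to the right of the window, so a non-zero summand
supplies a completion on both sides. -/
theorem Joined.allowed_of_leftValue_ne_zero (mu : Op n d →ₗ[ℂ] ℂ) {L : ℕ} {x y : C.Node}
    {b gap : ℕ} {A : Set (Sigma C.Irr)} (h : Joined L x y b A)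
    (h0 : C.leftValue u mu (fun b => C.rightValue u M ρ y gap b) x b ≠ 0) {i : ℕ} {l : C.Irr i}
    (ha : ⟨i, l⟩ ∈ A) : C.Allowed L i l := by
  obtain ⟨x', b', hx', hf, h'⟩ := h.exists_of_leftValue_ne_zero u mu _ h0
  exact h'.allowed_of_rightValue_ne_zero u M ρ hx' hf ha

end Vanishing

/-! ## Lower bounds for the parameters -/

theorem one_le_of_assumption3 [NeZero d] {M r : ℕ} (h : C.Assumption3 M r)
    (hM : M + 2 ≤ C.depth) : 1 ≤ r := by
  obtain ⟨x, hx, hx1⟩ := exists_node_hs_one_ne_zero C 0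
  obtain ⟨y, hy, hy1, hxy⟩ := exists_coef_ne_zero hx1 M
  have hmem : (x, y) ∈ C.fullTerms 0 M :=
    ⟨hx, by change y.pos = _; omega, isTriv_of_hs_one_ne_zero hx1, isTriv_of_hs_one_ne_zero hy1, hxy⟩
  have := (Set.one_le_encard_iff_nonempty.2 ⟨_, hmem⟩).trans (h 0 (by omega))
  exact_mod_cast this

theorem exists_coef_end_ne_zero [NeZero d] (C : NoisyCircuit n d G) (hD : 0 < C.depth) :
    ∃ x y : C.Node, x.pos = 0 ∧ y.pos = C.depth ∧ x.IsTriv ∧ coef x y ≠ 0 := by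
  obtain ⟨x, hx, hx1⟩ := exists_node_hs_one_ne_zero C 0
  obtain ⟨y, hy, hy1, hxy⟩ := exists_coef_ne_zero hx1 (C.depth - 1)
  exact ⟨x, y, hx, by omega, isTriv_of_hs_one_ne_zero hx1, hxy⟩

theorem one_le_of_assumption1 [NeZero d] {s : ℕ} (h : C.Assumption1 s) (hD : 0 < C.depth) :
    1 ≤ s := by
  obtain ⟨x, y, hx, hy, -, hxy⟩ := exists_coef_end_ne_zero C hD
  have hmem : y ∈ rightChildren x := ⟨lt_of_coef_ne_zero hxy, hy.le, hxy, Or.inl hy⟩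
  have := (Set.one_le_encard_iff_nonempty.2 ⟨_, hmem⟩).trans (h.right x (by omega))
  exact_mod_cast this

theorem one_le_of_assumption0 [NeZero d] {L dmax : ℕ} (h : C.Assumption0 L dmax)
    (hD : 0 < C.depth) : 1 ≤ dmax := by
  obtain ⟨x, y, hx, hy, hxt, hxy⟩ := exists_coef_end_ne_zero C hD
  have h2 := (Joined.refl L hxt).runRight hxy y.comp le_rfl (fun h => absurd h (by omega))
  have h3 := h2.allowed hx hy (Set.mem_insert_of_mem _ rfl)
  exact ((C.basis x.pos).irreducible x.irr).1.trans_le (h _ (by omega) _ h3)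

end NoisyCircuit

namespace NoisyCircuit

variable {n d : ℕ} {G : Type*} [Group G] [TopologicalSpace G] {C : NoisyCircuit n d G}

/-! ## Loops of the search -/

section Loops

variable {O : Oracle} {D L M dmax : ℕ}

theorem eval_list {dir gap b : ℕ} {acc : ℂ} {pend y : Val} (l : List C.Node) (w V : C.Node → ℂ)
    {τ : ℕ} (h : ∀ z ∈ l, EvalWithin searchProgram O
      [.pair z.enc (stateVal dir gap b (acc * w z) pend y (paramsVal D L M dmax))] childBody
      (.num (V z)) τ) :
    EvalWithin searchProgram O [.pair (Val.ofList (l.map fun z => .pair z.enc (.num (w z))))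
      (stateVal dir gap b acc pend y (paramsVal D L M dmax))] listBody
      (.num (l.map V).sum) (l.length * (τ + 200) + 100) := by
  induction l with
  | nil => exact eval_list_nil.mono (by omega)
  | cons z l ih =>
    rw [List.map_cons, List.map_cons, List.sum_cons]
    refine (eval_list_cons (h z (List.mem_cons_self ..))
      (ih fun z hz => h z (List.mem_cons_of_mem _ hz))).mono ?_
    rw [List.length_cons, add_mul, one_mul]
    omega

/-- The order within a position is up to the subroutine, so the list of visited nodes can only be
asserted to exist; value and time are expressed through it. -/
theorem eval_positions {dir gap b cCon τ : ℕ} {acc : ℂ} {pend y x : Val} (S : Set C.Node)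
    (w V : C.Node → ℂ) (j cnt : ℕ)
    (hO : ∀ j', j ≤ j' → j' < j + cnt → j' ≤ D →
      O.Answers (.pair (.nat dir) (.pair (.nat j') x)) cCon fun a => ∃ l : List C.Node,
        l.Nodup ∧ (∀ z, z ∈ l ↔ z ∈ S ∧ z.pos = j') ∧
        a = Val.ofList (l.map fun z => .pair z.enc (.num (w z))))
    (h : ∀ z ∈ S, j ≤ z.pos → z.pos < j + cnt → z.pos ≤ D → EvalWithin searchProgram O
      [.pair z.enc (stateVal dir gap b (acc * w z) pend y (paramsVal D L M dmax))] childBody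
      (.num (V z)) τ) :
    ∃ ls : List C.Node, ls.Nodup ∧
      (∀ z, z ∈ ls ↔ z ∈ S ∧ j ≤ z.pos ∧ z.pos < j + cnt ∧ z.pos ≤ D) ∧
      EvalWithin searchProgram O [.pair (.nat j) (.pair (.nat cnt) (.pair x
        (stateVal dir gap b acc pend y (paramsVal D L M dmax))))] positionBody
        (.num (ls.map V).sum) (cnt * (cCon + 300) + ls.length * (τ + 200) + 100) := by
  induction cnt generalizing j with
  | zero =>
    refine ⟨[], List.nodup_nil, fun z => ?_, (eval_position_stop (Or.inl rfl)).mono (by omega)⟩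
    simp only [List.not_mem_nil, false_iff]
    omega
  | succ cnt ih =>
    by_cases hj : j ≤ D
    · obtain ⟨l₂, hl₂, hl₂', h₂⟩ := ih (j + 1)
        (fun j' h1 h2 => hO j' (by omega) (by omega))
        (fun z hz h1 h2 => h z hz (by omega) (by omega))
      obtain ⟨a, t, ha, ht, l₁, hl₁, hl₁', rfl⟩ := hO j le_rfl (by omega) hj
      have h₁ := eval_list l₁ w V (O := O) (dir := dir) (gap := gap) (b := b) (acc := acc)
        (pend := pend) (y := y) (D := D) (L := L) (M := M) (dmax := dmax) (τ := τ) fun z hz => by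
          obtain ⟨hzS, hzj⟩ := (hl₁' z).1 hz
          exact h z hzS (by omega) (by omega) (by omega)
      refine ⟨l₁ ++ l₂, ?_, ?_, ?_⟩
      · refine List.Nodup.append hl₁ hl₂ fun z hz1 hz2 => ?_
        have h1 := ((hl₁' z).1 hz1).2
        have h2 := ((hl₂' z).1 hz2).2.1
        omega
      · intro z
        rw [List.mem_append, hl₁', hl₂']
        constructor
        · rintro (⟨h1, h2⟩ | ⟨h1, h2⟩)
          · exact ⟨h1, by omega⟩
          · exact ⟨h1, by omega⟩
        · rintro ⟨h1, h2⟩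
          by_cases hzj : z.pos = j
          · exact Or.inl ⟨h1, hzj⟩
          · exact Or.inr ⟨h1, by omega⟩
      · rw [List.map_append, List.sum_append, List.length_append]
        refine (eval_position_step hj ⟨_, t, ha, ht, rfl⟩ h₁ h₂).mono ?_
        rw [add_mul, add_mul]
        omega
    · refine ⟨[], List.nodup_nil, fun z => ?_,
        (eval_position_stop (Or.inr (by omega))).mono (by omega)⟩
      simp only [List.not_mem_nil, false_iff]
      omega

theorem eval_components {dir gap b τ : ℕ} {acc : ℂ} {pend y : Val} (z : C.Node)
    (V : Fin ((C.basis z.pos).dim z.irr) → ℂ)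
    (h : ∀ k, EvalWithin searchProgram O [.pair (z.withComp k).enc
      (stateVal dir (M + 2) b acc
        (.pair (if 3 < dir then Val.ofNats [z.pos, z.irr, k, z.comp]
          else Val.ofNats [z.pos, z.irr, z.comp, k]) pend) y (paramsVal D L M dmax))]
      nodeBody (.num (V k)) τ) :
    EvalWithin searchProgram O [.pair (.nat ((C.basis z.pos).dim z.irr)) (.pair z.enc
      (stateVal dir gap (b + 1) acc pend y (paramsVal D L M dmax)))] componentBody
      (.num (∑ k, V k)) ((C.basis z.pos).dim z.irr * (τ + 400) + 100) := by
  -- The program counts down from the dimension, so the induction runs over initial segments of the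
  -- components.
  have key : ∀ (K : ℕ) (hK : K ≤ (C.basis z.pos).dim z.irr),
      EvalWithin searchProgram O [.pair (.nat K) (.pair z.enc
        (stateVal dir gap (b + 1) acc pend y (paramsVal D L M dmax)))] componentBody
        (.num (∑ k : Fin K, V (Fin.castLE hK k))) (K * (τ + 400) + 100) := by
    intro K
    induction K with
    | zero =>
      intro _
      rw [Fin.sum_univ_zero]
      exact eval_component_zero.mono (by omega)
    | succ K ih =>
      intro hK
      rw [Fin.sum_univ_castSucc, add_comm (∑ i : Fin K, _)]
      refine (eval_component_succ (h ⟨K, hK⟩) (ih (by omega))).mono ?_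
      rw [add_mul]
      omega
  exact key _ le_rfl

end Loops

/-! ## Running times -/

/-- A bound for the running time of a search with `b` non-trivial layers left. -/
def searchTime (β X : ℕ) : ℕ → ℕ
  | 0 => β
  | b + 1 => β + X * (searchTime β X b + 400)

/-- The contribution of a single node to the running time, where `Λ` is the time that is needed at
the end of the search. -/
def baseTime (D s cCon cMat Λ : ℕ) : ℕ := Λ + 300 + D * (cCon + 300) + s * (Λ + cMat + 600)

/-- The running time of a child. -/
def childTime (β X dmax cMat Λ : ℕ) : ℕ → ℕ
  | 0 => Λ + cMat + 400
  | b + 1 => Λ + cMat + 400 + dmax * (searchTime β X b + 400)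

theorem le_searchTime (β X b : ℕ) : β ≤ searchTime β X b := by
  cases b
  · exact le_rfl
  · exact Nat.le_add_right _ _

theorem searchTime_mono (β X : ℕ) : Monotone (searchTime β X) := by
  refine monotone_nat_of_le_succ fun b => ?_
  induction b with
  | zero => exact le_searchTime β X 1
  | succ b ih => exact Nat.add_le_add_left (Nat.mul_le_mul_left _ (by omega)) _

/-- Solves the recursion: there are `b + 1` levels, and none costs more than `(β + 400) * X ^ b`. -/
theorem searchTime_le {β X : ℕ} (hX : 1 ≤ X) (b : ℕ) :
    searchTime β X b ≤ (b + 1) * (β + 400) * X ^ b := by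
  induction b with
  | zero => rw [searchTime, pow_zero, mul_one, zero_add, one_mul]; omega
  | succ b ih =>
    have h1 : 1 ≤ X ^ b := Nat.one_le_pow _ _ hX
    calc searchTime β X (b + 1) ≤ β + X * ((b + 1) * (β + 400) * X ^ b + 400) :=
          Nat.add_le_add_left (Nat.mul_le_mul_left _ (by omega)) _
      _ = (b + 1) * (β + 400) * X ^ (b + 1) + (β * 1 + 400 * X * 1) := by ring
      _ ≤ (b + 1) * (β + 400) * X ^ (b + 1) + (β * (X * X ^ b) + 400 * X * X ^ b) := by
          gcongr
          exact Nat.mul_pos hX h1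
      _ = (b + 1 + 1) * (β + 400) * X ^ (b + 1) := by ring

/-- At most `s` children with at most `dmax` components each give the branching factor `s * dmax`;
all other work at a node is covered by `baseTime`. -/
theorem node_time {D s cCon cMat Λ dmax N l : ℕ} (hN : N ≤ D) (hl : l ≤ s) (b : ℕ) :
    N * (cCon + 300) + l * (childTime (baseTime D s cCon cMat Λ) (s * dmax) dmax cMat Λ b + 200) +
      100 + 200 ≤ searchTime (baseTime D s cCon cMat Λ) (s * dmax) b := by
  have h1 := Nat.mul_le_mul_right (cCon + 300) hN
  cases b with
  | zero =>
    have h2 : l * (Λ + cMat + 400 + 200) ≤ s * (Λ + cMat + 600) := Nat.mul_le_mul hl (by omega)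
    simp only [childTime, searchTime, baseTime]
    linarith
  | succ b =>
    rw [childTime, searchTime]
    generalize searchTime (baseTime D s cCon cMat Λ) (s * dmax) b = T
    have h2 : l * (Λ + cMat + 400 + dmax * (T + 400) + 200) ≤
        s * (Λ + cMat + 600 + dmax * (T + 400)) := Nat.mul_le_mul hl (by omega)
    simp only [baseTime]
    linarith

theorem length_le_of_encard_le {α : Type*} {S : Set α} {s : ℕ} (hS : S.encard ≤ s) {l : List α}
    (hl : l.Nodup) (h : ∀ z ∈ l, z ∈ S) : l.length ≤ s := by
  classical
  have h1 : ((l.toFinset : Finset α) : Set α).encard ≤ s :=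
    (Set.encard_le_encard fun z hz => h z (by simpa using hz)).trans hS
  rw [Set.encard_coe_eq_coe_finsetCard, List.toFinset_card_of_nodup hl] at h1
  exact_mod_cast h1

/-! ## Pending matrix coefficients -/

variable (C) in
/-- A matrix coefficient: layer, irrep, row and column. -/
abbrev Pending := (i : ℕ) × (l : C.Irr i) × Fin ((C.basis i).dim l) × Fin ((C.basis i).dim l)

/-- The encoding of a matrix coefficient. -/
def Pending.enc (p : C.Pending) : Val := Val.ofNats [p.1, p.2.1, p.2.2.1, p.2.2.2]

/-- The encoding of a list of matrix coefficients. -/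
def pendingVal (pend : List C.Pending) : Val := Val.ofList (pend.map Pending.enc)

/-- The product of the matrix coefficients with the noise eigenvalues. -/
def pendingWeight (u : ℕ → G) (pend : List C.Pending) : ℂ :=
  (pend.map fun p => (C.basis p.1).coeff p.2.1 (u p.1) p.2.2.1 p.2.2.2 * C.e p.1 p.2.1 p.2.2.1).prod

/-- The irreps of a list of matrix coefficients. -/
def pendingIrr (pend : List C.Pending) : Set (Sigma C.Irr) := {a | ∃ p ∈ pend, ⟨p.1, p.2.1⟩ = a}

theorem pendingIrr_cons (p : C.Pending) (pend : List C.Pending) :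
    pendingIrr (p :: pend) = insert ⟨p.1, p.2.1⟩ (pendingIrr pend) := by
  ext a
  simp [pendingIrr, eq_comm]

variable (C) in
/-- The group elements of the layers, continued arbitrarily. -/
def extend (g : Fin C.depth → G) (i : ℕ) : G := if h : i < C.depth then g ⟨i, h⟩ else 1

variable [NeZero d]

variable (n d) in
/-- The sum over the outcomes that agree with `y`. -/
def diagSum (y : Fin n → Option (Fin d)) : Op n d →ₗ[ℂ] ℂ :=
  open Classical in
  ∑ z : Outcome n d with Agrees y z, Matrix.entryLinearMap ℂ ℂ z z

omit [NeZero d] in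
open Classical in
theorem diagSum_apply (y : Fin n → Option (Fin d)) (X : Op n d) :
    diagSum n d y X = ∑ z : Outcome n d with Agrees y z, X z z := by
  rw [diagSum, LinearMap.sum_apply]
  rfl

theorem hs_inputState (A : Op n d) : hs A (inputState n d) = star (A 0 0) := by
  rw [hs_apply, inputState, Matrix.trace_mul_single]
  simp

section Search

variable {L M dmax s cMat cCon cFull cEval : ℕ} {g : Fin C.depth → G}
  {y : Fin n → Option (Fin d)} {O : Oracle}

theorem eval_pending (hS : C.Subroutines L M g y cMat cCon cFull cEval O) (pend : List C.Pending)
    (h : ∀ p ∈ pend, p.1 < C.depth ∧ C.Allowed L p.1 p.2.1) :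
    EvalWithin searchProgram O [pendingVal pend] pendingBody
      (.num (pendingWeight (C.extend g) pend)) (pend.length * (2 * cMat + 200) + 100) := by
  induction pend with
  | nil => exact eval_pending_nil.mono (by omega)
  | cons p pend ih =>
    obtain ⟨hp, ha⟩ := h p (List.mem_cons_self ..)
    rw [pendingWeight, List.map_cons, List.prod_cons]
    have hu : C.extend g p.1 = g ⟨p.1, hp⟩ := dif_pos hp
    refine (eval_pending_cons (hu ▸ hS.matrixCoeff ⟨p.1, hp⟩ p.2.1 ha p.2.2.1 p.2.2.2)
      (hS.noiseCoeff p.1 hp p.2.1 ha p.2.2.1)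
      (ih fun p hp => h p (List.mem_cons_of_mem _ hp))).mono ?_
    rw [List.length_cons, add_mul]
    omega

theorem label_of_isTriv (hS : C.Subroutines L M g y cMat cCon cFull cEval O) {z : C.Node}
    (hz : z.pos < C.depth) (ht : z.IsTriv) : O.Answers (Val.ofNats [0, z.pos, z.irr]) cMat
      (· = Val.ofNats [(C.basis z.pos).dim z.irr, 1]) := by
  have h := hS.label z.pos hz z.irr
  rwa [if_pos (show C.IsTriv z.pos z.irr from ht)] at h

theorem label_of_not_isTriv (hS : C.Subroutines L M g y cMat cCon cFull cEval O) {z : C.Node}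
    (hz : z.pos < C.depth) (ht : ¬ z.IsTriv) : O.Answers (Val.ofNats [0, z.pos, z.irr]) cMat
      (· = Val.ofNats [(C.basis z.pos).dim z.irr, 0]) := by
  have h := hS.label z.pos hz z.irr
  rwa [if_neg (show ¬ C.IsTriv z.pos z.irr from ht)] at h

/-- The time for the evaluation of a complete path. -/
def leafTime (L cMat cEval : ℕ) : ℕ := L * (2 * cMat + 200) + 100 + cEval + 200

theorem eval_right_end (hS : C.Subroutines L M g y cMat cCon cFull cEval O) {x z : C.Node}
    {b gap : ℕ} {acc : ℂ} {pend : List C.Pending} {yv : Val} (hz : z.pos = C.depth)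
    (hx : x.pos = 0) (hj : Joined L x z b (pendingIrr pend)) (hp : ∀ p ∈ pend, p.1 < C.depth)
    (hl : pend.length ≤ L) :
    EvalWithin searchProgram O [.pair z.enc (stateVal 3 gap b acc (pendingVal pend) yv
      (paramsVal C.depth L M dmax))] nodeBody
      (.num (acc * hs z.op (inputState n d) * pendingWeight (C.extend g) pend))
      (leafTime L cMat cEval) := by
  have h1 := eval_pending hS pend fun p hpp =>
    ⟨hp p hpp, hj.allowed hx hz ⟨p, hpp, rfl⟩⟩
  have h2 := hS.overlap z hz
  rw [hs_inputState]
  have henc : z.enc = Val.ofNats [C.depth, z.irr, z.mul, z.comp] := by rw [← hz]; rfl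
  rw [henc] at h2 ⊢
  refine (eval_node_right_end h2 h1).mono ?_
  have := Nat.mul_le_mul_right (2 * cMat + 200) hl
  unfold leafTime
  omega

/-- The invariant: the segment from the left end to `z` runs through the irreps of `pend`, and
`pend.length + b ≤ L` bounds the final product. The value factors into what is accumulated, what
lies ahead and what is pending, so that a non-trivial layer moves its coefficient and eigenvalue
from the second factor to the third. -/
theorem eval_right (h0 : C.Assumption0 L dmax) (h1 : C.Assumption1 s)
    (hS : C.Subroutines L M g y cMat cCon cFull cEval O) (hM : M + 2 ≤ C.depth) {x : C.Node}
    (hx : x.pos = 0) {yv : Val} (b : ℕ) {z : C.Node} {gap : ℕ} {acc : ℂ} {pend : List C.Pending}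
    (hz : z.pos ≤ C.depth) (hgap : gap ≤ M + 2) (hj : Joined L x z b (pendingIrr pend))
    (hp : ∀ p ∈ pend, p.1 < C.depth) (hl : pend.length + b ≤ L) :
    open Classical in
    EvalWithin searchProgram O [.pair z.enc (stateVal 3 gap b acc (pendingVal pend) yv
      (paramsVal C.depth L M dmax))] nodeBody
      (.num (acc * (if z.pos = C.depth then hs z.op (inputState n d) else
        C.rightValue (C.extend g) M (inputState n d) z gap b) *
          pendingWeight (C.extend g) pend))
      (searchTime (baseTime C.depth s cCon cMat (leafTime L cMat cEval)) (s * dmax) b) := by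
  classical
  set u := C.extend g
  set Λ := leafTime L cMat cEval
  induction b using Nat.strong_induction_on generalizing z gap acc pend with
  | _ b ih =>
  by_cases hzD : z.pos = C.depth
  · rw [if_pos hzD]
    refine (eval_right_end hS hzD hx hj hp (by omega)).mono (le_trans ?_ (le_searchTime _ _ _))
    simp only [baseTime]
    omega
  rw [if_neg hzD]
  have hchild : ∀ c ∈ rightChildren z, z.pos + 1 ≤ c.pos → c.pos < z.pos + 1 + gap →
      c.pos ≤ C.depth → EvalWithin searchProgram O [.pair c.enc (stateVal 3 gap b (acc * coef z c)
        (pendingVal pend) yv (paramsVal C.depth L M dmax))] childBody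
        (.num (acc * (coef z c * hs c.op (C.suffix u M (inputState n d) b c.pos)) *
          pendingWeight u pend))
        (childTime (baseTime C.depth s cCon cMat Λ) (s * dmax) dmax cMat Λ b) := by
    intro c hc _ _ _
    have hT : Λ + cMat + 400 ≤
        childTime (baseTime C.depth s cCon cMat Λ) (s * dmax) dmax cMat Λ b := by
      cases b
      · exact le_rfl
      · exact Nat.le_add_right _ _
    by_cases hcD : c.pos = C.depth
    · have h := eval_child_end (pos := c.pos) (by omega) (eval_right_end hS (dmax := dmax) (b := b) (gap := gap)
        (acc := acc * coef z c) (yv := yv) (z := c) hcD hx ((hj.runRight hc.2.2.1 c.comp le_rfl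
          (fun h => absurd h (by omega))).mono le_rfl (Set.subset_insert _ _)) hp (by omega))
      rw [hcD, C.suffix_depth, ← mul_assoc acc]
      exact h.mono (by omega)
    have hcD' : c.pos < C.depth := by omega
    have hct : ¬ c.IsTriv := hc.2.2.2.resolve_left hcD
    have hlab := label_of_not_isTriv hS hcD' hct
    cases b with
    | zero =>
      rw [C.suffix_zero _ _ _ hcD, map_zero, mul_zero, mul_zero, zero_mul]
      exact (eval_child_skip hcD' hlab (Or.inl rfl)).mono (by omega)
    | succ b =>
      have hj' : ∀ k, Joined L x (c.withComp k) b (insert ⟨c.pos, c.irr⟩ (pendingIrr pend)) :=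
        fun k => hj.runRight hc.2.2.1 k (by omega) fun _ _ => le_rfl
      by_cases hdim : (C.basis c.pos).dim c.irr ≤ dmax
      · have h := eval_child_step hcD' hlab hdim (Nat.succ_ne_zero b) (eval_components c
          (dir := 3) (gap := gap) (acc := acc * coef z c) (pend := pendingVal pend) (y := yv)
          (fun k => acc * coef z c * C.rightValue u M (inputState n d) (c.withComp k) (M + 2) b *
            pendingWeight u (⟨c.pos, c.irr, c.comp, k⟩ :: pend)) (fun k => by
            have h := ih b (by omega) (z := c.withComp k) (gap := M + 2) (acc := acc * coef z c)
              (pend := ⟨c.pos, c.irr, c.comp, k⟩ :: pend) hcD'.le le_rfl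
              (by rw [pendingIrr_cons]; exact hj' k)
              (by
                intro p hpp
                rcases List.mem_cons.1 hpp with rfl | hpp
                · exact hcD'
                · exact hp p hpp)
              (by rw [List.length_cons]; omega)
            rw [if_neg (show (c.withComp k).pos ≠ C.depth from hcD)] at h
            exact h))
        have hV : acc * (coef z c * hs c.op (C.suffix u M (inputState n d) (b + 1) c.pos)) *
            pendingWeight u pend = ∑ k, acc * coef z c *
              C.rightValue u M (inputState n d) (c.withComp k) (M + 2) b *
              pendingWeight u (⟨c.pos, c.irr, c.comp, k⟩ :: pend) := by
          rw [hs_suffix_succ u M _ hct hcD, Finset.mul_sum, Finset.mul_sum, Finset.sum_mul]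
          refine Finset.sum_congr rfl fun k _ => ?_
          simp only [pendingWeight, List.map_cons, List.prod_cons]
          ring
        rw [hV]
        refine h.mono ?_
        have := Nat.mul_le_mul_right (searchTime (baseTime C.depth s cCon cMat Λ) (s * dmax) b + 400)
          hdim
        rw [childTime]
        linarith
      -- Above `dmax` the branch must be worthless: a non-zero term would complete to a valid
      -- truncated path through `c.irr`, contradicting `h0`.
      · have hV : hs c.op (C.suffix u M (inputState n d) (b + 1) c.pos) = 0 := by
          rw [hs_suffix_succ u M _ hct hcD]
          refine Finset.sum_eq_zero fun k _ => ?_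
          by_contra hk
          exact hdim (h0 c.pos hcD' c.irr ((hj' k).allowed_of_rightValue_ne_zero u M _ hx
            (right_ne_zero_of_mul hk) (Set.mem_insert _ _)))
        rw [hV, mul_zero, mul_zero, zero_mul]
        exact (eval_child_skip hcD' hlab (Or.inr (by omega))).mono (by omega)
  obtain ⟨ls, hnd, hls, h⟩ := eval_positions (O := O) (D := C.depth) (L := L) (M := M)
    (dmax := dmax) (dir := 3) (gap := gap) (b := b) (acc := acc) (pend := pendingVal pend) (y := yv)
    (x := z.enc) (rightChildren z) (coef z) _ (z.pos + 1) gap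
    (fun j hj1 _ hj2 => hS.contractRight z j hj1 hj2) hchild
  have hV : acc * C.rightValue u M (inputState n d) z gap b * pendingWeight u pend =
      (ls.map fun c => acc * (coef z c * hs c.op (C.suffix u M (inputState n d) b c.pos)) *
        pendingWeight u pend).sum := by
    rw [rightValue_eq_sum u M _ z gap b hnd, ← List.sum_map_mul_left, ← List.sum_map_mul_right]
    intro c
    rw [hls]
    exact ⟨fun h => ⟨h.1, h.2.1, h.2.2.1⟩, fun h => ⟨h.1, h.2.1, h.2.2, h.1.2.1⟩⟩
  rw [hV]
  refine (eval_node_right (by omega) h).mono ?_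
  exact node_time (by omega) (length_le_of_encard_le (h1.right z (by omega)) hnd
    fun c hc => ((hls c).1 hc).1) b

end Search

end NoisyCircuit

namespace NoisyCircuit

variable {n d : ℕ} {G : Type*} [Group G] [TopologicalSpace G] {C : NoisyCircuit n d G} [NeZero d]

/-! ### Search to the left, loop over terms and loop over windows -/

section Search

variable {L M dmax s cMat cCon cFull cEval : ℕ} {g : Fin C.depth → G}
  {y : Fin n → Option (Fin d)} {O : Oracle}

/-- The running time of the search to the right. -/
def rightTime (D s dmax cMat cCon cEval L b : ℕ) : ℕ :=
  searchTime (baseTime D s cCon cMat (leafTime L cMat cEval)) (s * dmax) b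

/-- The running time of the search to the left and then to the right. -/
def leftTime (D s dmax cMat cCon cEval L b : ℕ) : ℕ :=
  searchTime (baseTime D s cCon cMat (rightTime D s dmax cMat cCon cEval L L + cEval + 200))
    (s * dmax) b

/-- The entire search to the right is a leaf of the search to the left. Its time is taken at the
full budget `L`, whatever budget is left over. -/
theorem eval_left_end (h0 : C.Assumption0 L dmax) (h1 : C.Assumption1 s)
    (hS : C.Subroutines L M g y cMat cCon cFull cEval O) (hM : M + 2 ≤ C.depth)
    {z : C.Node} (hz : z.pos < C.depth) {b gap : ℕ} {x : C.Node} {acc : ℂ}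
    {pend : List C.Pending} (hx : x.pos = 0) (hj : Joined L x z b (pendingIrr pend))
    (hp : ∀ p ∈ pend, p.1 < C.depth) (hl : pend.length + b ≤ L) :
    EvalWithin searchProgram O [.pair x.enc (stateVal 4 gap b acc (pendingVal pend) z.enc
      (paramsVal C.depth L M dmax))] nodeBody
      (.num (acc * C.leftValue (C.extend g) (diagSum n d y) (fun b =>
          C.rightValue (C.extend g) M (inputState n d) z 1 b) x b *
          pendingWeight (C.extend g) pend))
      (rightTime C.depth s dmax cMat cCon cEval L L + cEval + 200) := by
  have hm := hS.marginal x hx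
  rw [← diagSum_apply] at hm
  have h := eval_right h0 h1 hS hM hx (yv := z.enc) b (gap := 1)
    (acc := acc * diagSum n d y x.op) hz.le (by omega) hj hp hl
  rw [if_neg hz.ne] at h
  rw [leftValue_of_pos_eq_zero _ _ _ hx, mul_comm (C.rightValue _ _ _ _ _ _), ← mul_assoc acc]
  have henc : x.enc = Val.ofNats [0, x.irr, x.mul, x.comp] := by rw [← hx]; rfl
  rw [henc] at hm ⊢
  refine (eval_node_left_end hm h).mono ?_
  have := searchTime_mono (baseTime C.depth s cCon cMat (leafTime L cMat cEval)) (s * dmax)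
    (show b ≤ L by omega)
  rw [rightTime]
  omega

/-- Mirror image of `eval_right`, with the right end `z` of the window held fixed. The weight at the
left end is `rightValue` as a function of the remaining budget, so both sides together use at most
`L` non-trivial layers. -/
theorem eval_left (h0 : C.Assumption0 L dmax) (h1 : C.Assumption1 s)
    (hS : C.Subroutines L M g y cMat cCon cFull cEval O) (hM : M + 2 ≤ C.depth)
    {z : C.Node} (hz : z.pos < C.depth) (b : ℕ) {gap : ℕ} {x : C.Node} {acc : ℂ}
    {pend : List C.Pending} (hj : Joined L x z b (pendingIrr pend))
    (hp : ∀ p ∈ pend, p.1 < C.depth) (hl : pend.length + b ≤ L) :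
    EvalWithin searchProgram O [.pair x.enc (stateVal 4 gap b acc (pendingVal pend) z.enc
      (paramsVal C.depth L M dmax))] nodeBody
      (.num (acc * C.leftValue (C.extend g) (diagSum n d y) (fun b =>
          C.rightValue (C.extend g) M (inputState n d) z 1 b) x b *
          pendingWeight (C.extend g) pend))
      (leftTime C.depth s dmax cMat cCon cEval L b) := by
  classical
  rw [leftTime]
  set u := C.extend g
  set f : ℕ → ℂ := fun b => C.rightValue u M (inputState n d) z 1 b with hf
  set Λ := rightTime C.depth s dmax cMat cCon cEval L L + cEval + 200 with hΛ
  induction b using Nat.strong_induction_on generalizing x gap acc pend with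
  | _ b ih =>
  have hxD : x.pos < C.depth := hj.1.trans_lt hz
  by_cases hx : x.pos = 0
  · refine (eval_left_end h0 h1 hS hM hz hx hj hp hl).mono
      (le_trans ?_ (le_searchTime _ _ _))
    simp only [baseTime]
    omega
  have hchild : ∀ c ∈ leftChildren x, 0 ≤ c.pos → c.pos < 0 + x.pos →
      c.pos ≤ C.depth → EvalWithin searchProgram O [.pair c.enc (stateVal 4 gap b (acc * coef c x)
        (pendingVal pend) z.enc (paramsVal C.depth L M dmax))] childBody
        (.num (acc * (coef c x * C.leftChildValue u (diagSum n d y) f c b) *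
          pendingWeight u pend))
        (childTime (baseTime C.depth s cCon cMat Λ) (s * dmax) dmax cMat Λ b) := by
    intro c hc _ hcx _
    have hT : Λ + cMat + 400 ≤
        childTime (baseTime C.depth s cCon cMat Λ) (s * dmax) dmax cMat Λ b := by
      cases b
      · exact le_rfl
      · exact Nat.le_add_right _ _
    have hcD : c.pos < C.depth := by omega
    by_cases hct : c.IsTriv
    · have hc0 : c.pos = 0 := hc.2.2.resolve_right fun h => h hct
      have h := eval_child_trivial hcD (label_of_isTriv hS hcD hct) (eval_left_end h0 h1 hS hM hz
        (gap := gap) (acc := acc * coef c x) hc0 ((hj.runLeft hc.2.1 c.comp le_rfl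
          (fun h => absurd hct h)).mono le_rfl (Set.subset_insert _ _)) hp hl)
      rw [leftChildValue, if_pos hct, ← mul_assoc acc]
      exact h.mono (by omega)
    have hlab := label_of_not_isTriv hS hcD hct
    rw [leftChildValue, if_neg hct]
    cases b with
    | zero =>
      change EvalWithin _ _ _ _ (.num (acc * (coef c x * 0) * pendingWeight u pend)) _
      rw [mul_zero, mul_zero, zero_mul]
      exact (eval_child_skip hcD hlab (Or.inl rfl)).mono (by omega)
    | succ b =>
      have hj' : ∀ k, Joined L (c.withComp k) z b (insert ⟨c.pos, c.irr⟩ (pendingIrr pend)) :=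
        fun k => hj.runLeft hc.2.1 k (by omega) fun _ => le_rfl
      by_cases hdim : (C.basis c.pos).dim c.irr ≤ dmax
      · have h := eval_child_step hcD hlab hdim (Nat.succ_ne_zero b) (eval_components c
          (dir := 4) (gap := gap) (acc := acc * coef c x) (pend := pendingVal pend) (y := z.enc)
          (fun k => acc * coef c x * C.leftValue u (diagSum n d y) f (c.withComp k) b *
            pendingWeight u (⟨c.pos, c.irr, k, c.comp⟩ :: pend)) (fun k =>
            ih b (by omega) (x := c.withComp k) (gap := M + 2) (acc := acc * coef c x)
              (pend := ⟨c.pos, c.irr, k, c.comp⟩ :: pend)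
              (by rw [pendingIrr_cons]; exact hj' k)
              (by
                intro p hpp
                rcases List.mem_cons.1 hpp with rfl | hpp
                · exact hcD
                · exact hp p hpp)
              (by rw [List.length_cons]; omega)))
        have hV : acc * (coef c x * ∑ k, C.e c.pos c.irr k *
            (C.basis c.pos).coeff c.irr (u c.pos) k c.comp *
            C.leftValue u (diagSum n d y) f (c.withComp k) b) *
            pendingWeight u pend = ∑ k, acc * coef c x *
              C.leftValue u (diagSum n d y) f (c.withComp k) b *
              pendingWeight u (⟨c.pos, c.irr, k, c.comp⟩ :: pend) := by
          rw [Finset.mul_sum, Finset.mul_sum, Finset.sum_mul]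
          refine Finset.sum_congr rfl fun k _ => ?_
          simp only [pendingWeight, List.map_cons, List.prod_cons]
          ring
        rw [hV]
        refine h.mono ?_
        have := Nat.mul_le_mul_right (searchTime (baseTime C.depth s cCon cMat Λ) (s * dmax) b + 400)
          hdim
        rw [childTime]
        linarith
      · have hV : ∑ k, C.e c.pos c.irr k *
            (C.basis c.pos).coeff c.irr (u c.pos) k c.comp *
            C.leftValue u (diagSum n d y) f (c.withComp k) b = 0 := by
          refine Finset.sum_eq_zero fun k _ => ?_
          by_contra hk
          exact hdim (h0 c.pos hcD c.irr ((hj' k).allowed_of_leftValue_ne_zero u M _ _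
            (right_ne_zero_of_mul hk) (Set.mem_insert _ _)))
        simp only [hV]
        rw [mul_zero, mul_zero, zero_mul]
        exact (eval_child_skip hcD hlab (Or.inr (by omega))).mono (by omega)
  obtain ⟨ls, hnd, hls, h⟩ := eval_positions (O := O) (D := C.depth) (L := L) (M := M)
    (dmax := dmax) (dir := 4) (gap := gap) (b := b) (acc := acc) (pend := pendingVal pend)
    (y := z.enc) (x := x.enc) (leftChildren x) (fun c => coef c x) _ 0 x.pos
    (fun j _ hj _ => hS.contractLeft x hxD j (by omega)) hchild
  have hV : acc * C.leftValue u (diagSum n d y) f x b * pendingWeight u pend =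
      (ls.map fun c => acc * (coef c x * C.leftChildValue u (diagSum n d y) f c b) *
        pendingWeight u pend).sum := by
    rw [leftValue_eq_sum u _ f (by omega) b hnd, ← List.sum_map_mul_left,
      ← List.sum_map_mul_right]
    intro c
    rw [hls]
    refine ⟨fun h => h.1, fun h => ⟨h, Nat.zero_le _, ?_, ?_⟩⟩
    · have := h.1
      omega
    · have := h.1
      omega
  rw [hV]
  refine (eval_node_left hx h).mono ?_
  exact node_time (by omega) (length_le_of_encard_le (h1.left x hxD) hnd
    fun c hc => ((hls c).1 hc).1) b

theorem Joined.of_mem_fullTerms {i : ℕ} {z : C.Node × C.Node} (hz : z ∈ C.fullTerms i M) :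
    Joined L z.1 z.2 L (pendingIrr []) := by
  obtain ⟨-, -, hx, hy, hc⟩ := hz
  exact ((Joined.refl L hy).runLeft hc z.1.comp le_rfl fun h => absurd hx h).mono le_rfl
    (by rintro a ⟨p, hp, -⟩; exact absurd hp List.not_mem_nil)

theorem eval_terms (h0 : C.Assumption0 L dmax) (h1 : C.Assumption1 s)
    (hS : C.Subroutines L M g y cMat cCon cFull cEval O) (hM : M + 2 ≤ C.depth) {i : ℕ}
    (hi : i + M + 1 < C.depth) (l : List (C.Node × C.Node)) (hl : ∀ z ∈ l, z ∈ C.fullTerms i M) :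
    EvalWithin searchProgram O [.pair (Val.ofList (l.map fun z =>
        .pair z.1.enc (.pair z.2.enc (.num (coef z.1 z.2))))) (paramsVal C.depth L M dmax)] termBody
      (.num (l.map fun z => coef z.1 z.2 * C.leftValue (C.extend g) (diagSum n d y)
        (fun b => C.rightValue (C.extend g) M (inputState n d) z.2 1 b) z.1 L).sum)
      (l.length * (leftTime C.depth s dmax cMat cCon cEval L L + 100) + 100) := by
  induction l with
  | nil => exact eval_term_nil.mono (by omega)
  | cons z l ih =>
    have hz := hl z (List.mem_cons_self ..)
    have h := eval_left h0 h1 hS hM (z := z.2) (by rw [hz.2.1]; omega) L (gap := 0)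
      (acc := coef z.1 z.2) (Joined.of_mem_fullTerms hz) (by simp) (by simp)
    rw [pendingWeight, List.map_nil, List.prod_nil, mul_one] at h
    rw [List.map_cons, List.map_cons, List.sum_cons]
    refine (eval_term_cons h (ih fun z hz => hl z (List.mem_cons_of_mem _ hz))).mono ?_
    rw [List.length_cons]
    linarith

/-- The running time for a window. -/
def windowTime (D s dmax cMat cCon cEval L r cFull : ℕ) : ℕ :=
  cFull + r * (leftTime D s dmax cMat cCon cEval L L + 100) + 200

theorem eval_windows (h0 : C.Assumption0 L dmax) (h1 : C.Assumption1 s) {r : ℕ}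
    (h3 : C.Assumption3 M r) (hS : C.Subroutines L M g y cMat cCon cFull cEval O)
    (hM : M + 2 ≤ C.depth) (m i : ℕ) (hm : i + m = C.depth) :
    EvalWithin searchProgram O [.pair (.nat i) (paramsVal C.depth L M dmax)] windowBody
      (.num (∑ t ∈ Finset.range m, diagSum n d y (C.prefixFam (C.extend g) (i + t)
        (C.windowFirst (C.extend g) M (inputState n d) (i + t)) L)))
      (m * windowTime C.depth s dmax cMat cCon cEval L r cFull + 100) := by
  induction m generalizing i with
  | zero =>
    rw [Finset.sum_range_zero]
    exact (eval_window_stop (by omega)).mono (by omega)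
  | succ m ih =>
    by_cases hi : i + M + 1 < C.depth
    · obtain ⟨w, t, hw, ht, l, hnd, hl, rfl⟩ := hS.contractFull i hi
      have hrec := ih (i + 1) (by omega)
      have hterm := eval_terms h0 h1 hS hM hi l fun z hz => (hl z).1 hz
      rw [← windowFirst_eq_sum (C.extend g) (diagSum n d y) M (inputState n d) hi hnd hl] at hterm
      rw [Finset.sum_range_succ', add_comm]
      have hlen := Nat.mul_le_mul_right (leftTime C.depth s dmax cMat cCon cEval L L + 100)
        (length_le_of_encard_le (h3 i hi) hnd fun z hz => (hl z).1 hz)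
      have key := eval_window_step hi ⟨_, t, hw, ht, rfl⟩ hterm hrec
      simp only [add_right_comm i 1, add_assoc i _ 1] at key ⊢
      refine key.mono ?_
      rw [windowTime]
      linarith
    -- Fewer than `M + 2` layers remain, so neither this window nor a later one fits.
    · rw [Finset.sum_eq_zero]
      · exact (eval_window_stop hi).mono (by omega)
      · intro t _
        have : C.windowFirst (C.extend g) M (inputState n d) (i + t) = 0 := by
          ext1 b
          exact if_neg (by omega)
        rw [this, map_zero, Pi.zero_apply, map_zero]

/-- The program computes the truncated sum over all paths. -/
theorem eval_search (h0 : C.Assumption0 L dmax) (h1 : C.Assumption1 s) {r : ℕ}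
    (h3 : C.Assumption3 M r) (hS : C.Subroutines L M g y cMat cCon cFull cEval O)
    (hL : (L + 1) * (M + 2) ≤ C.depth) :
    ∃ t ≤ C.depth * windowTime C.depth s dmax cMat cCon cEval L r cFull + 200,
      searchProgram.Outputs O (Val.ofNats [C.depth, L, M, dmax])
        (.num (diagSum n d y (C.prefixFam (C.extend g) C.depth (fun _ => inputState n d) L))) t := by
  have hM : M + 2 ≤ C.depth := le_trans (Nat.le_mul_of_pos_left _ (Nat.succ_pos L)) hL
  have h := eval_main (eval_windows h0 h1 h3 hS hM C.depth 0 (zero_add _))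
  simp only [zero_add] at h
  rw [C.prefixFam_const_eq (C.extend g) M, Pi.add_apply, C.windowFree_eq_zero _ _ _ hL, zero_add,
    Finset.sum_apply, map_sum]
  exact (EvalWithin.call rfl (.elementary (e := .var 0) rfl le_rfl) h).mono
    (by change 1 + _ + 1 ≤ _; omega)

end Search

end NoisyCircuit

/-! ## Schur orthogonality -/

section Schur

variable {G : Type*} [Group G] {m m' : ℕ}

/-- Schur's lemma: kernel and range of an intertwiner are invariant, so a non-zero one is bijective.
-/
theorem eq_zero_of_intertwines {v : G →* Matrix.unitaryGroup (Fin m) ℂ}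
    {v' : G →* Matrix.unitaryGroup (Fin m') ℂ} (hv : IsIrrep v) (hv' : IsIrrep v')
    (h : ¬ AreEquivalent v' v) {S : Matrix (Fin m) (Fin m') ℂ}
    (hS : ∀ g, (v g : Matrix (Fin m) (Fin m) ℂ) * S = S * (v' g : Matrix (Fin m') (Fin m') ℂ)) :
    S = 0 := by
  have hmul : ∀ g x, (v g : Matrix (Fin m) (Fin m) ℂ) *ᵥ (S *ᵥ x) =
      S *ᵥ ((v' g : Matrix (Fin m') (Fin m') ℂ) *ᵥ x) := fun g x => by
    rw [Matrix.mulVec_mulVec, hS, Matrix.mulVec_mulVec]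
  by_contra hne
  have hker : LinearMap.ker S.mulVecLin = ⊥ := by
    refine (hv'.2 _ fun g x hx => ?_).resolve_right fun htop => hne ?_
    · rw [LinearMap.mem_ker, Matrix.mulVecLin_apply] at hx ⊢
      rw [← hmul, hx, Matrix.mulVec_zero]
    · rw [LinearMap.ker_eq_top] at htop
      exact Matrix.toLin'.injective (by rw [Matrix.toLin'_apply', htop, map_zero])
  have hran : LinearMap.range S.mulVecLin = ⊤ := by
    refine (hv.2 _ fun g x hx => ?_).resolve_left fun hbot => hne ?_
    · obtain ⟨z, rfl⟩ := hx
      exact ⟨(v' g : Matrix (Fin m') (Fin m') ℂ) *ᵥ z, (hmul g z).symm⟩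
    · rw [LinearMap.range_eq_bot] at hbot
      exact Matrix.toLin'.injective (by rw [Matrix.toLin'_apply', hbot, map_zero])
  refine h ⟨LinearEquiv.ofBijective S.mulVecLin
    ⟨LinearMap.ker_eq_bot.1 hker, LinearMap.range_eq_top.1 hran⟩, fun g x => ?_⟩
  exact (hmul g x).symm

/-- An eigenspace of `S` is invariant and non-zero, hence everything; the scalar is read off from
the trace. -/
theorem eq_smul_one_of_commutes {v : G →* Matrix.unitaryGroup (Fin m) ℂ} (hv : IsIrrep v)
    {S : Matrix (Fin m) (Fin m) ℂ}
    (hS : ∀ g, (v g : Matrix (Fin m) (Fin m) ℂ) * S = S * (v g : Matrix (Fin m) (Fin m) ℂ)) :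
    S = (S.trace / m) • (1 : Matrix (Fin m) (Fin m) ℂ) := by
  have : Nonempty (Fin m) := ⟨⟨0, hv.1⟩⟩
  obtain ⟨c, hc⟩ := Module.End.exists_eigenvalue S.mulVecLin
  have hker : Module.End.eigenspace S.mulVecLin c = ⊤ := by
    refine (hv.2 _ fun g x hx => ?_).resolve_left hc
    rw [Module.End.mem_eigenspace_iff, Matrix.mulVecLin_apply] at hx ⊢
    rw [Matrix.mulVec_mulVec, ← hS, ← Matrix.mulVec_mulVec, hx, Matrix.mulVec_smul]
  have hSc : S = c • (1 : Matrix (Fin m) (Fin m) ℂ) := by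
    apply Matrix.ext_of_mulVec_single
    intro j
    have := Module.End.mem_eigenspace_iff.1
      (hker ▸ Submodule.mem_top : (Pi.single j 1 : Fin m → ℂ) ∈ _)
    rw [Matrix.mulVecLin_apply] at this
    rw [this, Matrix.smul_mulVec, Matrix.one_mulVec]
  have hm : (m : ℂ) ≠ 0 := Nat.cast_ne_zero.2 hv.1.ne'
  conv_lhs => rw [hSc]
  rw [hSc, Matrix.trace_smul, Matrix.trace_one, Fintype.card_fin, smul_eq_mul,
    mul_div_cancel_right₀ _ hm]

variable [TopologicalSpace G] [IsTopologicalGroup G] [CompactSpace G] [MeasurableSpace G]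
  [BorelSpace G] (μ : Measure G) [μ.IsHaarMeasure] [IsProbabilityMeasure μ]

omit [Group G] [IsTopologicalGroup G] in
theorem integrable_of_continuous {μ : Measure G} [IsFiniteMeasure μ] {f : G → ℂ}
    (hf : Continuous f) : Integrable f μ := by
  obtain ⟨K, hK⟩ := (isCompact_range hf).isBounded.exists_norm_le
  exact Integrable.of_bound hf.aestronglyMeasurable K
    (Filter.Eventually.of_forall fun x => hK _ ⟨x, rfl⟩)

/-- The matrix of the integrals of products of matrix coefficients of two representations. -/
def schurMatrix (v : G →* Matrix.unitaryGroup (Fin m) ℂ) (v' : G →* Matrix.unitaryGroup (Fin m') ℂ)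
    (k' : Fin m) (j' : Fin m') : Matrix (Fin m) (Fin m') ℂ :=
  .of fun k j => ∫ u, (v u : Matrix (Fin m) (Fin m) ℂ) k k' *
    star ((v' u : Matrix (Fin m') (Fin m') ℂ) j j') ∂μ

variable {μ}

/-- Replacing `u` by `g * u` in the Haar integral moves `g` from one factor to the other, and
unitarity turns `v' g⁻¹` into the adjoint of `v' g`. -/
theorem schurMatrix_intertwines {v : G →* Matrix.unitaryGroup (Fin m) ℂ}
    {v' : G →* Matrix.unitaryGroup (Fin m') ℂ}
    (hc : ∀ k k', Continuous fun u => (v u : Matrix (Fin m) (Fin m) ℂ) k k')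
    (hc' : ∀ k k', Continuous fun u => (v' u : Matrix (Fin m') (Fin m') ℂ) k k')
    (k' : Fin m) (j' : Fin m') (g : G) :
    (v g : Matrix (Fin m) (Fin m) ℂ) * schurMatrix μ v v' k' j' =
      schurMatrix μ v v' k' j' * (v' g : Matrix (Fin m') (Fin m') ℂ) := by
  have hint : ∀ k j, Integrable (fun u => (v u : Matrix (Fin m) (Fin m) ℂ) k k' *
      star ((v' u : Matrix (Fin m') (Fin m') ℂ) j j')) μ := fun k j =>
    integrable_of_continuous ((hc _ _).mul (hc' _ _).star)
  ext k j
  rw [Matrix.mul_apply, Matrix.mul_apply]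
  simp only [schurMatrix, Matrix.of_apply]
  have h1 : ∀ u, ∑ i, (v g : Matrix (Fin m) (Fin m) ℂ) k i * ((v u : Matrix (Fin m) (Fin m) ℂ) i k' *
      star ((v' u : Matrix (Fin m') (Fin m') ℂ) j j')) =
      (v (g * u) : Matrix (Fin m) (Fin m) ℂ) k k' *
      star ((v' (g⁻¹ * (g * u)) : Matrix (Fin m') (Fin m') ℂ) j j') := by
    intro u
    rw [inv_mul_cancel_left, map_mul, Matrix.UnitaryGroup.mul_val, Matrix.mul_apply, Finset.sum_mul]
    simp only [mul_assoc]
  have h2 : ∀ u, (v u : Matrix (Fin m) (Fin m) ℂ) k k' *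
      star ((v' (g⁻¹ * u) : Matrix (Fin m') (Fin m') ℂ) j j') =
      ∑ i, ((v u : Matrix (Fin m) (Fin m) ℂ) k k' *
        star ((v' u : Matrix (Fin m') (Fin m') ℂ) i j')) *
        (v' g : Matrix (Fin m') (Fin m') ℂ) i j := by
    intro u
    rw [map_mul, map_inv, Matrix.UnitaryGroup.mul_val, Matrix.mul_apply, star_sum, Finset.mul_sum]
    refine Finset.sum_congr rfl fun i _ => ?_
    rw [Matrix.UnitaryGroup.inv_val, Matrix.star_apply, star_mul, star_star]
    ring
  simp only [← integral_const_mul, ← integral_mul_const]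
  rw [← integral_finsetSum _ fun i _ => (hint i j).const_mul _,
    ← integral_finsetSum _ fun i _ => (hint k i).mul_const _]
  simp only [h1, ← h2]
  exact integral_mul_left_eq_self (μ := μ) (fun u => (v u : Matrix (Fin m) (Fin m) ℂ) k k' *
      star ((v' (g⁻¹ * u) : Matrix (Fin m') (Fin m') ℂ) j j')) g

theorem integral_coeff_of_not_equivalent {v : G →* Matrix.unitaryGroup (Fin m) ℂ}
    {v' : G →* Matrix.unitaryGroup (Fin m') ℂ} (hv : IsIrrep v) (hv' : IsIrrep v')
    (hc : ∀ k k', Continuous fun u => (v u : Matrix (Fin m) (Fin m) ℂ) k k')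
    (hc' : ∀ k k', Continuous fun u => (v' u : Matrix (Fin m') (Fin m') ℂ) k k')
    (h : ¬ AreEquivalent v' v) (k k' : Fin m) (j j' : Fin m') :
    ∫ u, (v u : Matrix (Fin m) (Fin m) ℂ) k k' *
      star ((v' u : Matrix (Fin m') (Fin m') ℂ) j j') ∂μ = 0 :=
  congrFun (congrFun (eq_zero_of_intertwines hv hv' h
    (schurMatrix_intertwines (μ := μ) hc hc' k' j')) k) j

theorem integral_coeff_same {v : G →* Matrix.unitaryGroup (Fin m) ℂ} (hv : IsIrrep v)
    (hc : ∀ k k', Continuous fun u => (v u : Matrix (Fin m) (Fin m) ℂ) k k')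
    (k k' j j' : Fin m) :
    ∫ u, (v u : Matrix (Fin m) (Fin m) ℂ) k k' * star ((v u : Matrix (Fin m) (Fin m) ℂ) j j') ∂μ =
      if k = j ∧ k' = j' then (m : ℂ)⁻¹ else 0 := by
  have h := congrFun (congrFun (eq_smul_one_of_commutes hv
    (schurMatrix_intertwines (μ := μ) hc hc k' j')) k) j
  -- The columns of a unitary matrix are orthonormal and `μ` has mass one, which fixes the scalar in
  -- Schur's lemma.
  have htr : (schurMatrix μ v v k' j').trace = if k' = j' then 1 else 0 := by
    simp only [Matrix.trace, Matrix.diag_apply, schurMatrix, Matrix.of_apply]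
    have hint : ∀ i ∈ Finset.univ, Integrable (fun u => (v u : Matrix (Fin m) (Fin m) ℂ) i k' *
        star ((v u : Matrix (Fin m) (Fin m) ℂ) i j')) μ := fun i _ =>
      integrable_of_continuous ((hc _ _).mul (hc _ _).star)
    rw [← integral_finsetSum _ hint]
    have hu : ∀ u, ∑ i, (v u : Matrix (Fin m) (Fin m) ℂ) i k' *
        star ((v u : Matrix (Fin m) (Fin m) ℂ) i j') = if k' = j' then 1 else 0 := by
      intro u
      have := congrFun (congrFun (Matrix.mem_unitaryGroup_iff'.1 (v u).2) j') k'
      rw [Matrix.mul_apply, Matrix.one_apply] at this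
      simp only [Matrix.star_apply] at this
      simp only [eq_comm (a := j')] at this
      exact (Finset.sum_congr rfl fun i _ => mul_comm _ _).trans this
    simp only [hu, integral_const, probReal_univ, one_smul]
  change schurMatrix μ v v k' j' k j = _
  rw [h, htr, Matrix.smul_apply, Matrix.one_apply]
  by_cases h1 : k = j <;> by_cases h2 : k' = j' <;> simp [h1, h2]

end Schur

namespace ITOBasis

variable {n d : ℕ} {G : Type*} [Group G] [TopologicalSpace G]
  {U : G →* Matrix.unitaryGroup (Outcome n d) ℂ} (B : ITOBasis n d U)

-- Continuity is assumed of `U` only. As every irrep has a copy in the basis, its coefficients are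
-- matrix elements of the conjugation by `U` and inherit it.
omit [TopologicalSpace G] in
theorem coeff_eq_hs (l : Fin B.nIrr) (u : G) (k k' : Fin (B.dim l)) :
    B.coeff l u k k' = hs (B.T l ⟨0, B.mult_pos l⟩ k)
      (conjBy (U u : Op n d) (B.T l ⟨0, B.mult_pos l⟩ k')) := by
  rw [B.transform, map_sum]
  simp [hs_same, coeff]

theorem continuous_coeff (hU : Continuous U) (l : Fin B.nIrr) (k k' : Fin (B.dim l)) :
    Continuous fun u => B.coeff l u k k' := by
  simp only [coeff_eq_hs, hs_apply, conjBy_apply]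
  have h : Continuous fun u => (U u : Op n d) := continuous_subtype_val.comp hU
  exact (continuous_const.matrix_mul
    (h.matrix_mul (continuous_const.matrix_mul h.matrix_conjTranspose))).matrix_trace

end ITOBasis

/-! ## Products of sums and orthogonal families -/

/-- The factors will be superoperators, which do not commute, so the distributive law has to keep
the order of the list. -/
theorem prod_ofFn_sum {R : Type*} [Semiring R] {t : ℕ} {ι : Fin t → Type*} [∀ i, Fintype (ι i)]
    (f : ∀ i, ι i → R) : (List.ofFn fun i => ∑ j, f i j).prod =
      ∑ φ : ∀ i, ι i, (List.ofFn fun i => f i (φ i)).prod := by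
  induction t with
  | zero => simp
  | succ t ih =>
    rw [List.ofFn_succ, List.prod_cons, ih, ← (Fin.consEquiv ι).sum_comp, Fintype.sum_prod_type,
      Finset.sum_mul]
    refine Finset.sum_congr rfl fun j _ => ?_
    rw [Finset.mul_sum]
    refine Finset.sum_congr rfl fun φ _ => ?_
    rw [List.ofFn_succ, List.prod_cons]
    rfl

theorem prod_ofFn_smul {R A : Type*} [CommSemiring R] [Semiring A] [Algebra R A] {t : ℕ}
    (c : Fin t → R) (f : Fin t → A) :
    (List.ofFn fun i => c i • f i).prod = (∏ i, c i) • (List.ofFn f).prod := by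
  induction t with
  | zero => simp
  | succ t ih =>
    rw [List.ofFn_succ, List.prod_cons, ih, List.ofFn_succ, List.prod_cons, Fin.prod_univ_succ,
      smul_mul_smul_comm]

theorem integral_norm_sq_sum {Ω I : Type*} [MeasurableSpace Ω] {μ : Measure Ω} [Fintype I]
    {φ : I → Ω → ℂ} {N : I → ℝ} (hint : ∀ i j, Integrable (fun ω => φ i ω * star (φ j ω)) μ)
    (hself : ∀ i, ∫ ω, φ i ω * star (φ i ω) ∂μ = N i)
    (hne : ∀ i j, i ≠ j → ∫ ω, φ i ω * star (φ j ω) ∂μ = 0) (a : I → ℂ) :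
    ∫ ω, ‖∑ i, a i * φ i ω‖ ^ 2 ∂μ = ∑ i, ‖a i‖ ^ 2 * N i := by
  have h : ∀ ω, ((‖∑ i, a i * φ i ω‖ ^ 2 : ℝ) : ℂ) =
      ∑ i, ∑ j, (a i * star (a j)) * (φ i ω * star (φ j ω)) := by
    intro ω
    rw [Complex.ofReal_pow, ← Complex.mul_conj', map_sum, Finset.sum_mul_sum]
    refine Finset.sum_congr rfl fun i _ => Finset.sum_congr rfl fun j _ => ?_
    rw [map_mul, starRingEnd_apply, starRingEnd_apply]
    ring
  apply Complex.ofReal_injective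
  rw [← integral_complex_ofReal]
  simp only [h]
  rw [integral_finsetSum _ fun i _ => integrable_finsetSum _ fun j _ => (hint i j).const_mul _,
    Complex.ofReal_sum]
  refine Finset.sum_congr rfl fun i _ => ?_
  rw [integral_finsetSum _ fun j _ => (hint i j).const_mul _, Finset.sum_eq_single i,
    integral_const_mul, hself, Complex.ofReal_mul, Complex.ofReal_pow, ← Complex.mul_conj']
  · rfl
  · intro j _ hj
    rw [integral_const_mul, hne i j hj.symm, mul_zero]
  · simp

theorem conjBy_mul {n d : ℕ} (A B : Op n d) : conjBy (A * B) = conjBy A * conjBy B := by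
  ext1 X
  simp only [conjBy_apply, Module.End.mul_apply, Matrix.conjTranspose_mul, mul_assoc]

theorem conjBy_one {n d : ℕ} : conjBy (1 : Op n d) = 1 := by
  ext1 X
  simp [conjBy_apply]

theorem conjBy_list_prod {n d : ℕ} (l : List (Op n d)) :
    conjBy l.prod = (l.map conjBy).prod := by
  induction l with
  | nil => simp [conjBy_one]
  | cons A l ih => simp [conjBy_mul, ih]

namespace NoisyCircuit

variable {n d : ℕ} {G : Type*} [Group G] [TopologicalSpace G] (C : NoisyCircuit n d G)

/-! ## Expansion into matrix coefficients -/

/-- The sum over the paths with given irreps and components. -/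
def pathOp (l : C.Irreps) (k k' : C.Comps l) : Module.End ℂ (Op n d) :=
  (List.ofFn fun i : Fin C.depth => (C.basis i).unit (l i) (k i) (k' i) * C.superW i).prod

theorem prod_layers_of_irreps (w : ∀ (i : Fin C.depth) (l : C.Irr i),
    Fin ((C.basis i).dim l) → Fin ((C.basis i).dim l) → ℂ) (l : C.Irreps) :
    (List.ofFn fun i : Fin C.depth =>
      (∑ k, ∑ k', w i (l i) k k' • (C.basis i).unit (l i) k k') * C.superW i).prod =
      ∑ k : C.Comps l, ∑ k' : C.Comps l, (∏ i, w i (l i) (k i) (k' i)) • C.pathOp l k k' := by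
  simp only [Finset.sum_mul, smul_mul_assoc]
  rw [prod_ofFn_sum]
  refine Finset.sum_congr rfl fun k _ => ?_
  rw [prod_ofFn_sum]
  refine Finset.sum_congr rfl fun k' _ => ?_
  rw [prod_ofFn_smul]
  rfl

theorem prod_layers (w : ∀ (i : Fin C.depth) (l : C.Irr i),
    Fin ((C.basis i).dim l) → Fin ((C.basis i).dim l) → ℂ) :
    (List.ofFn fun i : Fin C.depth =>
      (∑ l, ∑ k, ∑ k', w i l k k' • (C.basis i).unit l k k') * C.superW i).prod =
      ∑ l : C.Irreps, ∑ k : C.Comps l, ∑ k' : C.Comps l,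
        (∏ i, w i (l i) (k i) (k' i)) • C.pathOp l k k' := by
  simp only [Finset.sum_mul (s := (Finset.univ : Finset (C.Irr _)))]
  rw [prod_ofFn_sum]
  exact Finset.sum_congr rfl fun l _ => C.prod_layers_of_irreps w l

variable [NeZero d]

/-- The contribution of given irreps and components to the probability of an outcome. -/
def pathCoeff (x : Outcome n d) (l : C.Irreps) (k k' : C.Comps l) : ℂ :=
  C.pathOp l k k' (inputState n d) x x

/-- The noise eigenvalue of given irreps and components. -/
def noiseWeight (l : C.Irreps) (k : C.Comps l) : ℂ := ∏ i : Fin C.depth, C.e i (l i) (k i)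

theorem sum_pathOp_apply (c : (l : C.Irreps) → C.Comps l → C.Comps l → ℂ) (s : Finset C.Irreps)
    (x : Outcome n d) :
    (∑ l ∈ s, ∑ k : C.Comps l, ∑ k' : C.Comps l, c l k k' • C.pathOp l k k')
      (inputState n d) x x = ∑ l ∈ s, ∑ k, ∑ k', c l k k' * C.pathCoeff x l k k' := by
  simp only [LinearMap.sum_apply, LinearMap.smul_apply, Matrix.sum_apply, Matrix.smul_apply,
    smul_eq_mul, pathCoeff]

theorem p_eq_sum (x : Outcome n d) (g : Fin C.depth → G) :
    C.p x g = ∑ l : C.Irreps, ∑ k, ∑ k', C.matCoeff l k k' g * C.pathCoeff x l k k' := by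
  rw [← sum_pathOp_apply, p, unitary, conjBy_list_prod, List.map_ofFn]
  have h := C.prod_layers fun i l k k' => (C.basis i).coeff l (g i) k k'
  simp only [← (C.basis _).conjBy_eq] at h
  rw [show (∑ l : C.Irreps, ∑ k : C.Comps l, ∑ k' : C.Comps l, C.matCoeff l k k' g •
    C.pathOp l k k') = _ from h.symm]
  refine congrArg (fun s : List (Module.End ℂ (Op n d)) => s.prod (inputState n d) x x)
    (congrArg List.ofFn (funext fun i => ?_))
  exact conjBy_mul _ _

theorem pNoisy_eq_sum (x : Outcome n d) (g : Fin C.depth → G) :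
    C.pNoisy x g = ∑ l : C.Irreps, ∑ k, ∑ k',
      (C.noiseWeight l k * C.matCoeff l k k' g) * C.pathCoeff x l k k' := by
  rw [← sum_pathOp_apply, pNoisy]
  have h := C.prod_layers fun i l k k' => C.e i l k * (C.basis i).coeff l (g i) k k'
  simp only [Finset.prod_mul_distrib] at h
  rw [show (∑ l : C.Irreps, ∑ k : C.Comps l, ∑ k' : C.Comps l,
    (C.noiseWeight l k * C.matCoeff l k k' g) • C.pathOp l k k') = _ from h.symm]
  refine congrArg (fun s : List (Module.End ℂ (Op n d)) => s.prod (inputState n d) x x)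
    (congrArg List.ofFn (funext fun i => ?_))
  rw [noise_mul_conjBy]
  rfl

/-! ## Fourier coefficients -/

section Fourier

variable [IsTopologicalGroup G] [CompactSpace G] [MeasurableSpace G] [BorelSpace G]
  (μ : Measure G) [μ.IsHaarMeasure] [IsProbabilityMeasure μ]

omit [IsTopologicalGroup G] [NeZero d] [μ.IsHaarMeasure] in
theorem integrable_matCoeff_mul (l l' : C.Irreps) (k k' : C.Comps l) (j j' : C.Comps l') :
    Integrable (fun g => C.matCoeff l k k' g * star (C.matCoeff l' j j' g))
      (Measure.pi fun _ => μ) := by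
  simp only [matCoeff, star_prod, ← Finset.prod_mul_distrib]
  refine Integrable.fintype_prod_dep (f := fun (i : Fin C.depth) u =>
    (C.basis i).coeff (l i) u (k i) (k' i) * star ((C.basis i).coeff (l' i) u (j i) (j' i)))
    fun i => integrable_of_continuous ?_
  exact ((C.basis i).continuous_coeff (C.continuous_U i) _ _ _).mul
    ((C.basis i).continuous_coeff (C.continuous_U i) _ _ _).star

omit [NeZero d] in
theorem integral_matCoeff_same (l : C.Irreps) (k k' j j' : C.Comps l) :
    ∫ g, C.matCoeff l k k' g * star (C.matCoeff l j j' g) ∂(Measure.pi fun _ => μ) =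
      if k = j ∧ k' = j' then ((∏ i : Fin C.depth, (C.basis i).dim (l i) : ℕ) : ℂ)⁻¹ else 0 := by
  simp only [matCoeff, star_prod, ← Finset.prod_mul_distrib]
  refine (integral_fintype_prod_eq_prod (μ := fun _ : Fin C.depth => μ) (fun (i : Fin C.depth) u => (C.basis i).coeff (l i) u (k i) (k' i) *
    star ((C.basis i).coeff (l i) u (j i) (j' i)))).trans ?_
  have h : ∀ i : Fin C.depth, ∫ u, (C.basis i).coeff (l i) u (k i) (k' i) *
      star ((C.basis i).coeff (l i) u (j i) (j' i)) ∂μ =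
      if k i = j i ∧ k' i = j' i then (((C.basis i).dim (l i) : ℕ) : ℂ)⁻¹ else 0 := fun i =>
    integral_coeff_same ((C.basis i).irreducible _)
      ((C.basis i).continuous_coeff (C.continuous_U i) _) _ _ _ _
  simp only [h]
  split_ifs with hk
  · obtain ⟨rfl, rfl⟩ := hk
    simp
  · have : ∃ i, ¬ (k i = j i ∧ k' i = j' i) := by
      by_contra! hc
      exact hk ⟨funext fun i => (hc i).1, funext fun i => (hc i).2⟩
    obtain ⟨i, hi⟩ := this
    exact Finset.prod_eq_zero (Finset.mem_univ i) (if_neg hi)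

omit [NeZero d] in
theorem integral_matCoeff_of_ne {l l' : C.Irreps} (h : l ≠ l') (k k' : C.Comps l)
    (j j' : C.Comps l') :
    ∫ g, C.matCoeff l k k' g * star (C.matCoeff l' j j' g) ∂(Measure.pi fun _ => μ) = 0 := by
  simp only [matCoeff, star_prod, ← Finset.prod_mul_distrib]
  refine (integral_fintype_prod_eq_prod (μ := fun _ : Fin C.depth => μ) (fun (i : Fin C.depth) u => (C.basis i).coeff (l i) u (k i) (k' i) *
    star ((C.basis i).coeff (l' i) u (j i) (j' i)))).trans ?_
  obtain ⟨i, hi⟩ := Function.ne_iff.1 h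
  refine Finset.prod_eq_zero (Finset.mem_univ i) ?_
  exact integral_coeff_of_not_equivalent ((C.basis i).irreducible _) ((C.basis i).irreducible _)
    ((C.basis i).continuous_coeff (C.continuous_U i) _)
    ((C.basis i).continuous_coeff (C.continuous_U i) _)
    ((C.basis i).inequivalent _ _ hi.symm) _ _ _ _

/-- The product of the dimensions. -/
def dims (l : C.Irreps) : ℕ := ∏ i : Fin C.depth, (C.basis i).dim (l i)

omit [IsTopologicalGroup G] [CompactSpace G] [MeasurableSpace G] [BorelSpace G] [NeZero d] in
theorem dims_ne_zero (l : C.Irreps) : (C.dims l : ℂ) ≠ 0 :=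
  Nat.cast_ne_zero.2 (Finset.prod_ne_zero_iff.2 fun i _ => ((C.basis i).irreducible _).1.ne')

/-- Orthogonality selects one term of `p_eq_sum`, and the squared norm of a matrix coefficient is
the inverse dimension. The dimension factor of the series therefore cancels. -/
theorem fourier_p (x : Outcome n d) (l : C.Irreps) (k k' : C.Comps l) :
    C.fourier μ (C.p x) l k k' = C.pathCoeff x l k k' / C.dims l := by
  have hint : ∀ (l' : C.Irreps) (j j' : C.Comps l'), Integrable (fun g =>
      C.pathCoeff x l' j j' * (C.matCoeff l' j j' g * star (C.matCoeff l k k' g)))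
      (Measure.pi fun _ => μ) := fun l' j j' =>
    (C.integrable_matCoeff_mul μ l' l j j' k k').const_mul _
  have hexp : ∀ g, C.p x g * star (C.matCoeff l k k' g) = ∑ l', ∑ j, ∑ j',
      C.pathCoeff x l' j j' * (C.matCoeff l' j j' g * star (C.matCoeff l k k' g)) := by
    intro g
    simp only [p_eq_sum, Finset.sum_mul]
    refine Finset.sum_congr rfl fun _ _ => Finset.sum_congr rfl fun _ _ =>
      Finset.sum_congr rfl fun _ _ => ?_
    ring
  rw [fourier]
  simp only [hexp]
  rw [integral_finsetSum _ fun l' _ => integrable_finsetSum _ fun j _ =>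
    integrable_finsetSum _ fun j' _ => hint l' j j', Finset.sum_eq_single l]
  · rw [integral_finsetSum _ fun j _ => integrable_finsetSum _ fun j' _ => hint l j j',
      Finset.sum_eq_single k]
    · rw [integral_finsetSum _ fun j' _ => hint l k j', Finset.sum_eq_single k']
      · rw [integral_const_mul, integral_matCoeff_same, if_pos ⟨rfl, rfl⟩]
        rfl
      · intro j' _ hj
        rw [integral_const_mul, integral_matCoeff_same, if_neg fun h => hj h.2, mul_zero]
      · simp
    · intro j _ hj
      rw [integral_finsetSum _ fun j' _ => hint l j j']
      refine Finset.sum_eq_zero fun j' _ => ?_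
      rw [integral_const_mul, integral_matCoeff_same, if_neg fun h => hj h.1, mul_zero]
    · simp
  · intro l' _ hl
    rw [integral_finsetSum _ fun j _ => integrable_finsetSum _ fun j' _ => hint l' j j']
    refine Finset.sum_eq_zero fun j _ => ?_
    rw [integral_finsetSum _ fun j' _ => hint l' j j']
    refine Finset.sum_eq_zero fun j' _ => ?_
    rw [integral_const_mul, integral_matCoeff_of_ne C μ hl, mul_zero]
  · simp

/-- The number of non-trivial irreps. -/
def nontrivCount (l : C.Irreps) : ℕ :=
  open Classical in (Finset.univ.filter fun i : Fin C.depth => ¬ C.IsTriv i (l i)).card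

open Classical in
theorem truncSeries_p (L : ℕ) (wt : (l : C.Irreps) → C.Comps l → ℂ) (x : Outcome n d)
    (g : Fin C.depth → G) : C.truncSeries μ L wt (C.p x) g =
      ∑ l : C.Irreps with C.nontrivCount l ≤ L, ∑ k, ∑ k',
        (wt l k * C.matCoeff l k k' g) * C.pathCoeff x l k k' := by
  refine Finset.sum_congr rfl fun l _ => ?_
  rw [Finset.mul_sum]
  refine Finset.sum_congr rfl fun k _ => ?_
  rw [Finset.mul_sum]
  refine Finset.sum_congr rfl fun k' _ => ?_
  rw [fourier_p]
  have h := C.dims_ne_zero l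
  change (C.dims l : ℂ) * _ = _
  field_simp

end Fourier

end NoisyCircuit

namespace NoisyCircuit

variable {n d : ℕ} {G : Type*} [Group G] [TopologicalSpace G] (C : NoisyCircuit n d G)

/-! ## The truncated quasi-distribution as a sum over paths -/

open Classical in
theorem stepFam_eq_sum {i : ℕ} (he : ∀ l, C.IsTriv i l → ∀ k, C.e i l k = 1) (u : ℕ → G)
    (F : ℕ → Op n d) (b : ℕ) : C.stepFam u i F b = ∑ l, (C.irrepLayer i (u i) l * C.superW i)
      (if C.IsTriv i l then F b else shift F b) := by
  rw [stepFam_apply, proj_eq, nontrivLayer, LinearMap.sum_apply, LinearMap.sum_apply,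
    ← Finset.sum_add_distrib]
  refine Finset.sum_congr rfl fun l _ => ?_
  split_ifs with h
  · rw [C.irrepLayer_of_isTriv he (u i) h, LinearMap.zero_apply, add_zero]
    rfl
  · rw [LinearMap.zero_apply, zero_add]
    rfl

-- The budget recursion unrolled: each choice of irreps lowers the budget by its number of
-- non-trivial layers and drops out when the budget does not suffice. The projector joins the other
-- irreps in one sum because of `he`.
open Classical in
theorem prefixFam_apply_eq_sum (u : ℕ → G) (t : ℕ)
    (he : ∀ i < t, ∀ l, C.IsTriv i l → ∀ k, C.e i l k = 1) (F : ℕ → Op n d) (b : ℕ) :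
    C.prefixFam u t F b = ∑ l : (i : Fin t) → C.Irr i,
      if ∑ i : Fin t, (if C.IsTriv i (l i) then 0 else 1) ≤ b then
        (List.ofFn fun i : Fin t => C.irrepLayer i (u i) (l i) * C.superW i).prod
          (F (b - ∑ i : Fin t, (if C.IsTriv i (l i) then 0 else 1))) else 0 := by
  induction t generalizing F with
  | zero => simp [prefixFam]
  | succ t ih =>
    rw [prefixFam, LinearMap.comp_apply, ih fun i hi => he i (by omega),
      ← (Fin.snocEquiv fun i : Fin (t + 1) => C.Irr i).sum_comp, Fintype.sum_prod_type_right]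
    refine Finset.sum_congr rfl fun l _ => ?_
    simp only [C.stepFam_eq_sum (he t (by omega)), Fin.snocEquiv, Equiv.coe_fn_mk,
      Fin.sum_univ_castSucc, Fin.snoc_castSucc, Fin.snoc_last, List.ofFn_succ', List.concat_eq_append,
      List.prod_append, List.prod_singleton, Fin.val_castSucc, Fin.val_last]
    set c := ∑ i : Fin t, (if C.IsTriv i (l i) then 0 else 1)
    by_cases hc : c ≤ b
    · rw [if_pos hc, map_sum]
      refine Finset.sum_congr rfl fun j _ => ?_
      by_cases hj : C.IsTriv t j
      · simp only [if_pos hj, add_zero, if_pos hc]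
        rfl
      · simp only [if_neg hj]
        -- At `c = b` the budget is spent, and `shift` annihilates a further non-trivial layer.
        rcases hc.eq_or_lt with rfl | hlt
        · rw [Nat.sub_self, shift_zero, map_zero, map_zero, if_neg (by omega)]
        · rw [if_pos (by omega), show b - c = b - (c + 1) + 1 by omega, shift_succ]
          rfl
    · rw [if_neg hc]
      refine (Finset.sum_eq_zero fun j _ => if_neg ?_).symm
      omega

variable [NeZero d]

section Fourier

variable [IsTopologicalGroup G] [CompactSpace G] [MeasurableSpace G] [BorelSpace G]
  (μ : Measure G) [μ.IsHaarMeasure] [IsProbabilityMeasure μ]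

/-- The bridge between analysis and algorithm: the weighted Fourier series equals the product of
layers with a budget, which the program evaluates. -/
theorem pNoisyTrunc_eq (he : ∀ i < C.depth, ∀ l, C.IsTriv i l → ∀ k, C.e i l k = 1) (L : ℕ)
    (x : Outcome n d) (g : Fin C.depth → G) : C.pNoisyTrunc μ L x g =
      C.prefixFam (C.extend g) C.depth (fun _ => inputState n d) L x x := by
  classical
  have hcnt : ∀ l : C.Irreps,
      ∑ i : Fin C.depth, (if C.IsTriv i (l i) then 0 else 1) = C.nontrivCount l := by
    intro l
    rw [nontrivCount, Finset.card_filter]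
    exact Finset.sum_congr rfl fun i _ => by split_ifs <;> simp_all
  have hpath : ∀ l : C.Irreps, (List.ofFn fun i : Fin C.depth =>
      C.irrepLayer i (C.extend g i) (l i) * C.superW i).prod =
      ∑ k, ∑ k', (C.noiseWeight l k * C.matCoeff l k k' g) • C.pathOp l k k' := by
    intro l
    have h := C.prod_layers_of_irreps
      (fun i l k k' => C.e i l k * (C.basis i).coeff l (g i) k k') l
    simp only [Finset.prod_mul_distrib] at h
    refine Eq.trans ?_ h
    refine congrArg List.prod (congrArg List.ofFn (funext fun i => ?_))
    rw [show C.extend g i = g i from dif_pos i.2]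
    rfl
  rw [prefixFam_apply_eq_sum C _ _ he]
  simp only [hcnt, hpath]
  rw [← Finset.sum_filter, Matrix.sum_apply]
  refine (C.truncSeries_p μ L (fun l k => C.noiseWeight l k) x g).trans ?_
  refine Finset.sum_congr rfl fun l _ => ?_
  have h := C.sum_pathOp_apply (fun l k k' => C.noiseWeight l k * C.matCoeff l k k' g) {l} x
  rw [Finset.sum_singleton, Finset.sum_singleton] at h
  exact h.symm

theorem pNoisyTruncMarginal_eq (he : ∀ i < C.depth, ∀ l, C.IsTriv i l → ∀ k, C.e i l k = 1) (L : ℕ)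
    (y : Fin n → Option (Fin d)) (g : Fin C.depth → G) : C.pNoisyTruncMarginal μ L y g =
      diagSum n d y (C.prefixFam (C.extend g) C.depth (fun _ => inputState n d) L) := by
  classical
  rw [diagSum_apply]
  exact Finset.sum_congr rfl fun x _ => C.pNoisyTrunc_eq μ he L x g

/-! ## The truncation error -/

/-- Irreps with components. -/
abbrev CoeffIndex := (l : C.Irreps) × C.Comps l × C.Comps l

omit [NeZero d] in
theorem integral_norm_sq_matCoeff (a : C.CoeffIndex → ℂ) :
    ∫ g, ‖∑ I : C.CoeffIndex, a I * C.matCoeff I.1 I.2.1 I.2.2 g‖ ^ 2 ∂(Measure.pi fun _ => μ) =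
      ∑ I : C.CoeffIndex, ‖a I‖ ^ 2 * ((C.dims I.1 : ℝ)⁻¹) := by
  refine integral_norm_sq_sum (φ := fun (I : C.CoeffIndex) g => C.matCoeff I.1 I.2.1 I.2.2 g)
    (fun I J => C.integrable_matCoeff_mul μ I.1 J.1 _ _ _ _) ?_ ?_ a
  · rintro ⟨l, k, k'⟩
    refine (C.integral_matCoeff_same μ l k k' k k').trans ?_
    rw [if_pos ⟨rfl, rfl⟩]
    push_cast [dims]
    rfl
  · rintro ⟨l, k, k'⟩ ⟨l', j, j'⟩ h
    by_cases hl : l = l'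
    · subst hl
      refine (C.integral_matCoeff_same μ l k k' j j').trans (if_neg ?_)
      rintro ⟨rfl, rfl⟩
      exact h rfl
    · exact C.integral_matCoeff_of_ne μ hl k k' j j'

open Classical in
theorem p_sub_pTrunc (L : ℕ) (x : Outcome n d) (g : Fin C.depth → G) :
    C.p x g - C.pTrunc μ L x g = ∑ I : C.CoeffIndex,
      (if C.nontrivCount I.1 ≤ L then 0 else C.pathCoeff x I.1 I.2.1 I.2.2) *
        C.matCoeff I.1 I.2.1 I.2.2 g := by
  rw [pTrunc, truncSeries_p, p_eq_sum, sub_eq_iff_eq_add, Finset.sum_filter, Fintype.sum_sigma,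
    ← Finset.sum_add_distrib]
  refine Finset.sum_congr rfl fun l _ => ?_
  rw [Fintype.sum_prod_type]
  split_ifs with h
  · simp
  · simp [mul_comm]

open Classical in
theorem pNoisy_sub_pNoisyTrunc (L : ℕ) (x : Outcome n d) (g : Fin C.depth → G) :
    C.pNoisy x g - C.pNoisyTrunc μ L x g = ∑ I : C.CoeffIndex,
      (if C.nontrivCount I.1 ≤ L then 0 else
        C.noiseWeight I.1 I.2.1 * C.pathCoeff x I.1 I.2.1 I.2.2) *
        C.matCoeff I.1 I.2.1 I.2.2 g := by
  rw [pNoisyTrunc]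
  refine (congrArg (C.pNoisy x g - ·)
    (C.truncSeries_p μ L (fun l k => C.noiseWeight l k) x g)).trans ?_
  rw [pNoisy_eq_sum, sub_eq_iff_eq_add, Finset.sum_filter, Fintype.sum_sigma,
    ← Finset.sum_add_distrib]
  refine Finset.sum_congr rfl fun l _ => ?_
  rw [Fintype.sum_prod_type]
  split_ifs with h
  · simp
  · simp [mul_right_comm]

omit [IsTopologicalGroup G] [CompactSpace G] [MeasurableSpace G] [BorelSpace G] [NeZero d] in
theorem norm_noiseWeight_le {γ : ℝ} (h : C.Assumption2 γ) (l : C.Irreps) (k : C.Comps l) :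
    ‖C.noiseWeight l k‖ ≤ (1 - γ) ^ C.nontrivCount l := by
  classical
  rw [noiseWeight, norm_prod, nontrivCount, ← Finset.prod_const, Finset.prod_filter]
  refine Finset.prod_le_prod (fun _ _ => norm_nonneg _) fun i _ => ?_
  split_ifs with hi
  · rw [h.fixed i i.2 _ hi, norm_one]
  · exact h.penalised i i.2 _ hi _

/-- By Parseval both integrals are sums without cross terms over the same discarded indices. The
noisy terms differ only by `noiseWeight`, whose modulus is at most `(1 - γ) ^ L` there. -/
theorem integral_error_le {γ : ℝ} (h : C.Assumption2 γ) (L : ℕ) (x : Outcome n d) :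
    ∫ g, ‖C.pNoisy x g - C.pNoisyTrunc μ L x g‖ ^ 2 ∂(Measure.pi fun _ => μ) ≤
      ((1 - γ) ^ L) ^ 2 *
        ∫ g, ‖C.p x g - C.pTrunc μ L x g‖ ^ 2 ∂(Measure.pi fun _ => μ) := by
  classical
  simp only [p_sub_pTrunc, pNoisy_sub_pNoisyTrunc, integral_norm_sq_matCoeff]
  rw [Finset.mul_sum]
  refine Finset.sum_le_sum fun I _ => ?_
  rw [← mul_assoc]
  refine mul_le_mul_of_nonneg_right ?_ (by positivity)
  split_ifs with hI
  · simp
  · rw [norm_mul, mul_pow]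
    have h0 : 0 ≤ 1 - γ := sub_nonneg.2 h.gap_le_one
    have h1 : ‖C.noiseWeight I.1 I.2.1‖ ≤ (1 - γ) ^ L := (C.norm_noiseWeight_le h _ _).trans
      (pow_le_pow_of_le_one h0 (by linarith [h.gap_pos]) (by omega))
    gcongr

theorem truncError_le {γ c : ℝ} {L : ℕ} (h : C.Assumption2 γ)
    (hc : C.ResidualAnticoncentrates μ L c) : C.truncError μ L ≤ √c * (1 - γ) ^ L := by
  have h0 : 0 ≤ (1 - γ) ^ L := pow_nonneg (sub_nonneg.2 h.gap_le_one) L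
  set A : Outcome n d → ℝ := fun x =>
    ∫ g, ‖C.p x g - C.pTrunc μ L x g‖ ^ 2 ∂(Measure.pi fun _ => μ) with hA
  have hA0 : ∀ x, 0 ≤ A x := fun x => integral_nonneg fun g => by positivity
  have hd : (0 : ℝ) < (d : ℝ) ^ n := pow_pos (Nat.cast_pos.2 (NeZero.pos d)) n
  have h1 : C.truncError μ L ≤ ∑ x, (1 - γ) ^ L * √(A x) := by
    refine Finset.sum_le_sum fun x _ => ?_
    refine (Real.sqrt_le_sqrt (C.integral_error_le μ h L x)).trans_eq ?_
    rw [Real.sqrt_mul (by positivity), Real.sqrt_sq h0]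
  have h2 : (∑ x, √(A x)) ^ 2 ≤ c := by
    -- Cauchy–Schwarz over the outcomes; their number `d ^ n` cancels the denominator in the
    -- anti-concentration bound.
    calc (∑ x, √(A x)) ^ 2 ≤ (Finset.univ : Finset (Outcome n d)).card * ∑ x, √(A x) ^ 2 :=
          sq_sum_le_card_mul_sum_sq
      _ = (d : ℝ) ^ n * ∑ x, A x := by
          simp [Real.sq_sqrt (hA0 _)]
      _ ≤ (d : ℝ) ^ n * (c / (d : ℝ) ^ n) := by
          gcongr
          exact hc
      _ = c := mul_div_cancel₀ c hd.ne'
  rw [← Finset.mul_sum] at h1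
  refine h1.trans ?_
  rw [mul_comm]
  gcongr
  exact Real.le_sqrt_of_sq_le h2

end Fourier

end NoisyCircuit

/-! ## The running time is polynomial -/

theorem leafTime_le {q L cMat cEval : ℕ} (hL : L ≤ q) (hMat : cMat ≤ q) (hEval : cEval ≤ q)
    (hq : 1 ≤ q) : NoisyCircuit.leafTime L cMat cEval ≤ 503 * q ^ 2 := by
  have h1 : L * (2 * cMat + 200) ≤ q * (2 * q + 200) := by gcongr
  have h2 : q ≤ q ^ 2 := Nat.le_self_pow two_ne_zero q
  simp only [NoisyCircuit.leafTime]
  nlinarith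

/-- The parameters `a` and `k` let one estimate serve both searches: `Λ` is the time of a leaf on
the right, and on the left it contains the whole search to the right, with `a` including a power of
`s * dmax`. -/
theorem baseTime_le {q D s cCon cMat Λ a k : ℕ} (hD : D ≤ q) (hs : s ≤ q) (hCon : cCon ≤ q)
    (hMat : cMat ≤ q) (hq : 1 ≤ q) (hΛ : Λ ≤ a * q ^ (k + 1)) (ha : 1 ≤ a) :
    NoisyCircuit.baseTime D s cCon cMat Λ ≤ 1300 * a * q ^ (k + 2) := by
  have h1 : D * (cCon + 300) ≤ 301 * (a * q ^ (k + 2)) := by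
    calc D * (cCon + 300) ≤ q * (q + 300 * q) := by gcongr; omega
      _ = 301 * (1 * (1 * q ^ 2)) := by ring
      _ ≤ 301 * (a * (q ^ k * q ^ 2)) := by gcongr; exact Nat.one_le_pow _ _ hq
      _ = 301 * (a * q ^ (k + 2)) := by ring
  have h2 : s * (Λ + cMat + 600) ≤ 602 * (a * q ^ (k + 2)) := by
    calc s * (Λ + cMat + 600) ≤ q * (a * q ^ (k + 1) + q + 600 * q) := by gcongr; omega
      _ = a * q ^ (k + 2) + 601 * (1 * (1 * q ^ 2)) := by ring
      _ ≤ a * q ^ (k + 2) + 601 * (a * (q ^ k * q ^ 2)) := by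
          gcongr; exact Nat.one_le_pow _ _ hq
      _ = 602 * (a * q ^ (k + 2)) := by ring
  have h3 : Λ ≤ a * q ^ (k + 2) := hΛ.trans (by gcongr; omega)
  have h4 : 1 ≤ a * q ^ (k + 2) := Nat.mul_pos ha (Nat.one_le_pow _ _ hq)
  simp only [NoisyCircuit.baseTime]
  linarith

theorem searchTime_base_le {q D s cCon cMat Λ a k L X : ℕ} (hD : D ≤ q) (hs : s ≤ q)
    (hCon : cCon ≤ q) (hMat : cMat ≤ q) (hq : 1 ≤ q) (hL : L ≤ q) (hΛ : Λ ≤ a * q ^ (k + 1))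
    (ha : 1 ≤ a) (hX : 1 ≤ X) :
    NoisyCircuit.searchTime (NoisyCircuit.baseTime D s cCon cMat Λ) X L ≤
      3400 * (a * X ^ L) * q ^ (k + 3) := by
  have h1 : 1 ≤ a * q ^ (k + 2) := Nat.mul_pos ha (Nat.one_le_pow _ _ hq)
  calc _ ≤ (L + 1) * (NoisyCircuit.baseTime D s cCon cMat Λ + 400) * X ^ L :=
        NoisyCircuit.searchTime_le hX L
    _ ≤ (q + q) * (1300 * a * q ^ (k + 2) + 400 * (a * q ^ (k + 2))) * X ^ L := by
        gcongr
        · exact baseTime_le hD hs hCon hMat hq hΛ ha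
        · omega
    _ = 3400 * (a * X ^ L) * q ^ (k + 3) := by ring

/-- A polynomial bound for the running time of the search. -/
theorem totalTime_le {q D s dmax cMat cCon cEval L r cFull : ℕ} (hD : D ≤ q) (hs : s ≤ q)
    (hCon : cCon ≤ q) (hMat : cMat ≤ q) (hEval : cEval ≤ q) (hq : 1 ≤ q) (hL : L ≤ q)
    (hX : 1 ≤ s * dmax) (hD1 : 1 ≤ D) (hr : 1 ≤ r) (hFull : 1 ≤ cFull) :
    D * NoisyCircuit.windowTime D s dmax cMat cCon cEval L r cFull + 200 ≤
      6000000000 * q ^ 6 * (s * dmax) ^ (2 * L) * D * r * cFull := by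
  set X := s * dmax with hXdef
  have hp : 1 ≤ X ^ L := Nat.one_le_pow _ _ hX
  -- Each search multiplies the constant of its leaf by `3400`: here `3400 * 503`, then `201` is
  -- added for `cEval + 200`, and `3400 * 1710401` appears in `h3`.
  have h1 : NoisyCircuit.rightTime D s dmax cMat cCon cEval L L ≤ 1710200 * X ^ L * q ^ 4 := by
    refine (searchTime_base_le (k := 1) hD hs hCon hMat hq hL (leafTime_le hL hMat hEval hq)
      (by norm_num) hX).trans_eq ?_
    ring
  have h2 : NoisyCircuit.rightTime D s dmax cMat cCon cEval L L + cEval + 200 ≤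
      (1710401 * X ^ L) * q ^ (3 + 1) := by
    have h3 : q ≤ X ^ L * q ^ 4 := by
      calc q = 1 * q ^ 1 := by ring
        _ ≤ X ^ L * q ^ 4 := by gcongr; omega
    change _ ≤ 1710401 * X ^ L * q ^ 4
    rw [mul_assoc] at h1 ⊢
    omega
  have h3 : NoisyCircuit.leftTime D s dmax cMat cCon cEval L L ≤
      5815363400 * X ^ (2 * L) * q ^ 6 := by
    refine (searchTime_base_le (k := 3) hD hs hCon hMat hq hL h2
      (Nat.mul_pos (by norm_num) hp) hX).trans_eq ?_
    ring
  have hK : 1 ≤ q ^ 6 * X ^ (2 * L) :=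
    Nat.mul_pos (Nat.one_le_pow _ _ hq) (Nat.one_le_pow _ _ hX)
  set K := q ^ 6 * X ^ (2 * L) with hKdef
  have h4 : NoisyCircuit.windowTime D s dmax cMat cCon cEval L r cFull ≤
      5815363800 * K * r * cFull := by
    have h5 : cFull ≤ K * r * cFull := Nat.le_mul_of_pos_left _ (Nat.mul_pos hK hr)
    have h6 : r * (NoisyCircuit.leftTime D s dmax cMat cCon cEval L L + 100) ≤
        5815363500 * (K * r * cFull) := by
      calc _ ≤ r * (5815363400 * X ^ (2 * L) * q ^ 6 + 100 * K) * cFull := by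
            refine le_trans ?_ (Nat.le_mul_of_pos_right _ hFull)
            gcongr
            omega
        _ = 5815363500 * (K * r * cFull) := by rw [hKdef]; ring
    have h7 : 1 ≤ K * r * cFull := Nat.mul_pos (Nat.mul_pos hK hr) hFull
    rw [NoisyCircuit.windowTime]
    linarith
  have h5 : 1 ≤ D * (K * r * cFull) :=
    Nat.mul_pos hD1 (Nat.mul_pos (Nat.mul_pos hK hr) hFull)
  calc _ ≤ D * (5815363800 * K * r * cFull) + 200 * (D * (K * r * cFull)) := by
        gcongr
        omega
    _ = 5815364000 * (D * (K * r * cFull)) := by ring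
    _ ≤ 6000000000 * (D * (K * r * cFull)) := by gcongr; norm_num
    _ = _ := by rw [hKdef]; ring

end OpTrunc

end

theorem theorem2 :
    ∃ P : OpTrunc.Program, ∀ Q : Polynomial ℕ, ∃ R : Polynomial ℕ,
      ∀ (n d : ℕ) [NeZero d] (G : Type*) [Group G] [TopologicalSpace G] [IsTopologicalGroup G]
        [CompactSpace G] [T2Space G] [MeasurableSpace G] [BorelSpace G] (μ : Measure G)
        [μ.IsHaarMeasure] [IsProbabilityMeasure μ] (C : OpTrunc.NoisyCircuit n d G)
        (γ : ℝ) (L M s dmax r cMat cCon cFull cEval : ℕ),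
        C.Assumption0 L dmax → C.Assumption1 s → C.Assumption2 γ → C.Assumption3 M r →
        (L + 1) * (M + 2) ≤ C.depth →
        (∀ c ∈ [C.depth, s, dmax, cMat, cCon, cEval], c ≤ Q.eval n) → 0 < cFull →
        (∀ (g : Fin C.depth → G) (y : Fin n → Option (Fin d)) (O : OpTrunc.Oracle),
          C.Subroutines L M g y cMat cCon cFull cEval O →
          ∃ t, P.Outputs O (OpTrunc.Val.ofNats [C.depth, L, M, dmax])
              (.num (C.pNoisyTruncMarginal μ L y g)) t ∧
            t ≤ R.eval n * (s * dmax) ^ (2 * L) * C.depth * r * cFull ∧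
            (r ≤ Q.eval n → cFull ≤ Q.eval n →
              t ≤ C.depth * R.eval n * (s * dmax) ^ (2 * L))) ∧
        (∀ c : ℝ, C.ResidualAnticoncentrates μ L c →
          C.truncError μ L ≤ √c * (1 - γ) ^ L) := by
  -- `Q ^ 6` pays for the two searches; two further powers absorb `r` and `cFull` in the second time
  -- bound.
  refine ⟨OpTrunc.searchProgram, fun Q => ⟨Polynomial.C 6000000000 * Q ^ 8, ?_⟩⟩
  intro n d _ G _ _ _ _ _ _ _ μ _ _ C γ L M s dmax r cMat cCon cFull cEval h0 h1 h2 h3 hL hQ hFull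
  refine ⟨fun g y O hS => ?_, fun c hc => C.truncError_le μ h2 hc⟩
  have hM : M + 2 ≤ C.depth := le_trans (Nat.le_mul_of_pos_left _ (Nat.succ_pos L)) hL
  have hD : 0 < C.depth := by omega
  have hr := OpTrunc.NoisyCircuit.one_le_of_assumption3 h3 hM
  have hX : 1 ≤ s * dmax := Nat.mul_pos (OpTrunc.NoisyCircuit.one_le_of_assumption1 h1 hD)
    (OpTrunc.NoisyCircuit.one_le_of_assumption0 h0 hD)
  simp only [List.forall_mem_cons] at hQ
  obtain ⟨hDq, hs, -, hMat, hCon, hEval, -⟩ := hQ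
  -- The truncation parameter needs no polynomial bound of its own, since it lies below the depth.
  have hLq : L ≤ Q.eval n :=
    (Nat.le_succ L).trans <| (Nat.le_mul_of_pos_right _ (Nat.succ_pos _)).trans (hL.trans hDq)
  have hq : 1 ≤ Q.eval n := hD.trans_le hDq
  obtain ⟨t, ht, hout⟩ := OpTrunc.NoisyCircuit.eval_search h0 h1 h3 hS hL
  have ht := ht.trans (OpTrunc.totalTime_le hDq hs hCon hMat hEval hq hLq hX hD hr hFull)
  simp only [Polynomial.eval_mul, Polynomial.eval_pow, Polynomial.eval_C]
  refine ⟨t, ?_, ht.trans ?_, fun hrq hFq => ht.trans ?_⟩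
  · rw [C.pNoisyTruncMarginal_eq μ h2.fixed L y g]
    exact hout
  · gcongr
    norm_num
  · calc _ = 6000000000 * Q.eval n ^ 6 * (s * dmax) ^ (2 * L) * C.depth * (r * cFull) := by ring
      _ ≤ 6000000000 * Q.eval n ^ 6 * (s * dmax) ^ (2 * L) * C.depth *
          (Q.eval n * Q.eval n) := by gcongr
      _ = _ := by ring
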